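/- All germs are formal germs over $\mathbb{C}$. Put $\mathcal{O}_X=\mathbb{C}[[x,y,z]]$, the functions on a smooth 3-fold germ $P\in X$, and $\mathcal{O}_{\mathbb{C}^2}=\mathbb{C}[[u,v]]$. Let $P\in S=V(f)\subset X$ be a Du Val singularity of type $T\in\{A_n\,(n\ge1),\,D_n\,(n\ge4),\,E_6,E_7,E_8\}$, i.e. up to a unit and an automorphism of $\mathcal{O}_X$ the equation $f$ is, respectively, $x^2+y^2+z^{n+1}$, $x^2+y^2z+z^{n-1}$, $x^2+y^3+z^4$, $x^2+y^3+yz^3$ or $x^2+y^3+z^5$. Let $G\subset \mathrm{SL}(2,\mathbb{C})$ be a finite group and $\pi\colon\mathbb{C}^2\to S$ a map identifying $S$ with $\mathbb{C}^2/G$, i.e. inducing an isomorphism $\mathcal{O}_X/(f)\cong(\mathcal{O}_{\mathbb{C}^2})^G$. Let $P\in\Gamma\subset S$ be a reduced curve germ, with ideal $I_\Gamma\subset\mathcal{O}_X$. Let $\gamma\in\mathcal{O}_{\mathbb{C}^2}$ be an orbifold equation of $\Gamma$ and $\rho\colon G\to\mathbb{C}^\times$ the associated 1-dimensional representation: $(\gamma)$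 is the ideal of the reduced preimage $\pi^{-1}(\Gamma)\subset\mathbb{C}^2$, that is $(\gamma)=\sqrt{I_\Gamma\mathcal{O}_{\mathbb{C}^2}}$, and ${}^a\gamma=\rho(a)\gamma$ for all $a\in G$, where $({}^aq)(p)=q(a^{-1}p)$. Let $M_\rho=\{q\in\mathcal{O}_{\mathbb{C}^2} : {}^aq=\rho(a)q\ \ \forall a\in G\}$ be the $\mathcal{O}_X/(f)$-module of $\rho$-semi-invariants, and let $(\phi,\psi)$ be a matrix factorisation of $f$ by $2\times2$ matrices over $\mathcal{O}_X$ which resolves $M_\rho$: $\phi\psi=\psi\phi=fI_2$, and $M_\rho$ is the cokernel of $\phi\colon\mathcal{O}_X^{\oplus2}\to\mathcal{O}_X^{\oplus2}$ ($\phi$ acting on column vectors). Write $I(\phi)\subset\mathcal{O}_X$ for the ideal generated by the entries of $\phi$. Then: 1. There are $g,h\in\mathcal{O}_X$ such that $I_\Gamma$ is generated by the $2\times2$ minors of the $2\times3$ matrix $\left(\phi \;\middle|\; \begin{matrix} g\\ h\end{matrix}\right)$. 2. Suppose moreover that $S$ is a general Du Val section through $\Gamma$, in the sense that the general hypersurface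 section of $X$ through $\Gamma$ is Du Val of the same type $T$ as $S$; that is, for all generators $\xi_1,\dots,\xi_k$ of $I_\Gamma$ there is a nonempty Zariski open set of $c\in\mathbb{C}^k$ for which $V(\sum_i c_i\xi_i)$ is a Du Val singularity of type $T$. Then $g,h\in I(\phi)$ for all $g,h\in\mathcal{O}_X$ as in part 1. -/

import Mathlib

/-- `𝒪_X`: functions on the germ `(P ∈ X) ≅ (0 ∈ 𝔸³)` of a smooth 3-fold, in formal coordinates
`x = X 0`, `y = X 1`, `z = X 2`. -/
abbrev OX : Type := MvPowerSeries (Fin 3) ℂ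

/-- Functions on the germ `(0 ∈ ℂ²)`, in formal coordinates `u = X 0`, `v = X 1`. -/
abbrev OC2 : Type := MvPowerSeries (Fin 2) ℂ

/-! ### Du Val singularities -/

/-- The labels of the Du Val singularities. -/
inductive DuValType : Type
  | A (n : ℕ) (hn : 1 ≤ n)
  | D (n : ℕ) (hn : 4 ≤ n)
  | E6
  | E7
  | E8

/-- The normal form of the equation of a Du Val singularity of a given type. -/
noncomputable def DuValType.equation : DuValType → OX
  | .A n _ => MvPowerSeries.X 0 ^ 2 + MvPowerSeries.X 1 ^ 2 + MvPowerSeries.X 2 ^ (n + 1)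
  | .D n _ => MvPowerSeries.X 0 ^ 2 + MvPowerSeries.X 1 ^ 2 * MvPowerSeries.X 2
      + MvPowerSeries.X 2 ^ (n - 1)
  | .E6 => MvPowerSeries.X 0 ^ 2 + MvPowerSeries.X 1 ^ 3 + MvPowerSeries.X 2 ^ 4
  | .E7 => MvPowerSeries.X 0 ^ 2 + MvPowerSeries.X 1 ^ 3
      + MvPowerSeries.X 1 * MvPowerSeries.X 2 ^ 3
  | .E8 => MvPowerSeries.X 0 ^ 2 + MvPowerSeries.X 1 ^ 3 + MvPowerSeries.X 2 ^ 5

/-- The germ `V(f) ⊂ X` is a Du Val singularity of type `T`: some automorphism of the germ `X`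
carries the hypersurface of the normal form to `V(f)`, so that the equations agree up to a unit. -/
def IsDuValOfType (T : DuValType) (f : OX) : Prop :=
  ∃ σ : OX ≃ₐ[ℂ] OX, Associated f (σ T.equation)

/-- The germ `V(f) ⊂ X` is a Du Val singularity. -/
def IsDuVal (f : OX) : Prop := ∃ T, IsDuValOfType T f

/-! ### The group quotient -/

/-- The linear coordinate change `p ↦ g⁻¹ p` of `ℂ²`, as a pair of power series. -/
noncomputable def linearForms (g : Matrix.SpecialLinearGroup (Fin 2) ℂ) : Fin 2 → OC2 :=
  fun i => ∑ j, (g⁻¹).1 i j • MvPowerSeries.X j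

theorem hasSubst_linearForms (g : Matrix.SpecialLinearGroup (Fin 2) ℂ) :
    MvPowerSeries.HasSubst (linearForms g) :=
  MvPowerSeries.hasSubst_of_constantCoeff_zero fun i => by
    simp [linearForms, MvPowerSeries.smul_eq_C_mul]

/-- The action of `SL(2, ℂ)` on functions on `ℂ²`: `(ᵍh)(p) = h(g⁻¹ p)`. -/
noncomputable def act (g : Matrix.SpecialLinearGroup (Fin 2) ℂ) (h : OC2) : OC2 :=
  MvPowerSeries.subst (linearForms g) h

/-- `M_ρ`: the `ρ`-semi-invariant functions on `ℂ²`, those `h` with `ᵍh = ρ(g) h` for all `g ∈ G`.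
For `ρ = 1` these are the `G`-invariant functions. -/
def semiInvariants (G : Subgroup (Matrix.SpecialLinearGroup (Fin 2) ℂ)) (ρ : G →* ℂˣ) : Set OC2 :=
  {h | ∀ g : G, act g h = (ρ g : ℂ) • h}

/-- `π` (given by pull-back of functions) identifies `S = V(f) ⊂ X` with the quotient `ℂ²/G`, that
is, it induces an isomorphism `𝒪_X / (f) ≅ (𝒪_{ℂ²})^G`. -/
structure IsQuotientMap (G : Subgroup (Matrix.SpecialLinearGroup (Fin 2) ℂ)) (f : OX)
    (π : OX →ₐ[ℂ] OC2) : Prop where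
  ker_eq : RingHom.ker π = Ideal.span {f}
  range_eq : Set.range π = semiInvariants G 1

/-! ### Curves in Du Val singularities -/

/-- `I ⊂ 𝒪_X` is the ideal of a reduced curve germ `P ∈ Γ ⊂ X`. -/
structure IsReducedCurve (I : Ideal OX) : Prop where
  isRadical : I.IsRadical
  dim_eq : ringKrullDim (OX ⧸ I) = 1

/-- `γ` is an orbifold equation, with associated 1-dimensional representation `ρ`, of the curve `Γ`
with ideal `I`: the reduced preimage `C = π⁻¹(Γ) ⊂ ℂ²` is defined by the single equation `γ`, and
`ᵍγ = ρ(g) γ` for all `g ∈ G`. -/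
structure IsOrbifoldEquation (G : Subgroup (Matrix.SpecialLinearGroup (Fin 2) ℂ)) (ρ : G →* ℂˣ)
    (π : OX →ₐ[ℂ] OC2) (I : Ideal OX) (γ : OC2) : Prop where
  span_eq : Ideal.span {γ} = (I.map π).radical
  semiInvariant : γ ∈ semiInvariants G ρ

/-- `(φ, ψ)` is a matrix factorisation of `f` which resolves `M_ρ`: we have `φψ = ψφ = f I₂`, and
there are elements `α₀, α₁` generating `M_ρ` as an `𝒪_S`-module (`𝒪_X` acting through `π`) whose
module of relations is the image of `φ`, i.e. `M_ρ ← 𝒪² ← 𝒪²` with second map `φ` is exact.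
(Since `φψ = ψφ = f`, this then continues over `𝒪_S = 𝒪_X / (f)` to the 2-periodic resolution
with maps `φ, ψ, φ, …`.) -/
structure IsMatrixFactorisation (G : Subgroup (Matrix.SpecialLinearGroup (Fin 2) ℂ)) (ρ : G →* ℂˣ)
    (π : OX →ₐ[ℂ] OC2) (f : OX) (φ ψ : Matrix (Fin 2) (Fin 2) OX) : Prop where
  mul_eq : φ * ψ = f • (1 : Matrix (Fin 2) (Fin 2) OX)
  mul_eq' : ψ * φ = f • (1 : Matrix (Fin 2) (Fin 2) OX)
  exact_seq : ∃ α : Fin 2 → OC2,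
    semiInvariants G ρ = Set.range (fun a : Fin 2 → OX => ∑ i, π (a i) * α i) ∧
    ∀ a : Fin 2 → OX, ∑ i, π (a i) * α i = 0 ↔ ∃ b : Fin 2 → OX, a = φ.mulVec b

/-- `I(φ)`: the ideal generated by the entries of `φ`. -/
noncomputable def entriesIdeal (φ : Matrix (Fin 2) (Fin 2) OX) : Ideal OX :=
  Ideal.span (Set.range fun p : Fin 2 × Fin 2 => φ p.1 p.2)

/-- The `2 × 3` matrix `(φ | (g, h)ᵀ)`. -/
def augmented (φ : Matrix (Fin 2) (Fin 2) OX) (g h : OX) : Matrix (Fin 2) (Fin 3) OX :=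
  !![φ 0 0, φ 0 1, g; φ 1 0, φ 1 1, h]

/-- The ideal generated by the three `2 × 2` minors of a `2 × 3` matrix. -/
noncomputable def minorsIdeal (M : Matrix (Fin 2) (Fin 3) OX) : Ideal OX :=
  Ideal.span (Set.range fun e : Fin 2 ↪o Fin 3 => (M.submatrix id e).det)

/-- The property `Prp` holds for the general member of the ideal `I`: whenever `ξ₁, …, ξ_k`
generate `I`, it holds for `c₁ ξ₁ + ⋯ + c_k ξ_k` for all `c` in a nonempty Zariski open subset of
`ℂ^k`. -/
def HoldsForGeneralMember (I : Ideal OX) (Prp : OX → Prop) : Prop :=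
  ∀ (k : ℕ) (ξ : Fin k → OX), Ideal.span (Set.range ξ) = I →
    ∃ p : MvPolynomial (Fin k) ℂ, p ≠ 0 ∧
      ∀ c : Fin k → ℂ, MvPolynomial.eval c p ≠ 0 → Prp (∑ i, c i • ξ i)

/-- `S = V(f)` is a general Du Val section through the curve with ideal `I`: it contains the curve,
it is Du Val, and the general hypersurface through the curve is Du Val of the same type as `S`. -/
def IsGeneralDuValSection (I : Ideal OX) (f : OX) : Prop :=
  f ∈ I ∧ ∃ T, IsDuValOfType T f ∧ HoldsForGeneralMember I (IsDuValOfType T)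

/-! Part 1. Write γ = c₀α₀ + c₁α₁ in the generators of M_ρ whose relations are the columns of φ; the
third column is (c₀, c₁). Averaging over G shows that a ∈ I_Γ if and only if γ ∣ π(a). If π(a) = γq,
then q is ρ⁻¹-semi-invariant, so each qαᵢ comes from 𝒪_X. Since M_ρ has rank one, det φ is f up to a
unit (`IsMatrixFactorisation.associated_det`), and Cramer's rule then expresses a through the
minors. Conversely, the pull-back of a minor containing the third column, multiplied by any element
of M_ρ, is divisible by γ. The ideal generated by M_ρ contains two coprime elements
(`orbitProd_mem`, `exists_coprime_orbitProd`), so γ divides the minor itself.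

Part 2. A coordinate change and a unit make det φ the normal form of type T. Let L, R be the two
other minors. The general c₀ det φ + c₁L + c₂R has type T, and the partial derivatives of det φ lie
in I(φ). The types A, D and E₇ are detected by a smooth formal arc along which the equation and its
gradient vanish to high order.

Type A_n: deforming det φ inside the family moves the arc by a bounded amount, and a first-order
comparison shows that L and R vanish to order n + 1 on the z-axis (`dvd_of_family_A`). There the
Cramer identities g·det φ = φ₀₁L - φ₀₀R and h·det φ = φ₁₁L - φ₁₀R can be divided by det φ = zⁿ⁺¹.
Since x, y, zⁿ ∈ I(φ), this gives g, h ∈ I(φ).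

Types D and E: the Hessian has rank one, so the Hessians of L and R at the origin are multiples of
that of x². A unit entry of φ makes I(φ) everything. Otherwise ∂ₓφ(0) has determinant 1, and g, h
vanish at the origin and in every tangent direction of the plane x = 0 that φ kills. If an entry of
φ has a nonzero z-derivative, this first-order information suffices
(`IsGeneralNormal.mem_of_transversal`). If not, either x, y, z² ∈ I(φ) and it suffices again, or
I(φ) = (x, s, z^k) with s = y - z²Q(z) and k ≥ 3. If then g or h had order j < k on the branch x = s
= 0, the general member would contain x² and x z^j with unit coefficients. Completing the square
leaves z^(2j), so its type would be at most about D_(2j+1), or E₆ in place of E₇. The order of det φ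
on the branch forces T to be D_n with n ≥ 2k or E₇ with j = 2, and `IsGeneralNormal.false_of_branch`
turns this into a contradiction by following the arc of type T. -/

namespace DuVal

/-! ### The local ring of the 3-fold germ: order, derivations, formal arcs. -/

open MvPowerSeries

/-- The coordinates on the 3-fold germ. -/
noncomputable abbrev xv (i : Fin 3) : OX := MvPowerSeries.X i

/-- Value at the origin. -/
noncomputable abbrev cc : OX →+* ℂ := MvPowerSeries.constantCoeff

/-- Partial derivatives. -/
noncomputable abbrev pd (i : Fin 3) : Derivation ℂ OX OX := MvPowerSeries.pderiv ℂ i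

/-- The maximal ideal of the 3-fold germ. -/
noncomputable abbrev maxId : Ideal OX := RingHom.ker cc

theorem mem_maxId {h : OX} : h ∈ maxId ↔ cc h = 0 := RingHom.mem_ker

theorem isUnit_iff_cc {h : OX} : IsUnit h ↔ cc h ≠ 0 := by
  rw [MvPowerSeries.isUnit_iff_constantCoeff, isUnit_iff_ne_zero]

/-- The power series with given coefficients. -/
def ofCoeff (c : (Fin 3 →₀ ℕ) → ℂ) : OX := c

theorem coeff_ofCoeff (c : (Fin 3 →₀ ℕ) → ℂ) (m : Fin 3 →₀ ℕ) :
    MvPowerSeries.coeff m (ofCoeff c) = c m := rfl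

/-- Monomials are sorted by the first variable they contain: x, else y, else z. -/
theorem exists_decomp {h : OX} (hh : cc h = 0) :
    ∃ a b c : OX, h = xv 0 * a + xv 1 * b + xv 2 * c := by
  have h0 : xv 0 ∣ ofCoeff (fun m => if m 0 = 0 then 0 else coeff m h) := by
    rw [MvPowerSeries.X_dvd_iff]
    intro m hm
    simp [coeff_ofCoeff, hm]
  have h1 : xv 1 ∣ ofCoeff (fun m => if m 0 = 0 ∧ m 1 ≠ 0 then coeff m h else 0) := by
    rw [MvPowerSeries.X_dvd_iff]
    intro m hm
    simp [coeff_ofCoeff, hm]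
  have h2 : xv 2 ∣ ofCoeff (fun m => if m 0 = 0 ∧ m 1 = 0 then coeff m h else 0) := by
    rw [MvPowerSeries.X_dvd_iff]
    intro m hm
    rw [coeff_ofCoeff]
    split_ifs with h'
    · have : m = 0 := by
        ext i; fin_cases i <;> simp_all
      rw [this]; exact hh
    · rfl
  obtain ⟨a, ha⟩ := h0
  obtain ⟨b, hb⟩ := h1
  obtain ⟨c, hc⟩ := h2
  refine ⟨a, b, c, ?_⟩
  rw [← ha, ← hb, ← hc]
  ext m
  rw [map_add, map_add, coeff_ofCoeff, coeff_ofCoeff, coeff_ofCoeff]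
  split_ifs <;> simp_all

theorem xv_mem (i : Fin 3) : xv i ∈ maxId := by simp

theorem cc_C (r : ℂ) : cc (MvPowerSeries.C r) = r := MvPowerSeries.constantCoeff_C r

theorem cc_smul (r : ℂ) (h : OX) : cc (r • h) = r * cc h := by
  rw [MvPowerSeries.smul_eq_C_mul, map_mul, cc_C]

theorem sub_cc_mem (h : OX) : h - MvPowerSeries.C (cc h) ∈ maxId := by
  rw [mem_maxId, map_sub, cc_C, sub_self]

theorem pd_xv (i j : Fin 3) : pd i (xv j) = if i = j then 1 else 0 := by
  classical
  rw [pd, MvPowerSeries.pderiv_X]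
  simp [Pi.single_apply, eq_comm]

theorem pd_mul (i : Fin 3) (a b : OX) : pd i (a * b) = a * pd i b + b * pd i a := by
  rw [Derivation.leibniz]; simp

theorem derivation_mul (d : Derivation ℂ OX OX) (a b : OX) : d (a * b) = a * d b + b * d a := by
  rw [Derivation.leibniz]; simp

theorem derivation_C (d : Derivation ℂ OX OX) (r : ℂ) : d (MvPowerSeries.C r) = 0 := by
  rw [MvPowerSeries.c_eq_algebraMap]; exact d.map_algebraMap r

/-- Derivations lower the order by at most one. -/
theorem derivation_mem_maxId (d : Derivation ℂ OX OX) {h : OX} (hh : h ∈ maxId ^ 2) :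
    d h ∈ maxId := by
  rw [pow_two] at hh
  refine Submodule.mul_induction_on hh ?_ ?_
  · intro a ha b hb
    rw [derivation_mul]
    exact add_mem (Ideal.mul_mem_right _ _ ha) (Ideal.mul_mem_right _ _ hb)
  · intro a b ha hb
    rw [map_add]; exact add_mem ha hb

theorem mem_sq_iff {h : OX} : h ∈ maxId ^ 2 ↔ cc h = 0 ∧ ∀ i, cc (pd i h) = 0 := by
  constructor
  · intro hh
    exact ⟨mem_maxId.1 (Ideal.pow_le_self two_ne_zero hh),
      fun i => mem_maxId.1 (derivation_mem_maxId _ hh)⟩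
  · rintro ⟨h0, h1⟩
    obtain ⟨a, b, c, rfl⟩ := exists_decomp h0
    have e0 := h1 0
    have e1 := h1 1
    have e2 := h1 2
    simp [pd_mul] at e0 e1 e2
    rw [pow_two]
    exact add_mem (add_mem (Ideal.mul_mem_mul (xv_mem 0) (mem_maxId.2 e0))
      (Ideal.mul_mem_mul (xv_mem 1) (mem_maxId.2 e1)))
      (Ideal.mul_mem_mul (xv_mem 2) (mem_maxId.2 e2))

/-- An algebra homomorphism to a local algebra with residue field `ℂ` is local. -/
theorem residue_algHom {B : Type*} [CommRing B] [Algebra ℂ B] (ε : B →ₐ[ℂ] ℂ) (θ : OX →ₐ[ℂ] B)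
    (h : OX) : ε (θ h) = cc h := by
  by_contra hne
  -- If the two values differed, h minus the constant ε(θ h) would be a unit sent to zero by ε ∘ θ.
  have hu : IsUnit (h - algebraMap ℂ OX (ε (θ h))) := by
    rw [isUnit_iff_cc, map_sub, ← MvPowerSeries.c_eq_algebraMap, cc_C]
    exact sub_ne_zero.2 (Ne.symm hne)
  have hu' := (hu.map θ).map ε
  rw [map_sub, map_sub, AlgHom.commutes, AlgHom.commutes] at hu'
  simp at hu'

/-- The value at the origin of a formal arc. -/
noncomputable def psResidue : PowerSeries ℂ →ₐ[ℂ] ℂ :=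
  { PowerSeries.constantCoeff with
    commutes' := fun r => by simp }

noncomputable def ccAlg : OX →ₐ[ℂ] ℂ :=
  { (cc : OX →+* ℂ) with
    commutes' := fun r => by
      change cc (algebraMap ℂ OX r) = r
      rw [← MvPowerSeries.c_eq_algebraMap, cc_C] }

theorem constantCoeff_arc (θ : OX →ₐ[ℂ] PowerSeries ℂ) (h : OX) :
    PowerSeries.constantCoeff (θ h) = cc h := residue_algHom psResidue θ h

theorem cc_algHom (σ : OX →ₐ[ℂ] OX) (h : OX) : cc (σ h) = cc h := residue_algHom ccAlg σ h

theorem X_dvd_arc (θ : OX →ₐ[ℂ] PowerSeries ℂ) {h : OX} (hh : h ∈ maxId) :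
    PowerSeries.X ∣ θ h := by
  rw [PowerSeries.X_dvd_iff, constantCoeff_arc, mem_maxId.1 hh]

theorem X_pow_dvd_arc (θ : OX →ₐ[ℂ] PowerSeries ℂ) {n : ℕ} {h : OX} (hh : h ∈ maxId ^ n) :
    PowerSeries.X ^ n ∣ θ h := by
  have h1 : maxId ≤ (Ideal.span {PowerSeries.X}).comap θ := fun a ha =>
    Ideal.mem_span_singleton.2 (X_dvd_arc θ ha)
  have h2 : maxId ^ n ≤ (Ideal.span {PowerSeries.X ^ n}).comap θ := by
    rw [← Ideal.span_singleton_pow]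
    exact (Ideal.pow_right_mono h1 n).trans (Ideal.le_comap_pow _ _)
  exact Ideal.mem_span_singleton.1 (h2 hh)

/-- Existence of arcs with given coordinates. -/
theorem exists_arc (a : Fin 3 → PowerSeries ℂ) (ha : ∀ i, PowerSeries.constantCoeff (a i) = 0) :
    ∃ θ : OX →ₐ[ℂ] PowerSeries ℂ, ∀ i, θ (xv i) = a i := by
  have hs : MvPowerSeries.HasSubst (S := ℂ) (τ := Unit) a :=
    MvPowerSeries.hasSubst_of_constantCoeff_zero ha
  exact ⟨MvPowerSeries.substAlgHom hs, fun i => MvPowerSeries.substAlgHom_X hs i⟩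

/-- Reparametrisation of a smooth branch. -/
theorem exists_reparam (P : PowerSeries ℂ) (h0 : PowerSeries.constantCoeff P = 0)
    (h1 : PowerSeries.coeff 1 P ≠ 0) :
    ∃ e : PowerSeries ℂ →ₐ[ℂ] PowerSeries ℂ, e P = PowerSeries.X ∧
      ∀ n q, PowerSeries.X ^ n ∣ q → PowerSeries.X ^ n ∣ e q := by
  have hu : IsUnit (PowerSeries.coeff 1 P) := isUnit_iff_ne_zero.2 h1
  have hs : PowerSeries.HasSubst (P.substInvOfIsUnit hu) := PowerSeries.HasSubst.substInvOfIsUnit P hu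
  refine ⟨PowerSeries.substAlgHom hs, ?_, ?_⟩
  · rw [PowerSeries.coe_substAlgHom]
    exact PowerSeries.subst_substInvOfIsUnit_right P h0 hu
  · rintro n _ ⟨q, rfl⟩
    rw [map_mul, map_pow]
    apply Dvd.dvd.mul_right
    apply pow_dvd_pow_of_dvd
    have : PowerSeries.substAlgHom hs (PowerSeries.X : PowerSeries ℂ) = P.substInvOfIsUnit hu :=
      PowerSeries.substAlgHom_X hs
    rw [this, PowerSeries.X_dvd_iff, PowerSeries.constantCoeff_substInvOfIsUnit]

end DuVal

/-! ### Normal forms: Hessians and the arcs that detect the types. -/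

namespace DuVal

open MvPowerSeries

theorem _root_.IsDuValOfType.exists_eq {T : DuValType} {f : OX} (hf : IsDuValOfType T f) :
    ∃ (σ : OX ≃ₐ[ℂ] OX) (w : OX), IsUnit w ∧ f = w * σ T.equation := by
  obtain ⟨σ, u, hu⟩ := hf
  exact ⟨σ, ↑u⁻¹, u⁻¹.isUnit, by rw [← hu]; simp [mul_comm f]⟩

theorem algHom_mem_maxId_pow (σ : OX →ₐ[ℂ] OX) {n : ℕ} {h : OX} (hh : h ∈ maxId ^ n) :
    σ h ∈ maxId ^ n := by
  have h1 : maxId ≤ maxId.comap σ := fun a ha => by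
    rw [Ideal.mem_comap, mem_maxId, cc_algHom, mem_maxId.1 ha]
  have h2 : maxId ^ n ≤ (maxId ^ n).comap σ :=
    (Ideal.pow_right_mono h1 n).trans (Ideal.le_comap_pow _ _)
  exact h2 hh

theorem derivation_mem_maxId_pow (d : Derivation ℂ OX OX) {n : ℕ} {h : OX}
    (hh : h ∈ maxId ^ (n + 1)) : d h ∈ maxId ^ n := by
  induction n generalizing h with
  | zero => simp
  | succ n ih =>
    rw [pow_succ] at hh
    refine Submodule.mul_induction_on hh ?_ ?_
    · intro a ha b hb
      rw [derivation_mul]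
      refine add_mem (Ideal.mul_mem_right _ _ ha) ?_
      rw [pow_succ, mul_comm b]
      exact Ideal.mul_mem_mul (ih ha) hb
    · intro a b ha hb
      rw [map_add]; exact add_mem ha hb

theorem mono_mem (i j k : ℕ) : xv 0 ^ i * xv 1 ^ j * xv 2 ^ k ∈ maxId ^ (i + j + k) := by
  rw [pow_add, pow_add]
  exact Ideal.mul_mem_mul (Ideal.mul_mem_mul (Ideal.pow_mem_pow (xv_mem 0) _)
    (Ideal.pow_mem_pow (xv_mem 1) _)) (Ideal.pow_mem_pow (xv_mem 2) _)

theorem mono_mem' {N : ℕ} (i j k : ℕ) (h : N ≤ i + j + k) :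
    xv 0 ^ i * xv 1 ^ j * xv 2 ^ k ∈ maxId ^ N := Ideal.pow_le_pow_right h (mono_mem i j k)

/-- The type is `D` or `E`. -/
def IsDE : DuValType → Prop
  | .A _ _ => False
  | _ => True

/-- What D and E share: the quadratic part is x² alone, so the Hessian at the origin has rank one.
-/
theorem equation_de {T : DuValType} (hT : IsDE T) :
    ∃ c ∈ maxId ^ 3, T.equation = xv 0 ^ 2 + c := by
  cases T with
  | A n hn => exact hT.elim
  | D n hn =>
    refine ⟨_, ?_, by rw [DuValType.equation, add_assoc]⟩
    refine add_mem ?_ ?_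
    · simpa using mono_mem' (N := 3) 0 2 1 (by norm_num)
    · simpa using mono_mem' (N := 3) 0 0 (n - 1) (by omega)
  | E6 =>
    refine ⟨_, ?_, by rw [DuValType.equation, add_assoc]⟩
    refine add_mem ?_ ?_
    · simpa using mono_mem' (N := 3) 0 3 0 (by norm_num)
    · simpa using mono_mem' (N := 3) 0 0 4 (by omega)
  | E7 =>
    refine ⟨_, ?_, by rw [DuValType.equation, add_assoc]⟩
    refine add_mem ?_ ?_
    · simpa using mono_mem' (N := 3) 0 3 0 (by norm_num)
    · simpa using mono_mem' (N := 3) 0 1 3 (by omega)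
  | E8 =>
    refine ⟨_, ?_, by rw [DuValType.equation, add_assoc]⟩
    refine add_mem ?_ ?_
    · simpa using mono_mem' (N := 3) 0 3 0 (by norm_num)
    · simpa using mono_mem' (N := 3) 0 0 5 (by omega)

theorem equation_mem_sq (T : DuValType) : T.equation ∈ maxId ^ 2 := by
  have hx : xv 0 ^ 2 ∈ maxId ^ 2 := Ideal.pow_mem_pow (xv_mem 0) _
  by_cases hT : IsDE T
  · obtain ⟨c, hc, h⟩ := equation_de hT
    rw [h]
    exact add_mem hx (Ideal.pow_le_pow_right (by norm_num) hc)
  · cases T with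
    | A n hn =>
      refine add_mem (add_mem hx (Ideal.pow_mem_pow (xv_mem 1) _)) ?_
      simpa using mono_mem' (N := 2) 0 0 (n + 1) (by omega)
    | _ => exact (hT trivial).elim

theorem _root_.IsDuValOfType.mem_sq {T : DuValType} {f : OX} (hf : IsDuValOfType T f) :
    f ∈ maxId ^ 2 := by
  obtain ⟨σ, w, -, rfl⟩ := hf.exists_eq
  exact Ideal.mul_mem_left _ _ (algHom_mem_maxId_pow σ.toAlgHom (equation_mem_sq T))

/-- The Hessian at the origin of a singularity of type `D` or `E` has rank at most one. -/
theorem _root_.IsDuValOfType.hessian {T : DuValType} (hT : IsDE T) {f : OX} (hf : IsDuValOfType T f)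
    (d₁ d₂ d₃ d₄ : Derivation ℂ OX OX) :
    cc (d₁ (d₃ f)) * cc (d₂ (d₄ f)) = cc (d₁ (d₄ f)) * cc (d₂ (d₃ f)) := by
  obtain ⟨σ, w, -, rfl⟩ := hf.exists_eq
  obtain ⟨c, hc, h⟩ := equation_de hT
  have hx : cc (σ (xv 0)) = 0 := by
    rw [← mem_maxId]
    simpa using algHom_mem_maxId_pow (n := 1) σ.toAlgHom (by simp)
  have hc' : w * σ c ∈ maxId ^ 3 :=
    Ideal.mul_mem_left _ _ (algHom_mem_maxId_pow σ.toAlgHom hc)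
  have key : ∀ d d' : Derivation ℂ OX OX, cc (d (d' (w * σ T.equation))) =
      2 * cc w * (cc (d (σ (xv 0))) * cc (d' (σ (xv 0)))) := by
    intro d d'
    have h1 : cc (d (d' (w * σ c))) = 0 :=
      mem_maxId.1 (derivation_mem_maxId d (derivation_mem_maxId_pow d' hc'))
    rw [h, map_add, mul_add, map_add, map_add, map_add, h1, map_pow, pow_two]
    simp only [derivation_mul, map_add, map_mul, hx]
    ring
  simp only [key]
  ring

/-- `θ` is a smooth formal arc. -/
def IsSmoothArc (θ : OX →ₐ[ℂ] PowerSeries ℂ) : Prop :=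
  ∃ i, PowerSeries.coeff 1 (θ (xv i)) ≠ 0

theorem coeff_one_mul_of_cc (a b : PowerSeries ℂ) (ha : PowerSeries.constantCoeff a = 0) :
    PowerSeries.coeff 1 (a * b) = PowerSeries.coeff 1 a * PowerSeries.constantCoeff b := by
  rw [PowerSeries.coeff_mul, Finset.Nat.antidiagonal_succ]
  simp [ha]

theorem coeff_one_arc (θ : OX →ₐ[ℂ] PowerSeries ℂ) {h : OX} (hh : h ∈ maxId) :
    PowerSeries.coeff 1 (θ h) = ∑ i, PowerSeries.coeff 1 (θ (xv i)) * cc (pd i h) := by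
  obtain ⟨a, b, c, rfl⟩ := exists_decomp (mem_maxId.1 hh)
  have hz : ∀ i, PowerSeries.constantCoeff (θ (xv i)) = 0 := fun i => by
    rw [constantCoeff_arc]; exact mem_maxId.1 (xv_mem i)
  simp only [map_add, map_mul, coeff_one_mul_of_cc _ _ (hz _), constantCoeff_arc,
    Fin.sum_univ_three, derivation_mul, pd_xv]
  simp

/-- The singular branch of the normal form, transported by an automorphism. -/
theorem exists_transported_arc (σ : OX ≃ₐ[ℂ] OX) :
    ∃ θ : OX →ₐ[ℂ] PowerSeries ℂ, IsSmoothArc θ ∧ θ (σ (xv 0)) = 0 ∧ θ (σ (xv 1)) = 0 ∧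
      θ (σ (xv 2)) = PowerSeries.X := by
  obtain ⟨θ₀, h⟩ := exists_arc ![0, 0, PowerSeries.X] (by intro i; fin_cases i <;> simp)
  have hσ : ∀ a, (θ₀.comp σ.symm.toAlgHom) (σ a) = θ₀ a := fun a => by simp
  refine ⟨θ₀.comp σ.symm.toAlgHom, ?_, ?_, ?_, ?_⟩
  -- If all three coordinates had order at least two along the arc, so would every function
  -- vanishing at the origin, including σ(z), which pulls back to the parameter.
  · by_contra hne
    have hne' : ∀ i, PowerSeries.coeff 1 ((θ₀.comp σ.symm.toAlgHom) (xv i)) = 0 := by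
      simpa [IsSmoothArc] using hne
    have hm : σ (xv 2) ∈ maxId := by
      simpa using algHom_mem_maxId_pow (n := 1) σ.toAlgHom (by simp)
    have h1 := coeff_one_arc (θ₀.comp σ.symm.toAlgHom) hm
    rw [hσ, h 2, Finset.sum_eq_zero fun i _ => by rw [hne' i, zero_mul]] at h1
    simp at h1
  · rw [hσ, h 0]; rfl
  · rw [hσ, h 1]; rfl
  · rw [hσ, h 2]; rfl

/-- Arc along which a function of the form `w (x² + y² q + z^(N+1))` and its derivatives vanish to
high order. -/
theorem exists_arc_of_eq (σ : OX ≃ₐ[ℂ] OX) (w q : OX) (N : ℕ) :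
    ∃ θ : OX →ₐ[ℂ] PowerSeries ℂ, IsSmoothArc θ ∧
      PowerSeries.X ^ (N + 1) ∣ θ (w * σ (xv 0 ^ 2 + xv 1 ^ 2 * q + xv 2 ^ (N + 1))) ∧
      ∀ d : Derivation ℂ OX OX,
        PowerSeries.X ^ N ∣ θ (d (w * σ (xv 0 ^ 2 + xv 1 ^ 2 * q + xv 2 ^ (N + 1)))) := by
  obtain ⟨θ, hs, h0, h1, h2⟩ := exists_transported_arc σ
  refine ⟨θ, hs, ?_, ?_⟩
  · simp [map_add, map_mul, map_pow, h0, h1, h2]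
  · intro d
    have e : θ (d (w * σ (xv 0 ^ 2 + xv 1 ^ 2 * q + xv 2 ^ (N + 1)))) =
        PowerSeries.X ^ N * (θ w * (((N : PowerSeries ℂ) + 1) * θ (d (σ (xv 2)))) + PowerSeries.X * θ (d w)) := by
      simp only [map_add, map_mul, map_pow, derivation_mul, Derivation.leibniz_pow, h0, h1, h2,
        smul_eq_mul, nsmul_eq_mul]
      simp
      ring
    rw [e]
    exact dvd_mul_right _ _

/-- The z-axis of the normal form, whose order of contact with the surface records n. -/
theorem _root_.IsDuValOfType.exists_arc_A {n : ℕ} {hn : 1 ≤ n} {f : OX}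
    (hf : IsDuValOfType (.A n hn) f) : ∃ θ : OX →ₐ[ℂ] PowerSeries ℂ, IsSmoothArc θ ∧
      PowerSeries.X ^ (n + 1) ∣ θ f ∧
      ∀ d : Derivation ℂ OX OX, PowerSeries.X ^ n ∣ θ (d f) := by
  obtain ⟨σ, w, -, rfl⟩ := hf.exists_eq
  simpa [DuValType.equation] using exists_arc_of_eq σ w 1 n

theorem _root_.IsDuValOfType.exists_arc_D {n : ℕ} {hn : 4 ≤ n} {f : OX}
    (hf : IsDuValOfType (.D n hn) f) : ∃ θ : OX →ₐ[ℂ] PowerSeries ℂ, IsSmoothArc θ ∧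
      PowerSeries.X ^ (n - 1) ∣ θ f ∧
      ∀ d : Derivation ℂ OX OX, PowerSeries.X ^ (n - 2) ∣ θ (d f) := by
  obtain ⟨σ, w, -, rfl⟩ := hf.exists_eq
  have := exists_arc_of_eq σ w (xv 2) (n - 2)
  rw [show n - 2 + 1 = n - 1 by omega] at this
  simpa [DuValType.equation] using this

/-- The z-axis lies on the surface, and modulo z² the Hessian along it comes from x² alone. The rank
condition will later fix the tangent of the arc. -/
theorem _root_.IsDuValOfType.exists_arc_E7 {f : OX}
    (hf : IsDuValOfType .E7 f) : ∃ θ : OX →ₐ[ℂ] PowerSeries ℂ, IsSmoothArc θ ∧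
      θ f = 0 ∧ (∀ d : Derivation ℂ OX OX, PowerSeries.X ^ 3 ∣ θ (d f)) ∧
      ∀ d₁ d₂ d₃ d₄ : Derivation ℂ OX OX, PowerSeries.X ^ 2 ∣
        θ (d₁ (d₃ f)) * θ (d₂ (d₄ f)) - θ (d₁ (d₄ f)) * θ (d₂ (d₃ f)) := by
  obtain ⟨σ, w, -, rfl⟩ := hf.exists_eq
  obtain ⟨θ, hs, h0, h1, h2⟩ := exists_transported_arc σ
  refine ⟨θ, hs, ?_, ?_, ?_⟩
  · simp [DuValType.equation, map_add, map_mul, map_pow, h0, h1]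
  · intro d
    have e : θ (d (w * σ DuValType.E7.equation)) =
        PowerSeries.X ^ 3 * (θ w * θ (d (σ (xv 1)))) := by
      simp only [DuValType.equation, map_add, map_mul, map_pow, derivation_mul,
        Derivation.leibniz_pow, h0, h1, h2, smul_eq_mul, nsmul_eq_mul]
      simp
      ring
    rw [e]
    exact dvd_mul_right _ _
  · intro d₁ d₂ d₃ d₄
    have key : ∀ d d' : Derivation ℂ OX OX, ∃ r, θ (d (d' (w * σ DuValType.E7.equation))) =
        2 * θ w * (θ (d (σ (xv 0))) * θ (d' (σ (xv 0)))) + PowerSeries.X ^ 2 * r := by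
      intro d d'
      refine ⟨PowerSeries.X * (θ (d w) * θ (d' (σ (xv 1))) + θ w * θ (d (d' (σ (xv 1))))
        + θ (d' w) * θ (d (σ (xv 1)))) + 3 * θ w * (θ (d' (σ (xv 1))) * θ (d (σ (xv 2)))
        + θ (d (σ (xv 1))) * θ (d' (σ (xv 2)))), ?_⟩
      simp only [DuValType.equation, map_add, map_mul, map_pow, derivation_mul,
        pow_succ, pow_zero, one_mul, h0, h1, h2]
      simp
      ring
    obtain ⟨r₁, e₁⟩ := key d₁ d₃
    obtain ⟨r₂, e₂⟩ := key d₂ d₄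
    obtain ⟨r₃, e₃⟩ := key d₁ d₄
    obtain ⟨r₄, e₄⟩ := key d₂ d₃
    rw [e₁, e₂, e₃, e₄]
    refine ⟨2 * θ w * (θ (d₁ (σ (xv 0))) * θ (d₃ (σ (xv 0)))) * r₂
      + r₁ * (2 * θ w * (θ (d₂ (σ (xv 0))) * θ (d₄ (σ (xv 0)))) + PowerSeries.X ^ 2 * r₂)
      - 2 * θ w * (θ (d₁ (σ (xv 0))) * θ (d₄ (σ (xv 0)))) * r₄
      - r₃ * (2 * θ w * (θ (d₂ (σ (xv 0))) * θ (d₃ (σ (xv 0)))) + PowerSeries.X ^ 2 * r₄), ?_⟩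
    ring

end DuVal

/-! ### Bounds for families of arcs as the parameter tends to zero. -/

namespace DuVal

open MvPowerSeries Filter Topology Asymptotics

theorem exists_quadratic_remainder (h : OX) : ∃ r ∈ maxId ^ 2,
    h = C (cc h) + (C (cc (pd 0 h)) * xv 0 + C (cc (pd 1 h)) * xv 1 + C (cc (pd 2 h)) * xv 2)
      + r := by
  refine ⟨h - (C (cc h) + (C (cc (pd 0 h)) * xv 0 + C (cc (pd 1 h)) * xv 1
    + C (cc (pd 2 h)) * xv 2)), ?_, by ring⟩
  rw [mem_sq_iff]
  constructor
  · simp only [map_sub, map_add, map_mul, cc_C]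
    simp
  · intro i
    simp only [map_sub, map_add, map_mul, derivation_mul, derivation_C, pd_xv, cc_C]
    fin_cases i <;> simp

theorem map_C_mul (θ : OX →ₐ[ℂ] PowerSeries ℂ) (r : ℂ) (h : OX) :
    θ (C r * h) = r • θ h := by
  rw [← MvPowerSeries.smul_eq_C_mul, map_smul]

/-- Division by `x`, a smooth equation `s = y - z r` and a power of `z`. -/
theorem exists_polynomial_decomp {s r : OX} (hs : xv 1 = s + xv 2 * r) (h : OX) (N : ℕ) :
    ∃ (q : Polynomial ℂ) (a b c : OX),
      h = Polynomial.aeval (xv 2) q + xv 0 * a + s * b + xv 2 ^ N * c := by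
  induction N with
  | zero => exact ⟨0, 0, 0, h, by simp⟩
  | succ N ih =>
    obtain ⟨q, a, b, c, hq⟩ := ih
    obtain ⟨a', b', c', hc⟩ := exists_decomp (mem_maxId.1 (sub_cc_mem c))
    refine ⟨q + Polynomial.C (cc c) * Polynomial.X ^ N, a + xv 2 ^ N * a', b + xv 2 ^ N * b',
      c' + r * b', ?_⟩
    have hc2 : c = C (cc c) + (xv 0 * a' + xv 1 * b' + xv 2 * c') := by rw [← hc]; ring
    have e : Polynomial.aeval (xv 2) (Polynomial.C (cc c) * Polynomial.X ^ N) =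
        C (cc c) * xv 2 ^ N := by
      simp [MvPowerSeries.c_eq_algebraMap]
    rw [map_add, e]
    calc h = _ := hq
      _ = Polynomial.aeval (xv 2) q + xv 0 * a + s * b
          + xv 2 ^ N * (C (cc c) + (xv 0 * a' + (s + xv 2 * r) * b' + xv 2 * c')) := by
        rw [← hs, ← hc2]
      _ = _ := by ring

theorem derivation_aeval_z {i : Fin 3} (hi : i ≠ 2) (q : Polynomial ℂ) :
    pd i (Polynomial.aeval (xv 2) q) = 0 := by
  rw [Derivation.map_aeval, pd_xv, if_neg hi]
  simp

theorem coeff_aeval_X (q : Polynomial ℂ) (j : ℕ) :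
    PowerSeries.coeff j (Polynomial.aeval (PowerSeries.X : PowerSeries ℂ) q) = q.coeff j := by
  induction q using Polynomial.induction_on' with
  | add p q hp hq => rw [map_add, map_add, hp, hq, Polynomial.coeff_add]
  | monomial n a =>
    rw [Polynomial.aeval_monomial, ← Algebra.smul_def, map_smul, PowerSeries.coeff_X_pow,
      Polynomial.coeff_monomial]
    simp [eq_comm]

/-- In a product of two series without constant term, a coefficient of index at most i involves only
coefficients of index below i. -/
theorem bounded_coeff_sq {l : Filter ℂ} (θ : ℂ → OX →ₐ[ℂ] PowerSeries ℂ) (i : ℕ)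
    (hB : ∀ h : OX, ∀ j < i, (fun t => PowerSeries.coeff j (θ t h)) =O[l] (fun _ => (1 : ℂ)))
    {h : OX} (hh : h ∈ maxId ^ 2) {j : ℕ} (hj : j ≤ i) :
    (fun t => PowerSeries.coeff j (θ t h)) =O[l] (fun _ => (1 : ℂ)) := by
  rw [pow_two] at hh
  refine Submodule.mul_induction_on hh ?_ ?_
  · intro a ha b hb
    have h0 : ∀ t, PowerSeries.coeff 0 (θ t a) = 0 := fun t => by
      rw [PowerSeries.coeff_zero_eq_constantCoeff, constantCoeff_arc, mem_maxId.1 ha]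
    have h1 : ∀ t, PowerSeries.coeff 0 (θ t b) = 0 := fun t => by
      rw [PowerSeries.coeff_zero_eq_constantCoeff, constantCoeff_arc, mem_maxId.1 hb]
    simp only [map_mul, PowerSeries.coeff_mul]
    refine IsBigO.fun_sum fun x hx => ?_
    rw [Finset.HasAntidiagonal.mem_antidiagonal] at hx
    rcases Nat.eq_zero_or_pos x.1 with e | e
    · simp only [e, h0, zero_mul]
      exact isBigO_zero _ _
    rcases Nat.eq_zero_or_pos x.2 with e' | e'
    · simp only [e', h1, mul_zero]
      exact isBigO_zero _ _
    simpa using (hB a x.1 (by omega)).mul (hB b x.2 (by omega))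
  · intro a b ha hb
    simp only [map_add]
    exact ha.add hb

/-- The determinant of the system tends to 4 as t → 0, so Cramer's rule expresses the solution by
bounded quantities. -/
theorem bounded_of_linear_system {l : Filter ℂ} (hl : l ≤ 𝓝 0) {u v s r : ℂ → ℂ}
    (a b c d : ℂ) (hs : s =O[l] (fun _ => (1 : ℂ))) (hr : r =O[l] (fun _ => (1 : ℂ)))
    (h1 : ∀ᶠ t in l, 2 * u t + t * (a * u t + b * v t + s t) = 0)
    (h2 : ∀ᶠ t in l, 2 * v t + t * (c * u t + d * v t + r t) = 0) :
    u =O[l] (fun _ => (1 : ℂ)) ∧ v =O[l] (fun _ => (1 : ℂ)) := by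
  have hΔ : Tendsto (fun t : ℂ => ((2 + t * a) * (2 + t * d) - t * b * (t * c))⁻¹) l
      (𝓝 ((2 + 0 * a) * (2 + 0 * d) - 0 * b * (0 * c))⁻¹) := by
    apply Tendsto.inv₀
    · apply Tendsto.mono_left _ hl
      apply Continuous.tendsto
      fun_prop
    · norm_num
  have hne : ∀ᶠ t : ℂ in l, (2 + t * a) * (2 + t * d) - t * b * (t * c) ≠ 0 := by
    have : Tendsto (fun t : ℂ => ((2 + t * a) * (2 + t * d) - t * b * (t * c))) l
      (𝓝 ((2 + 0 * a) * (2 + 0 * d) - 0 * b * (0 * c))) := by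
      apply Tendsto.mono_left _ hl
      apply Continuous.tendsto
      fun_prop
    exact this.eventually_ne (by norm_num)
  have hid : (fun t : ℂ => t) =O[l] (fun _ => (1 : ℂ)) :=
    (show Tendsto (fun t : ℂ => t) l (𝓝 0) from hl).isBigO_one ℂ
  have hc : ∀ z : ℂ, (fun _ : ℂ => z) =O[l] (fun _ => (1 : ℂ)) := fun z =>
    isBigO_const_const _ one_ne_zero _
  have hm : ∀ {p q : ℂ → ℂ}, p =O[l] (fun _ => (1 : ℂ)) → q =O[l] (fun _ => (1 : ℂ)) →
      (fun t => p t * q t) =O[l] (fun _ => (1 : ℂ)) := fun hp hq => by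
    simpa using hp.mul hq
  have hi := hΔ.isBigO_one ℂ
  constructor
  · have : (fun t => ((2 + t * a) * (2 + t * d) - t * b * (t * c))⁻¹ *
        (t * b * (t * r t) - t * s t * (2 + t * d))) =O[l] (fun _ => (1 : ℂ)) :=
      hm hi (((hm (hm hid (hc b)) (hm hid hr))).sub (hm (hm hid hs) ((hc 2).add (hm hid (hc d)))))
    refine this.congr' ?_ EventuallyEq.rfl
    filter_upwards [h1, h2, hne] with t e1 e2 e3
    rw [inv_mul_eq_iff_eq_mul₀ e3]
    linear_combination -(2 + t * d) * e1 + t * b * e2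
  · have : (fun t => ((2 + t * a) * (2 + t * d) - t * b * (t * c))⁻¹ *
        (t * c * (t * s t) - t * r t * (2 + t * a))) =O[l] (fun _ => (1 : ℂ)) :=
      hm hi (((hm (hm hid (hc c)) (hm hid hs))).sub (hm (hm hid hr) ((hc 2).add (hm hid (hc a)))))
    refine this.congr' ?_ EventuallyEq.rfl
    filter_upwards [h1, h2, hne] with t e1 e2 e3
    rw [inv_mul_eq_iff_eq_mul₀ e3]
    linear_combination t * c * e1 - (2 + t * a) * e2

theorem eq_zero_of_linear_system {l : Filter ℂ} (hl : l ≤ 𝓝 0) (a b c d : ℂ) :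
    ∀ᶠ t : ℂ in l, ∀ u v : ℂ, 2 * u + t * (a * u + b * v) = 0 → 2 * v + t * (c * u + d * v) = 0 →
      u = 0 ∧ v = 0 := by
  have hne : ∀ᶠ t : ℂ in l, (2 + t * a) * (2 + t * d) - t * b * (t * c) ≠ 0 := by
    have : Tendsto (fun t : ℂ => ((2 + t * a) * (2 + t * d) - t * b * (t * c))) l
      (𝓝 ((2 + 0 * a) * (2 + 0 * d) - 0 * b * (0 * c))) := by
      apply Tendsto.mono_left _ hl
      apply Continuous.tendsto
      fun_prop
    exact this.eventually_ne (by norm_num)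
  filter_upwards [hne] with t ht u v e1 e2
  constructor
  · refine (mul_eq_zero.1 (?_ : ((2 + t * a) * (2 + t * d) - t * b * (t * c)) * u = 0)).resolve_left
      ht
    linear_combination (2 + t * d) * e1 - t * b * e2
  · refine (mul_eq_zero.1 (?_ : ((2 + t * a) * (2 + t * d) - t * b * (t * c)) * v = 0)).resolve_left
      ht
    linear_combination (2 + t * a) * e2 - t * c * e1

end DuVal

/-! ### Deformations of A_n with constant type. -/

namespace DuVal

open MvPowerSeries Filter Topology Asymptotics

theorem coeff_arc_remainder (θ : OX →ₐ[ℂ] PowerSeries ℂ) {g r : OX} (hg : g ∈ maxId)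
    (h : g = C (cc g) + (C (cc (pd 0 g)) * xv 0 + C (cc (pd 1 g)) * xv 1 + C (cc (pd 2 g)) * xv 2)
      + r) (j : ℕ) :
    PowerSeries.coeff j (θ g) = cc (pd 0 g) * PowerSeries.coeff j (θ (xv 0))
      + cc (pd 1 g) * PowerSeries.coeff j (θ (xv 1)) + (cc (pd 2 g) * PowerSeries.coeff j (θ (xv 2))
      + PowerSeries.coeff j (θ r)) := by
  have h' := congrArg (fun a => PowerSeries.coeff j (θ a)) h
  simp only [mem_maxId.1 hg, map_add, map_C_mul, map_zero, zero_add, smul_eq_mul, map_smul] at h'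
  linear_combination h'

theorem pd_add_smul (i : Fin 3) (f ξ : OX) (t : ℂ) : pd i (f + t • ξ) = pd i f + t • pd i ξ := by
  rw [map_add, Derivation.map_smul]

/-- The gradient conditions give x ≈ -τTP/2 and y ≈ -τTQ/2 with errors of order T^(m+1). In the
squares each error meets a further factor T or another error, so it is lost modulo T^(m+2). What
survives of F is τp and a term with τ²; c stands for 1/4. -/
theorem second_order_expansion {A : Type*} [CommRing A] {T τ c x y a b P Q p F E₀ E₁ r : A}
    (m : ℕ) (hc : c * 4 = 1) (hx : 2 * x + τ * (T * P) = T ^ (m + 1) * E₀)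
    (hy : 2 * y + τ * (T * Q) = T ^ (m + 1) * E₁)
    (hF : T ^ (m + 1 + 1) * F = x ^ 2 + y ^ 2 + T ^ (m + 1 + 1)
      + τ * (p + x * (T * a) + y * (T * b) + T ^ (m + 1 + 1) * r)) :
    T ^ (m + 1 + 1) ∣ τ * p + τ * τ * ((c * (T * P) - 2 * c * (T * a)) * (T * P)
      + (c * (T * Q) - 2 * c * (T * b)) * (T * Q)) := by
  refine ⟨F - 1 - τ * r - (c * T ^ m * E₀ ^ 2 - 2 * c * τ * E₀ * P + 2 * c * τ * a * E₀)
    - (c * T ^ m * E₁ ^ 2 - 2 * c * τ * E₁ * Q + 2 * c * τ * b * E₁), ?_⟩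
  have ex : x = 2 * c * (T ^ (m + 1) * E₀ - τ * (T * P)) := by
    linear_combination 2 * c * hx - x * hc
  have ey : y = 2 * c * (T ^ (m + 1) * E₁ - τ * (T * Q)) := by
    linear_combination 2 * c * hy - y * hc
  rw [ex, ey] at hF
  linear_combination (-1 : A) * hF - c * ((T ^ (m + 1) * E₀ - τ * (T * P)) ^ 2
    + (T ^ (m + 1) * E₁ - τ * (T * Q)) ^ 2) * hc

/-- Along a family of branches parametrised by `z` which are critical for `f + t ξ` up to order `n`,
coefficients stay bounded as `t → 0`. -/
theorem bounded_coeff {l : Filter ℂ} (hl : l ≤ 𝓝 0) (n : ℕ) {f ξ : OX} (hξ : ξ ∈ maxId ^ 2)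
    (hf0 : pd 0 f = 2 * xv 0) (hf1 : pd 1 f = 2 * xv 1)
    (θ : ℂ → OX →ₐ[ℂ] PowerSeries ℂ) (hz : ∀ᶠ t in l, θ t (xv 2) = PowerSeries.X)
    (h0 : ∀ᶠ t in l, PowerSeries.X ^ n ∣ θ t (pd 0 (f + t • ξ)))
    (h1 : ∀ᶠ t in l, PowerSeries.X ^ n ∣ θ t (pd 1 (f + t • ξ))) (i : ℕ) (hi : i ≤ n) :
    ∀ h : OX, ∀ j < i, (fun t => PowerSeries.coeff j (θ t h)) =O[l] (fun _ => (1 : ℂ)) := by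
  induction i with
  | zero => intro h j hj; omega
  | succ i ih =>
    have hB := ih (by omega)
    have hconst : ∀ z : ℂ, (fun _ : ℂ => z) =O[l] (fun _ => (1 : ℂ)) := fun z =>
      isBigO_const_const _ one_ne_zero _
    have hz' : (fun t => PowerSeries.coeff i (θ t (xv 2))) =O[l] (fun _ => (1 : ℂ)) := by
      refine (hconst (PowerSeries.coeff i PowerSeries.X)).congr' ?_ EventuallyEq.rfl
      filter_upwards [hz] with t ht
      rw [ht]
    have hD : ∀ d, pd d ξ ∈ maxId := fun d => derivation_mem_maxId _ hξ
    obtain ⟨r, hr, er⟩ := exists_quadratic_remainder (pd 0 ξ)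
    obtain ⟨s, hs, es⟩ := exists_quadratic_remainder (pd 1 ξ)
    -- The i-th coefficients of the two gradient equations form a linear system for the i-th
    -- coefficients of x and y. Its inhomogeneous terms involve z and the quadratic remainders,
    -- which are bounded by induction.
    have hxy := bounded_of_linear_system hl
      (u := fun t => PowerSeries.coeff i (θ t (xv 0)))
      (v := fun t => PowerSeries.coeff i (θ t (xv 1)))
      (s := fun t => cc (pd 2 (pd 0 ξ)) * PowerSeries.coeff i (θ t (xv 2))
        + PowerSeries.coeff i (θ t r))
      (r := fun t => cc (pd 2 (pd 1 ξ)) * PowerSeries.coeff i (θ t (xv 2))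
        + PowerSeries.coeff i (θ t s))
      (cc (pd 0 (pd 0 ξ))) (cc (pd 1 (pd 0 ξ))) (cc (pd 0 (pd 1 ξ))) (cc (pd 1 (pd 1 ξ)))
      ((hz'.const_mul_left _).add (bounded_coeff_sq θ i hB hr le_rfl))
      ((hz'.const_mul_left _).add (bounded_coeff_sq θ i hB hs le_rfl))
      (by
        filter_upwards [h0] with t ht
        have := PowerSeries.X_pow_dvd_iff.1 ht i (by omega)
        rw [← coeff_arc_remainder (θ t) (hD 0) er i]
        simpa [hf0, two_mul] using this)
      (by
        filter_upwards [h1] with t ht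
        have := PowerSeries.X_pow_dvd_iff.1 ht i (by omega)
        rw [← coeff_arc_remainder (θ t) (hD 1) es i]
        simpa [hf1, two_mul] using this)
    intro h j hj
    rcases Nat.lt_succ_iff_lt_or_eq.1 hj with hj | rfl
    · exact hB h j hj
    obtain ⟨q, hq, eq⟩ := exists_quadratic_remainder (h - C (cc h))
    have e : (fun t => PowerSeries.coeff j (θ t h)) = fun t =>
        PowerSeries.coeff j (PowerSeries.C (cc h)) + PowerSeries.coeff j (θ t (h - C (cc h))) := by
      ext t
      have : θ t (C (cc h)) = PowerSeries.C (cc h) := by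
        rw [MvPowerSeries.c_eq_algebraMap, AlgHom.commutes]; rfl
      rw [map_sub, this, map_sub]; ring
    rw [e]
    refine (hconst _).add ?_
    simp_rw [fun t => coeff_arc_remainder (θ t) (sub_cc_mem h) eq j]
    exact ((hxy.1.const_mul_left _).add (hxy.2.const_mul_left _)).add
      ((hz'.const_mul_left _).add (bounded_coeff_sq θ j hB hq le_rfl))

/-- If the members `f + t ξ` with `t` close to `0` are all of type `A_n`, where
`f = x² + y² + z^(n+1)`, then `ξ` vanishes to order `n + 1` along the branch `x = y = 0`. -/
theorem dvd_of_family_A {n : ℕ} (hn : 1 ≤ n) (hn2 : 2 ≤ n) {ξ : OX} (hξ : ξ ∈ maxId ^ 2)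
    (hf : ∀ᶠ t in 𝓝[≠] (0 : ℂ), IsDuValOfType (.A n hn) ((DuValType.A n hn).equation + t • ξ))
    (Θ : OX →ₐ[ℂ] PowerSeries ℂ) (hΘ0 : Θ (xv 0) = 0) (hΘ1 : Θ (xv 1) = 0)
    (hΘ2 : Θ (xv 2) = PowerSeries.X) : PowerSeries.X ^ (n + 1) ∣ Θ ξ := by
  set f := (DuValType.A n hn).equation with hfdef
  have hl : 𝓝[≠] (0 : ℂ) ≤ 𝓝 0 := nhdsWithin_le_nhds
  have hD : ∀ d, pd d ξ ∈ maxId := fun d => derivation_mem_maxId _ hξ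
  have hf0 : pd 0 f = 2 * xv 0 := by
    simp [hfdef, DuValType.equation, pd_xv]
  have hf1 : pd 1 f = 2 * xv 1 := by
    simp [hfdef, DuValType.equation, pd_xv]
  -- branches parametrised by `z`
  have hex : ∀ᶠ t in 𝓝[≠] (0 : ℂ), ∃ θ : OX →ₐ[ℂ] PowerSeries ℂ, θ (xv 2) = PowerSeries.X ∧
      PowerSeries.X ^ (n + 1) ∣ θ (f + t • ξ) ∧
      ∀ i, PowerSeries.X ^ n ∣ θ (pd i (f + t • ξ)) := by
    filter_upwards [hf, eq_zero_of_linear_system hl (cc (pd 0 (pd 0 ξ))) (cc (pd 1 (pd 0 ξ)))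
      (cc (pd 0 (pd 1 ξ))) (cc (pd 1 (pd 1 ξ)))] with t ht hlin
    obtain ⟨θ, hs, h1, h2⟩ := ht.exists_arc_A
    -- If the arc were tangent to z = 0, the linear terms of the gradient equations (available since
    -- n ≥ 2) would force its whole tangent vector to vanish.
    have hz : PowerSeries.coeff 1 (θ (xv 2)) ≠ 0 := by
      intro hz
      obtain ⟨u, v⟩ := hlin (PowerSeries.coeff 1 (θ (xv 0))) (PowerSeries.coeff 1 (θ (xv 1)))
        (by
          have := PowerSeries.X_pow_dvd_iff.1 (h2 (pd 0)) 1 (by omega)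
          rw [pd_add_smul, hf0, map_add, map_smul, map_add, map_smul,
            coeff_one_arc θ (hD 0), Fin.sum_univ_three, hz] at this
          simp [two_mul] at this
          linear_combination this)
        (by
          have := PowerSeries.X_pow_dvd_iff.1 (h2 (pd 1)) 1 (by omega)
          rw [pd_add_smul, hf1, map_add, map_smul, map_add, map_smul,
            coeff_one_arc θ (hD 1), Fin.sum_univ_three, hz] at this
          simp [two_mul] at this
          linear_combination this)
      obtain ⟨i, hi⟩ := hs
      fin_cases i
      · exact hi u
      · exact hi v
      · exact hi hz
    obtain ⟨e, he, hdvd⟩ := exists_reparam (θ (xv 2))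
      (by rw [constantCoeff_arc]; exact mem_maxId.1 (xv_mem 2)) hz
    exact ⟨e.comp θ, he, hdvd _ _ h1, fun i => hdvd _ _ (h2 _)⟩
  obtain ⟨θ, hθ⟩ : ∃ θ : ℂ → OX →ₐ[ℂ] PowerSeries ℂ, ∀ᶠ t in 𝓝[≠] (0 : ℂ),
      θ t (xv 2) = PowerSeries.X ∧ PowerSeries.X ^ (n + 1) ∣ θ t (f + t • ξ) ∧
      ∀ i, PowerSeries.X ^ n ∣ θ t (pd i (f + t • ξ)) := by
    classical
    refine ⟨fun t => if h : ∃ θ : OX →ₐ[ℂ] PowerSeries ℂ, θ (xv 2) = PowerSeries.X ∧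
      PowerSeries.X ^ (n + 1) ∣ θ (f + t • ξ) ∧
      ∀ i, PowerSeries.X ^ n ∣ θ (pd i (f + t • ξ)) then h.choose else Θ, ?_⟩
    filter_upwards [hex] with t ht
    rw [dif_pos ht]
    exact ht.choose_spec
  have hB := bounded_coeff hl n hξ hf0 hf1 θ (hθ.mono fun t h => h.1) (hθ.mono fun t h => h.2.2 0)
    (hθ.mono fun t h => h.2.2 1) n le_rfl
  obtain ⟨q, a, b, c, hq⟩ := exists_polynomial_decomp (s := xv 1) (r := 0) (by simp) ξ (n + 1)
  have hpdq : ∀ i : Fin 3, i ≠ 2 → pd i (Polynomial.aeval (xv 2) q) = 0 := fun i hi =>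
    derivation_aeval_z hi q
  have ha : a ∈ maxId := by
    have h := mem_maxId.1 (hD 0)
    rw [hq] at h
    simp only [map_add, hpdq 0 (by decide), derivation_mul, Derivation.leibniz_pow, pd_xv] at h
    simpa [mem_maxId] using h
  have hb : b ∈ maxId := by
    have h := mem_maxId.1 (hD 1)
    rw [hq] at h
    simp only [map_add, hpdq 1 (by decide), derivation_mul, Derivation.leibniz_pow, pd_xv] at h
    simpa [mem_maxId] using h
  -- the second order term
  set R : OX := (C (1 / 4) * pd 0 ξ - C (1 / 2) * a) * pd 0 ξ
    + (C (1 / 4) * pd 1 ξ - C (1 / 2) * b) * pd 1 ξ with hRdef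
  have hR : R ∈ maxId ^ 2 := by
    rw [pow_two]
    exact add_mem
      (Ideal.mul_mem_mul (sub_mem (Ideal.mul_mem_left _ _ (hD 0)) (Ideal.mul_mem_left _ _ ha)) (hD 0))
      (Ideal.mul_mem_mul (sub_mem (Ideal.mul_mem_left _ _ (hD 1)) (Ideal.mul_mem_left _ _ hb)) (hD 1))
  -- Modulo zⁿ⁺¹ the equation on the arc reads t q(z) + t² R = 0, where the coefficients of R up to
  -- index n stay bounded. Dividing by t and letting t → 0 kills the coefficients of q.
  have hcoeff : ∀ j ≤ n, q.coeff j = 0 := by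
    intro j hj
    have hRb := bounded_coeff_sq θ n hB hR hj
    have hlim : Tendsto (fun t : ℂ => -(t * PowerSeries.coeff j (θ t R))) (𝓝[≠] 0) (𝓝 0) := by
      have h1 : (fun t : ℂ => t * PowerSeries.coeff j (θ t R)) =O[𝓝[≠] 0] (fun t : ℂ => t) := by
        simpa using (isBigO_refl (fun t : ℂ => t) (𝓝[≠] 0)).mul hRb
      have h2 := h1.trans_tendsto (show Tendsto (fun t : ℂ => t) (𝓝[≠] 0) (𝓝 0) from hl)
      simpa using h2.neg
    refine tendsto_nhds_unique (tendsto_const_nhds.congr' ?_) hlim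
    filter_upwards [hθ, self_mem_nhdsWithin] with t ht ht0
    obtain ⟨hz, h1, h2⟩ := ht
    have key : PowerSeries.X ^ (n + 1) ∣ t • Polynomial.aeval (PowerSeries.X : PowerSeries ℂ) q
        + (t * t) • θ t R := by
      obtain ⟨E0, hE0⟩ := h2 0
      obtain ⟨E1, hE1⟩ := h2 1
      rw [pd_add_smul, hf0, map_add, map_mul, map_smul, map_ofNat] at hE0
      rw [pd_add_smul, hf1, map_add, map_mul, map_smul, map_ofNat] at hE1
      obtain ⟨A, hA⟩ := X_dvd_arc (θ t) ha
      obtain ⟨B, hB'⟩ := X_dvd_arc (θ t) hb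
      obtain ⟨P, hP⟩ := X_dvd_arc (θ t) (hD 0)
      obtain ⟨Q, hQ⟩ := X_dvd_arc (θ t) (hD 1)
      obtain ⟨F, hF⟩ := h1
      have hqθ : θ t (Polynomial.aeval (xv 2) q) = Polynomial.aeval (PowerSeries.X) q := by
        rw [← hz, ← Polynomial.aeval_algHom_apply]
      have hfe : θ t (f + t • ξ) = θ t (xv 0) ^ 2 + θ t (xv 1) ^ 2 + PowerSeries.X ^ (n + 1)
          + t • (Polynomial.aeval PowerSeries.X q + θ t (xv 0) * θ t a + θ t (xv 1) * θ t b
            + PowerSeries.X ^ (n + 1) * θ t c) := by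
        rw [map_add, map_smul]
        conv_lhs => rw [hq]
        rw [hfdef, DuValType.equation]
        simp only [map_add, map_mul, map_pow, hz, hqθ]
      rw [hF] at hfe
      simp only [PowerSeries.smul_eq_C_mul] at hfe hE0 hE1 ⊢
      rw [hRdef]
      have hC : ∀ r : ℂ, θ t (C r) = PowerSeries.C r := fun r => by
        rw [MvPowerSeries.c_eq_algebraMap, AlgHom.commutes]; rfl
      simp only [map_add, map_mul, map_sub, hC]
      have h4 : (PowerSeries.C (1 / 4) : PowerSeries ℂ) * 4 = 1 := by
        rw [show (4 : PowerSeries ℂ) = PowerSeries.C 4 from (map_ofNat _ 4).symm, ← map_mul]; norm_num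
      have h12 : (PowerSeries.C (1 / 2) : PowerSeries ℂ) = 2 * PowerSeries.C (1 / 4) := by
        rw [show (2 : PowerSeries ℂ) = PowerSeries.C 2 from (map_ofNat _ 2).symm, ← map_mul]; norm_num
      rw [h12]
      set c4 : PowerSeries ℂ := PowerSeries.C (1 / 4)
      set τ : PowerSeries ℂ := PowerSeries.C t
      rw [hP] at hE0
      rw [hQ] at hE1
      rw [hA, hB'] at hfe
      rw [hP, hQ, hA, hB']
      clear_value f
      obtain ⟨m, rfl⟩ : ∃ m, n = m + 1 := ⟨n - 1, by omega⟩
      exact second_order_expansion m h4 hE0 hE1 hfe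
    have := PowerSeries.X_pow_dvd_iff.1 key j (by omega)
    rw [map_add, map_smul, map_smul, coeff_aeval_X, smul_eq_mul, smul_eq_mul] at this
    have ht0' : t ≠ 0 := ht0
    apply mul_left_cancel₀ ht0'
    linear_combination this
  rw [hq, map_add, map_add, map_add, map_mul, map_mul, map_mul, hΘ0, hΘ1, map_pow, hΘ2,
    ← Polynomial.aeval_algHom_apply, hΘ2]
  simp only [zero_mul, add_zero]
  refine dvd_add (PowerSeries.X_pow_dvd_iff.2 fun j hj => ?_) (dvd_mul_right _ _)
  rw [coeff_aeval_X]
  exact hcoeff j (by omega)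

end DuVal

/-! ### The general member of the net of minors, and type A. -/

namespace DuVal

open MvPowerSeries Filter Topology

theorem eventually_eval_ne_zero {q : Polynomial ℂ} (hq : q ≠ 0) :
    ∀ᶠ t in 𝓝[≠] (0 : ℂ), q.eval t ≠ 0 := by
  have hfin : {t : ℂ | t ≠ 0 ∧ q.eval t = 0}.Finite :=
    (Polynomial.finite_setOfPred_isRoot hq).subset fun t ht => ht.2
  have h0 : {t : ℂ | t ≠ 0 ∧ q.eval t = 0}ᶜ ∈ 𝓝 (0 : ℂ) :=
    hfin.isClosed.isOpen_compl.mem_nhds (by simp)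
  filter_upwards [nhdsWithin_le_nhds h0, self_mem_nhdsWithin] with t ht ht0 he
  exact ht ⟨ht0, he⟩

/-- A polynomial that is nonzero at one point of a line has finitely many zeros on it. -/
theorem eventually_eval_line_ne_zero {k : ℕ} {p : MvPolynomial (Fin k) ℂ} (c d : Fin k → ℂ)
    {t₀ : ℂ} (h : MvPolynomial.eval (fun i => c i + t₀ * d i) p ≠ 0) :
    ∀ᶠ t in 𝓝[≠] (0 : ℂ), MvPolynomial.eval (fun i => c i + t * d i) p ≠ 0 := by
  have key : ∀ t : ℂ, (MvPolynomial.aeval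
      (fun i => Polynomial.C (c i) + Polynomial.X * Polynomial.C (d i)) p).eval t =
      MvPolynomial.eval (fun i => c i + t * d i) p := by
    intro t
    rw [← Polynomial.coe_evalRingHom, MvPolynomial.aeval_def, MvPolynomial.hom_eval₂,
      MvPolynomial.eval, MvPolynomial.coe_eval₂Hom]
    congr 1
    · ext; simp
    · ext i; simp; ring
  have hq : MvPolynomial.aeval
      (fun i => Polynomial.C (c i) + Polynomial.X * Polynomial.C (d i)) p ≠ 0 := by
    intro h0
    apply h
    rw [← key, h0, Polynomial.eval_zero]
  filter_upwards [eventually_eval_ne_zero hq] with t ht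
  rwa [← key]

/-- Nonempty Zariski open sets are dense. -/
theorem dense_eval_ne_zero {k : ℕ} {p : MvPolynomial (Fin k) ℂ} (hp : p ≠ 0) :
    Dense {c : Fin k → ℂ | MvPolynomial.eval c p ≠ 0} := by
  obtain ⟨d, hd⟩ : ∃ d, MvPolynomial.eval d p ≠ 0 := by
    by_contra! h
    exact hp (MvPolynomial.funext fun x => by rw [h x, map_zero])
  intro c
  have h1 := eventually_eval_line_ne_zero (p := p) c (d - c) (t₀ := 1) (by simpa using hd)
  have h2 : Tendsto (fun t : ℂ => fun i => c i + t * (d - c) i) (𝓝[≠] 0)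
      (𝓝 (fun i => c i + 0 * (d - c) i)) := by
    apply Tendsto.mono_left _ nhdsWithin_le_nhds
    apply Continuous.tendsto
    fun_prop
  simp only [zero_mul, add_zero] at h2
  exact mem_closure_of_tendsto h2 h1

/-- The minors of `(φ | v)` which involve the last column, as in `adj φ · v`. -/
noncomputable def minorL (φ : Matrix (Fin 2) (Fin 2) OX) (g h : OX) : OX := φ 0 0 * h - φ 1 0 * g

noncomputable def minorR (φ : Matrix (Fin 2) (Fin 2) OX) (g h : OX) : OX := φ 0 1 * h - φ 1 1 * g

/-- The general linear combination of the minors of `(φ | v)` has type `T`, and `det φ` is the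
normal form of type `T`. -/
structure IsGeneralNormal (T : DuValType) (φ : Matrix (Fin 2) (Fin 2) OX) (g h : OX) : Prop where
  det_eq : φ.det = T.equation
  general : ∃ p : MvPolynomial (Fin 3) ℂ, p ≠ 0 ∧ ∀ c : Fin 3 → ℂ, MvPolynomial.eval c p ≠ 0 →
    IsDuValOfType T (c 0 • φ.det + c 1 • minorL φ g h + c 2 • minorR φ g h)

theorem smul_isDuValOfType {T : DuValType} {f : OX} (hf : IsDuValOfType T f) {c : ℂ} (hc : c ≠ 0) :
    IsDuValOfType T (c • f) := by
  obtain ⟨σ, hσ⟩ := hf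
  refine ⟨σ, Associated.trans ?_ hσ⟩
  have hu : IsUnit (C c : OX) := by
    rw [isUnit_iff_cc, cc_C]; exact hc
  rw [MvPowerSeries.smul_eq_C_mul]
  exact associated_unit_mul_left f _ hu

section

variable {T : DuValType} {φ : Matrix (Fin 2) (Fin 2) OX} {g h : OX}

/-- Closed conditions on the general member hold for every member. -/
theorem IsGeneralNormal.eq_zero_of_closed (H : IsGeneralNormal T φ g h) (F : (Fin 3 → ℂ) → ℂ)
    (hF : Continuous F)
    (hz : ∀ c : Fin 3 → ℂ, IsDuValOfType T
      (c 0 • φ.det + c 1 • minorL φ g h + c 2 • minorR φ g h) → F c = 0) (c : Fin 3 → ℂ) :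
    F c = 0 := by
  obtain ⟨p, hp, hgen⟩ := H.general
  have := Continuous.ext_on (dense_eval_ne_zero hp) hF continuous_zero
    fun c hc => hz c (hgen c hc)
  exact congrFun this c

/-- Order at least two is a set of linear conditions. They hold for the general member, hence for
every member of the net. -/
theorem IsGeneralNormal.minor_mem_sq (H : IsGeneralNormal T φ g h) :
    minorL φ g h ∈ maxId ^ 2 ∧ minorR φ g h ∈ maxId ^ 2 := by
  have key : ∀ L : OX →ₗ[ℂ] ℂ, (∀ a ∈ maxId ^ 2, L a = 0) →
      L (minorL φ g h) = 0 ∧ L (minorR φ g h) = 0 := by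
    intro L hL
    have := H.eq_zero_of_closed
      (fun c => c 0 * L φ.det + c 1 * L (minorL φ g h) + c 2 * L (minorR φ g h)) (by fun_prop)
      (fun c hc => by simpa using hL _ hc.mem_sq)
    exact ⟨by simpa using (this ![0, 1, 0]), by simpa using (this ![0, 0, 1])⟩
  have h0 := key (ccAlg : OX →ₐ[ℂ] ℂ).toLinearMap fun a ha => (mem_sq_iff.1 ha).1
  have h1 := fun i => key ((ccAlg : OX →ₐ[ℂ] ℂ).toLinearMap.comp (pd i : OX →ₗ[ℂ] OX))
    fun a ha => (mem_sq_iff.1 ha).2 i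
  exact ⟨mem_sq_iff.2 ⟨h0.1, fun i => (h1 i).1⟩, mem_sq_iff.2 ⟨h0.2, fun i => (h1 i).2⟩⟩

theorem entry_mem (φ : Matrix (Fin 2) (Fin 2) OX) (i j : Fin 2) : φ i j ∈ entriesIdeal φ :=
  Ideal.subset_span ⟨(i, j), rfl⟩

theorem derivation_det_mem (d : Derivation ℂ OX OX) (φ : Matrix (Fin 2) (Fin 2) OX) :
    d φ.det ∈ entriesIdeal φ := by
  rw [Matrix.det_fin_two, map_sub, derivation_mul, derivation_mul]
  refine sub_mem (add_mem ?_ ?_) (add_mem ?_ ?_) <;>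
    exact Ideal.mul_mem_right _ _ (entry_mem _ _ _)

/-- Functions of order `m` along the branch `x = s = 0`. -/
theorem exists_decomp_of_dvd {s r : OX} (hs : xv 1 = s + xv 2 * r) (Θ : OX →ₐ[ℂ] PowerSeries ℂ)
    (h0 : Θ (xv 0) = 0) (h1 : Θ s = 0) (h2 : Θ (xv 2) = PowerSeries.X) {w : OX} {m : ℕ}
    (hw : PowerSeries.X ^ m ∣ Θ w) :
    ∃ u : Fin 3 → OX, w = xv 0 * u 0 + s * u 1 + xv 2 ^ m * u 2 := by
  obtain ⟨q, a, b, c, rfl⟩ := exists_polynomial_decomp hs w m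
  rw [map_add, map_add, map_add, map_mul, map_mul, map_mul, h0, h1, map_pow, h2, zero_mul,
    zero_mul, add_zero, add_zero, ← Polynomial.aeval_algHom_apply, h2] at hw
  have hq : Polynomial.X ^ m ∣ q := by
    rw [Polynomial.X_pow_dvd_iff]
    intro d hd
    rw [← coeff_aeval_X]
    exact PowerSeries.X_pow_dvd_iff.1 ((dvd_add_left (dvd_mul_right _ _)).1 hw) d hd
  obtain ⟨q', rfl⟩ := hq
  refine ⟨![a, b, Polynomial.aeval (xv 2) q' + c], ?_⟩
  simp only [map_mul, map_pow, Polynomial.aeval_X, Matrix.cons_val]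
  ring

/-- Membership in an ideal containing the equations of a smooth branch, tested on the branch. -/
theorem mem_of_dvd_arc {K : Ideal OX} {s r : OX} (hs : xv 1 = s + xv 2 * r) {n : ℕ}
    (hx : xv 0 ∈ K) (hsK : s ∈ K) (hz : xv 2 ^ n ∈ K) (Θ : OX →ₐ[ℂ] PowerSeries ℂ)
    (h0 : Θ (xv 0) = 0) (h1 : Θ s = 0) (h2 : Θ (xv 2) = PowerSeries.X) {w : OX}
    (hw : PowerSeries.X ^ n ∣ Θ w) : w ∈ K := by
  obtain ⟨u, rfl⟩ := exists_decomp_of_dvd hs Θ h0 h1 h2 hw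
  exact add_mem (add_mem (Ideal.mul_mem_right _ _ hx) (Ideal.mul_mem_right _ _ hsK))
    (Ideal.mul_mem_right _ _ hz)

theorem exists_aeval_sub_dvd (m : PowerSeries ℂ) (n : ℕ) :
    ∃ q : Polynomial ℂ, PowerSeries.X ^ n ∣ m - Polynomial.aeval PowerSeries.X q := by
  refine ⟨PowerSeries.trunc n m, PowerSeries.X_pow_dvd_iff.2 fun j hj => ?_⟩
  rw [map_sub, coeff_aeval_X, PowerSeries.coeff_trunc, if_pos hj, sub_self]

/-- Both minors are divisible by det φ = zⁿ⁺¹ on the z-axis, so Cramer's identity puts g and h into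
I(φ) after restriction to the axis. The partial derivatives of det φ give x, y, zⁿ ∈ I(φ), so the
axis decides membership. -/
theorem IsGeneralNormal.mem_of_A {n : ℕ} {hn : 1 ≤ n} (H : IsGeneralNormal (.A n hn) φ g h) :
    g ∈ entriesIdeal φ ∧ h ∈ entriesIdeal φ := by
  obtain ⟨Θ, hΘ⟩ := exists_arc ![0, 0, PowerSeries.X] (by intro i; fin_cases i <;> simp)
  have hΘ0 : Θ (xv 0) = 0 := hΘ 0
  have hΘ1 : Θ (xv 1) = 0 := hΘ 1
  have hΘ2 : Θ (xv 2) = PowerSeries.X := hΘ 2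
  obtain ⟨hL, hR⟩ := H.minor_mem_sq
  -- both minors vanish to order `n + 1` along the branch
  have hdvd : PowerSeries.X ^ (n + 1) ∣ Θ (minorL φ g h) ∧
      PowerSeries.X ^ (n + 1) ∣ Θ (minorR φ g h) := by
    rcases hn.eq_or_lt with rfl | hn2
    · exact ⟨X_pow_dvd_arc Θ hL, X_pow_dvd_arc Θ hR⟩
    obtain ⟨p, hp, hgen⟩ := H.general
    -- The extra factor makes c₀ ≠ 0, so that a member can be rescaled to det φ + t ξ.
    have hp' : p * MvPolynomial.X 0 ≠ 0 := mul_ne_zero hp (MvPolynomial.X_ne_zero 0)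
    have key : ∀ c : Fin 3 → ℂ, MvPolynomial.eval c (p * MvPolynomial.X 0) ≠ 0 →
        PowerSeries.X ^ (n + 1) ∣ Θ (c 1 • minorL φ g h + c 2 • minorR φ g h) := by
      intro c hc
      rw [map_mul, MvPolynomial.eval_X] at hc
      have hc0 : c 0 ≠ 0 := right_ne_zero_of_mul hc
      -- The line runs from c₀(1, 0, 0) in the direction c₀(0, c₁, c₂) and passes through c at t =
      -- 1/c₀.
      have hline := eventually_eval_line_ne_zero (p := p) ![c 0, 0, 0] ![0, c 0 * c 1, c 0 * c 2]
        (t₀ := (c 0)⁻¹) (by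
          convert left_ne_zero_of_mul hc using 3
          ext i; fin_cases i <;> simp [hc0])
      refine dvd_of_family_A hn hn2 (add_mem (Submodule.smul_of_tower_mem _ _ hL)
        (Submodule.smul_of_tower_mem _ _ hR)) ?_ Θ hΘ0 hΘ1 hΘ2
      filter_upwards [hline] with t ht
      have := smul_isDuValOfType (hgen _ ht) (inv_ne_zero hc0)
      rw [← H.det_eq]
      have e0 : (c 0)⁻¹ * c 0 = 1 := inv_mul_cancel₀ hc0
      have e1 : (c 0)⁻¹ * (t * (c 0 * c 1)) = t * c 1 := by field_simp
      have e2 : (c 0)⁻¹ * (t * (c 0 * c 2)) = t * c 2 := by field_simp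
      convert this using 1
      simp [smul_add, smul_smul, e0, e1, e2, add_assoc]
    have hall : ∀ j < n + 1, PowerSeries.coeff j (Θ (minorL φ g h)) = 0 ∧
        PowerSeries.coeff j (Θ (minorR φ g h)) = 0 := by
      intro j hj
      have hext := Continuous.ext_on (dense_eval_ne_zero hp')
        (f := fun c : Fin 3 → ℂ => c 1 * PowerSeries.coeff j (Θ (minorL φ g h))
          + c 2 * PowerSeries.coeff j (Θ (minorR φ g h))) (g := fun _ => 0)
        (by fun_prop) (by fun_prop) (fun c hc => by
          simpa using PowerSeries.X_pow_dvd_iff.1 (key c hc) j hj)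
      exact ⟨by simpa using congrFun hext ![0, 1, 0], by simpa using congrFun hext ![0, 0, 1]⟩
    exact ⟨PowerSeries.X_pow_dvd_iff.2 fun j hj => (hall j hj).1,
      PowerSeries.X_pow_dvd_iff.2 fun j hj => (hall j hj).2⟩
  have hdet : Θ φ.det = PowerSeries.X ^ (n + 1) := by
    rw [H.det_eq, DuValType.equation, map_add, map_add, map_pow, map_pow, map_pow, hΘ0, hΘ1, hΘ2]
    simp
  have hK : ∀ d, pd d (DuValType.A n hn).equation ∈ entriesIdeal φ := fun d => by
    rw [← H.det_eq]; exact derivation_det_mem _ _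
  have hunit : ∀ (r : ℂ) (a : OX), r ≠ 0 → C r * a ∈ entriesIdeal φ → a ∈ entriesIdeal φ := by
    intro r a hr ha
    have := Ideal.mul_mem_left _ (C r⁻¹) ha
    rwa [← mul_assoc, ← map_mul, inv_mul_cancel₀ hr, map_one, one_mul] at this
  have hx : xv 0 ∈ entriesIdeal φ := by
    apply hunit 2 _ two_ne_zero
    have := hK 0
    simp only [DuValType.equation] at this
    simp at this
    rwa [map_ofNat]
  have hy : xv 1 ∈ entriesIdeal φ := by
    apply hunit 2 _ two_ne_zero
    have := hK 1
    simp only [DuValType.equation] at this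
    simp at this
    rwa [map_ofNat]
  have hz : xv 2 ^ n ∈ entriesIdeal φ := by
    apply hunit (n + 1 : ℕ) _ (Nat.cast_ne_zero.2 n.succ_ne_zero)
    have := hK 2
    simp only [DuValType.equation] at this
    simp at this
    rw [map_natCast]
    simpa using this
  obtain ⟨⟨mL, hmL⟩, ⟨mR, hmR⟩⟩ := hdvd
  -- Since zⁿ ∈ I(φ), the quotients mL and mR matter only modulo zⁿ, and polynomials in z lift them
  -- to the 3-fold.
  obtain ⟨qL, vL, hvL⟩ := exists_aeval_sub_dvd mL n
  obtain ⟨qR, vR, hvR⟩ := exists_aeval_sub_dvd mR n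
  have hlift : ∀ q : Polynomial ℂ, Θ (Polynomial.aeval (xv 2) q) = Polynomial.aeval PowerSeries.X q :=
    fun q => by rw [← Polynomial.aeval_algHom_apply, hΘ2]
  have hX : (PowerSeries.X : PowerSeries ℂ) ^ (n + 1) ≠ 0 := pow_ne_zero _ PowerSeries.X_ne_zero
  have main : ∀ (i : Fin 2) (w : OX), w * φ.det = φ i 1 * minorL φ g h - φ i 0 * minorR φ g h →
      w ∈ entriesIdeal φ := by
    intro i w hw
    have e1 : Θ w = Θ (φ i 1) * mL - Θ (φ i 0) * mR := by
      apply mul_right_cancel₀ hX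
      have := congrArg Θ hw
      rw [map_mul, hdet, map_sub, map_mul, map_mul, hmL, hmR] at this
      rw [this]; ring
    have e2 : w - (φ i 1 * Polynomial.aeval (xv 2) qL - φ i 0 * Polynomial.aeval (xv 2) qR) ∈
        entriesIdeal φ := by
      refine mem_of_dvd_arc (s := xv 1) (r := 0) (by simp) hx hy hz Θ hΘ0 hΘ1 hΘ2 ?_
      rw [map_sub, map_sub, map_mul, map_mul, hlift, hlift, e1]
      refine ⟨Θ (φ i 1) * vL - Θ (φ i 0) * vR, ?_⟩
      linear_combination Θ (φ i 1) * hvL - Θ (φ i 0) * hvR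
    have e3 : φ i 1 * Polynomial.aeval (xv 2) qL - φ i 0 * Polynomial.aeval (xv 2) qR ∈
        entriesIdeal φ :=
      sub_mem (Ideal.mul_mem_right _ _ (entry_mem _ _ _)) (Ideal.mul_mem_right _ _ (entry_mem _ _ _))
    simpa using add_mem e2 e3
  exact ⟨main 0 g (by rw [Matrix.det_fin_two, minorL, minorR]; ring),
    main 1 h (by rw [Matrix.det_fin_two, minorL, minorR]; ring)⟩

end

end DuVal

/-! ### Orders of x, s, z along an arc: power series in one variable. -/

namespace DuVal

section PowerSeriesLemmas

open PowerSeries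

local notation "𝕋" => (PowerSeries.X : PowerSeries ℂ)

theorem constantCoeff_eq_zero_of_dvd {e : PowerSeries ℂ} {N M : ℕ} (hNM : N < M)
    (h : 𝕋 ^ M ∣ 𝕋 ^ N * e) : constantCoeff e = 0 := by
  have h1 : 𝕋 ^ N * 𝕋 ∣ 𝕋 ^ N * e := by
    rw [← pow_succ]; exact (pow_dvd_pow _ hNM).trans h
  exact X_dvd_iff.1 ((mul_dvd_mul_iff_left (pow_ne_zero _ X_ne_zero)).1 h1)

theorem isUnit_of_constantCoeff {e : PowerSeries ℂ} (h : constantCoeff e ≠ 0) : IsUnit e :=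
  PowerSeries.isUnit_iff_constantCoeff.2 (isUnit_iff_ne_zero.2 h)

theorem coeff_one_X_mul (e : PowerSeries ℂ) : coeff 1 (𝕋 * e) = constantCoeff e := by
  rw [show (1 : ℕ) = 0 + 1 from rfl, coeff_succ_X_mul, coeff_zero_eq_constantCoeff]

variable {α u₂ A u₄ u₅ u₆ X S Z a₀ b₀ c₀ e₀ f₀ g₀ a₁ b₁ c₁ e₁ f₁ g₁ : PowerSeries ℂ} {j : ℕ}

/-- On leading coefficients u₅ = 0, and αx² + u₄xzʲ vanishes together with its x-derivative,
although its discriminant (u₄zʲ)² is nonzero. -/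
theorem branch_top_order (hj : 1 ≤ j) (hX : 𝕋 ^ j ∣ X) (hS : 𝕋 ^ j ∣ S) (hZ : 𝕋 ∣ Z)
    (hu₂ : 𝕋 ∣ u₂) (hA : 𝕋 ∣ A)
    (hF : 𝕋 ^ (2 * j + 1) ∣ α * X ^ 2 + u₂ * X * S + A * S ^ 2 + u₄ * X * Z ^ j + u₅ * S * Z ^ j
      + u₆ * Z ^ (2 * j + 1))
    (h0 : 𝕋 ^ (j + 1) ∣ 2 * α * X + a₀ * X ^ 2 + u₂ * S + b₀ * X * S + c₀ * S ^ 2 + u₄ * Z ^ j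
      + e₀ * X * Z ^ j + f₀ * S * Z ^ j + g₀ * Z ^ (2 * j + 1))
    (h1 : 𝕋 ^ (j + 1) ∣ a₁ * X ^ 2 + u₂ * X + b₁ * X * S + 2 * A * S + c₁ * S ^ 2
      + e₁ * X * Z ^ j + u₅ * Z ^ j + f₁ * S * Z ^ j + g₁ * Z ^ (2 * j + 1))
    (hu₄ : constantCoeff u₄ ≠ 0) (hZ1 : coeff 1 Z ≠ 0) : False := by
  obtain ⟨x, rfl⟩ := hX
  obtain ⟨s, rfl⟩ := hS
  obtain ⟨z, rfl⟩ := hZ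
  obtain ⟨v, rfl⟩ := hu₂
  obtain ⟨B, rfl⟩ := hA
  rw [coeff_one_X_mul] at hZ1
  obtain ⟨i, rfl⟩ : ∃ i, j = i + 1 := ⟨j - 1, by omega⟩
  have k1 := constantCoeff_eq_zero_of_dvd (N := i + 1) (M := i + 1 + 1)
    (e := u₅ * z ^ (i + 1) + 𝕋 * (a₁ * x ^ 2 * 𝕋 ^ i + v * x + b₁ * x * s * 𝕋 ^ i + 2 * B * s
      + c₁ * s ^ 2 * 𝕋 ^ i + e₁ * x * z ^ (i + 1) * 𝕋 ^ i + f₁ * s * z ^ (i + 1) * 𝕋 ^ i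
      + g₁ * z ^ (2 * (i + 1) + 1) * 𝕋 ^ (i + 1))) (by omega) (by
      convert h1 using 1
      ring)
  have k0 := constantCoeff_eq_zero_of_dvd (N := i + 1) (M := i + 1 + 1)
    (e := 2 * α * x + u₄ * z ^ (i + 1) + 𝕋 * (a₀ * x ^ 2 * 𝕋 ^ i + v * s + b₀ * x * s * 𝕋 ^ i
      + c₀ * s ^ 2 * 𝕋 ^ i + e₀ * x * z ^ (i + 1) * 𝕋 ^ i + f₀ * s * z ^ (i + 1) * 𝕋 ^ i
      + g₀ * z ^ (2 * (i + 1) + 1) * 𝕋 ^ (i + 1))) (by omega) (by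
      convert h0 using 1
      ring)
  have k2 := constantCoeff_eq_zero_of_dvd (N := 2 * (i + 1)) (M := 2 * (i + 1) + 1)
    (e := α * x ^ 2 + u₄ * x * z ^ (i + 1) + u₅ * s * z ^ (i + 1)
      + 𝕋 * (v * x * s + B * s ^ 2 + u₆ * z ^ (2 * (i + 1) + 1))) (by omega) (by
      convert hF using 1
      ring)
  simp only [map_add, map_mul, map_pow, constantCoeff_X, zero_mul, add_zero, map_ofNat] at k0 k1 k2
  set z0 := (constantCoeff z) ^ (i + 1)
  have hz0 : z0 ≠ 0 := pow_ne_zero _ hZ1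
  have hu5 : constantCoeff u₅ = 0 := (mul_eq_zero.1 k1).resolve_right hz0
  rw [hu5] at k2
  have h3 : (constantCoeff u₄ * z0) ^ 2 = 0 := by
    linear_combination (-4 * constantCoeff α) * k2
      + (2 * constantCoeff α * constantCoeff x + constantCoeff u₄ * z0) * k0
  exact mul_ne_zero hu₄ hz0 (pow_eq_zero_iff two_ne_zero |>.1 h3)

/-- In the x-derivative X has a unit coefficient, and every term not containing it in this way has
order at least i + 1. -/
theorem branch_x_order {i : ℕ} (hi : 2 ≤ i) (hij : i + 1 ≤ j) (hS : 𝕋 ^ i ∣ S) (hX : 𝕋 ∣ X)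
    (hZ : 𝕋 ∣ Z) (hu₂ : 𝕋 ∣ u₂)
    (h0 : 𝕋 ^ (i + 1) ∣ 2 * α * X + a₀ * X ^ 2 + u₂ * S + b₀ * X * S + c₀ * S ^ 2 + u₄ * Z ^ j
      + e₀ * X * Z ^ j + f₀ * S * Z ^ j + g₀ * Z ^ (2 * j + 1))
    (hα : constantCoeff α ≠ 0) : 𝕋 ^ (i + 1) ∣ X := by
  have hZj : 𝕋 ^ (i + 1) ∣ Z ^ j := (pow_dvd_pow _ hij).trans (pow_dvd_pow_of_dvd hZ j)
  have hZj' : 𝕋 ^ (i + 1) ∣ Z ^ (2 * j + 1) :=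
    (pow_dvd_pow _ (by omega)).trans (pow_dvd_pow_of_dvd hZ _)
  have hSS : 𝕋 ^ (i + 1) ∣ S ^ 2 := by
    refine (pow_dvd_pow _ (by omega : i + 1 ≤ i * 2)).trans ?_
    rw [pow_mul]
    exact pow_dvd_pow_of_dvd hS 2
  have hu : 𝕋 ^ (i + 1) ∣ u₂ * S := by
    rw [pow_succ']; exact mul_dvd_mul hu₂ hS
  have hrest : 𝕋 ^ (i + 1) ∣ u₂ * S + c₀ * S ^ 2 + u₄ * Z ^ j + f₀ * S * Z ^ j
      + g₀ * Z ^ (2 * j + 1) :=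
    dvd_add (dvd_add (dvd_add (dvd_add hu (hSS.mul_left _)) (hZj.mul_left _)) (hZj.mul_left _))
      (hZj'.mul_left _)
  have hprod : 𝕋 ^ (i + 1) ∣ (2 * α + a₀ * X + b₀ * S + e₀ * Z ^ j) * X := by
    have := dvd_sub h0 hrest
    convert this using 1
    ring
  have hunit : IsUnit (2 * α + a₀ * X + b₀ * S + e₀ * Z ^ j) := by
    apply isUnit_of_constantCoeff
    have hX0 : constantCoeff X = 0 := X_dvd_iff.1 hX
    have hZ0 : constantCoeff (Z ^ j) = 0 :=
      X_dvd_iff.1 ((dvd_pow_self _ (by omega)).trans hZj)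
    have hS0 : constantCoeff S = 0 := X_dvd_iff.1 ((dvd_pow_self _ (by omega)).trans hS)
    simp only [map_add, map_mul, map_ofNat, hX0, hZ0, hS0, mul_zero, add_zero]
    exact mul_ne_zero two_ne_zero hα
  exact (hunit.dvd_mul_left).1 hprod

theorem branch_x_two (hj : 2 ≤ j) (hX : 𝕋 ∣ X) (hS : 𝕋 ∣ S) (hZ : 𝕋 ∣ Z) (hu₂ : 𝕋 ∣ u₂)
    (h0 : 𝕋 ^ 2 ∣ 2 * α * X + a₀ * X ^ 2 + u₂ * S + b₀ * X * S + c₀ * S ^ 2 + u₄ * Z ^ j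
      + e₀ * X * Z ^ j + f₀ * S * Z ^ j + g₀ * Z ^ (2 * j + 1))
    (hα : constantCoeff α ≠ 0) : 𝕋 ^ 2 ∣ X := by
  obtain ⟨x, rfl⟩ := hX
  obtain ⟨z, rfl⟩ := hZ
  obtain ⟨s, rfl⟩ := hS
  obtain ⟨v, rfl⟩ := hu₂
  obtain ⟨i, rfl⟩ : ∃ i, j = i + 2 := ⟨j - 2, by omega⟩
  have k := constantCoeff_eq_zero_of_dvd (N := 1) (M := 2)
    (e := 2 * α * x + 𝕋 * (a₀ * x ^ 2 + v * s + b₀ * x * s + c₀ * s ^ 2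
      + u₄ * z ^ (i + 2) * 𝕋 ^ i + e₀ * x * z ^ (i + 2) * 𝕋 ^ (i + 1)
      + f₀ * s * z ^ (i + 2) * 𝕋 ^ (i + 1) + g₀ * z ^ (2 * (i + 2) + 1) * 𝕋 ^ (2 * i + 3)))
    (by omega) (by
      convert h0 using 1
      ring)
  simp only [map_add, map_mul, map_ofNat, constantCoeff_X, zero_mul, add_zero] at k
  rw [pow_two]
  exact mul_dvd_mul_left _
    (X_dvd_iff.2 ((mul_eq_zero.1 k).resolve_left (mul_ne_zero two_ne_zero hα)))

/-- Write A = 𝕋B. While i + 1 < j the leading coefficient of the s-derivative is 2Bs. At i + 1 = j a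
term with u₅ joins it, and comparison with the function itself leaves Bs² = 0. -/
theorem branch_s_order {i : ℕ} (hi : 2 ≤ i) (hij : i + 1 ≤ j) (hS : 𝕋 ^ i ∣ S)
    (hX : 𝕋 ^ (i + 1) ∣ X) (hZ : 𝕋 ∣ Z) (hu₂ : 𝕋 ∣ u₂) (hA : 𝕋 ∣ A) (hA1 : coeff 1 A ≠ 0)
    (hF : 𝕋 ^ (2 * j + 1) ∣ α * X ^ 2 + u₂ * X * S + A * S ^ 2 + u₄ * X * Z ^ j + u₅ * S * Z ^ j
      + u₆ * Z ^ (2 * j + 1))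
    (h1 : 𝕋 ^ (j + 1) ∣ a₁ * X ^ 2 + u₂ * X + b₁ * X * S + 2 * A * S + c₁ * S ^ 2
      + e₁ * X * Z ^ j + u₅ * Z ^ j + f₁ * S * Z ^ j + g₁ * Z ^ (2 * j + 1)) :
    𝕋 ^ (i + 1) ∣ S := by
  obtain ⟨x, rfl⟩ := hX
  obtain ⟨s, rfl⟩ := hS
  obtain ⟨z, rfl⟩ := hZ
  obtain ⟨v, rfl⟩ := hu₂
  obtain ⟨B, rfl⟩ := hA
  rw [coeff_one_X_mul] at hA1
  suffices hs : constantCoeff s = 0 by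
    rw [pow_succ]; exact mul_dvd_mul_left _ (X_dvd_iff.2 hs)
  obtain ⟨m, rfl⟩ : ∃ m, i = m + 2 := ⟨i - 2, by omega⟩
  obtain ⟨d, rfl⟩ : ∃ d, j = m + 2 + 1 + d := ⟨j - (m + 2 + 1), by omega⟩
  have k1 := constantCoeff_eq_zero_of_dvd (N := m + 2 + 1) (M := m + 2 + 1 + d + 1)
    (e := 2 * B * s + u₅ * z ^ (m + 2 + 1 + d) * 𝕋 ^ d + 𝕋 * (a₁ * x ^ 2 * 𝕋 ^ (m + 2) + v * x
      + b₁ * x * s * 𝕋 ^ (m + 1) + c₁ * s ^ 2 * 𝕋 ^ m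
      + e₁ * x * z ^ (m + 2 + 1 + d) * 𝕋 ^ (m + 2 + d)
      + f₁ * s * z ^ (m + 2 + 1 + d) * 𝕋 ^ (m + 1 + d)
      + g₁ * z ^ (2 * (m + 2 + 1 + d) + 1) * 𝕋 ^ (m + 3 + 2 * d))) (by omega) (by
      convert h1 using 1
      ring)
  rcases Nat.eq_zero_or_pos d with rfl | hd
  · have k2 := constantCoeff_eq_zero_of_dvd (N := 2 * (m + 2) + 1) (M := 2 * (m + 2 + 1 + 0) + 1)
      (e := B * s ^ 2 + u₅ * s * z ^ (m + 3) + 𝕋 * (α * x ^ 2 + v * x * s + u₄ * x * z ^ (m + 3)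
        + u₆ * z ^ (2 * (m + 3) + 1) * 𝕋)) (by omega) (by
        convert hF using 1
        ring)
    simp only [map_add, map_mul, map_pow, constantCoeff_X, zero_mul, add_zero, map_ofNat,
      pow_zero, mul_one] at k1 k2
    have h3 : constantCoeff B * (constantCoeff s) ^ 2 = 0 := by
      linear_combination constantCoeff s * k1 - k2
    exact pow_eq_zero_iff two_ne_zero |>.1 ((mul_eq_zero.1 h3).resolve_left hA1)
  · simp only [map_add, map_mul, map_pow, constantCoeff_X, zero_mul, add_zero, map_ofNat,
      zero_pow hd.ne', mul_zero] at k1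
    rcases mul_eq_zero.1 k1 with h | h
    · exact absurd h (mul_ne_zero two_ne_zero hA1)
    · exact h

/-- The tangent of the arc is a multiple root of the cubic c₁s³ + r₂s²z + u₅sz², where the last term
occurs only for j = 2. The conditions on r₂ and on the discriminant leave s = 0 as the only possible
multiple root. -/
theorem branch_s_tangent {p₂ q₂ r₂ s₂ t₂ v₂ : PowerSeries ℂ} (hj : 2 ≤ j) (hX : 𝕋 ^ 2 ∣ X)
    (hS : 𝕋 ∣ S) (hZ : 𝕋 ∣ Z) (hu₂ : 𝕋 ∣ u₂) (hA : 𝕋 ∣ A)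
    (h1 : 𝕋 ^ 3 ∣ a₁ * X ^ 2 + u₂ * X + b₁ * X * S + 2 * A * S + c₁ * S ^ 2
      + e₁ * X * Z ^ j + u₅ * Z ^ j + f₁ * S * Z ^ j + g₁ * Z ^ (2 * j + 1))
    (h2 : 𝕋 ^ 3 ∣ p₂ * X ^ 2 + q₂ * X * S + r₂ * S ^ 2 + s₂ * X * Z ^ (j - 1)
      + (t₂ * Z + j * u₅) * S * Z ^ (j - 1) + v₂ * Z ^ (2 * j))
    (hA1 : coeff 1 A = constantCoeff c₁ * coeff 1 S + constantCoeff r₂ * coeff 1 Z)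
    (hr : constantCoeff r₂ ≠ 0)
    (hdisc : j = 2 → constantCoeff r₂ ^ 2 - 4 * constantCoeff c₁ * constantCoeff u₅ ≠ 0) :
    coeff 1 S = 0 := by
  obtain ⟨x, rfl⟩ := hX
  obtain ⟨s, rfl⟩ := hS
  obtain ⟨z, rfl⟩ := hZ
  obtain ⟨v, rfl⟩ := hu₂
  obtain ⟨B, rfl⟩ := hA
  simp only [coeff_one_X_mul] at *
  obtain ⟨i, rfl⟩ : ∃ i, j = i + 2 := ⟨j - 2, by omega⟩
  rw [show i + 2 - 1 = i + 1 by omega] at h2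
  have k1 := constantCoeff_eq_zero_of_dvd (N := 2) (M := 3)
    (e := 2 * B * s + c₁ * s ^ 2 + u₅ * z ^ (i + 2) * 𝕋 ^ i + 𝕋 * (a₁ * x ^ 2 * 𝕋 + v * x
      + b₁ * x * s + e₁ * x * z ^ (i + 2) * 𝕋 ^ (i + 1) + f₁ * s * z ^ (i + 2) * 𝕋 ^ i
      + g₁ * z ^ (2 * (i + 2) + 1) * 𝕋 ^ (2 * i + 2))) (by omega) (by
      convert h1 using 1
      ring)
  have k2 := constantCoeff_eq_zero_of_dvd (N := 2) (M := 3)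
    (e := r₂ * s ^ 2 + ((i + 2 : ℕ) : PowerSeries ℂ) * u₅ * s * z ^ (i + 1) * 𝕋 ^ i
      + 𝕋 * (p₂ * x ^ 2 * 𝕋 + q₂ * x * s + s₂ * x * z ^ (i + 1) * 𝕋 ^ i
      + t₂ * z * s * z ^ (i + 1) * 𝕋 ^ i + v₂ * z ^ (2 * (i + 2)) * 𝕋 ^ (2 * i + 1))) (by omega) (by
      convert h2 using 1
      ring)
  simp only [map_add, map_mul, map_pow, constantCoeff_X, zero_mul, add_zero, map_ofNat,
    map_natCast, hA1] at k1 k2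
  by_contra hs
  rcases Nat.eq_zero_or_pos i with rfl | hi
  · have hd := hdisc rfl
    simp only [pow_zero, mul_one] at k1 k2
    norm_num at k1 k2
    have k3 : constantCoeff r₂ * constantCoeff s + 2 * constantCoeff u₅ * constantCoeff z = 0 := by
      apply mul_left_cancel₀ hs
      linear_combination k2
    by_cases hz : constantCoeff z = 0
    · rw [hz] at k3
      exact mul_ne_zero hr hs (by linear_combination k3)
    · have k4 : constantCoeff u₅ * (constantCoeff r₂ ^ 2 - 4 * constantCoeff c₁ * constantCoeff u₅)
          * constantCoeff z ^ 2 = 0 := by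
        linear_combination (- constantCoeff r₂ ^ 2 / 3) * k1
          + (constantCoeff c₁ * (constantCoeff r₂ * constantCoeff s
            - 2 * constantCoeff u₅ * constantCoeff z)
            + 2 / 3 * constantCoeff r₂ ^ 2 * constantCoeff z) * k3
      have h5 := (mul_eq_zero.1 ((mul_eq_zero.1 k4).resolve_right (pow_ne_zero _ hz))).resolve_right hd
      rw [h5] at k3
      exact mul_ne_zero hr hs (by linear_combination k3)
  · simp only [zero_pow hi.ne', mul_zero, add_zero] at k2
    exact mul_ne_zero hr (pow_ne_zero 2 hs) k2

/-- A function `α x² + u₂ x s + A s² + (u₄ x + u₅ s) z^j + u₆ z^(2j+1)` with `α`, `u₄` units does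
not vanish to order `2 j + 1`, with gradient vanishing to order `j + 1`, along a branch
transversal to `z = 0`. -/
theorem branch_contradiction (hj : 2 ≤ j) (hX : 𝕋 ∣ X) (hS : 𝕋 ^ 2 ∣ S) (hZ : 𝕋 ∣ Z)
    (hu₂ : 𝕋 ∣ u₂) (hA : 𝕋 ∣ A) (hA1 : j ≠ 2 → coeff 1 A ≠ 0)
    (hF : 𝕋 ^ (2 * j + 1) ∣ α * X ^ 2 + u₂ * X * S + A * S ^ 2 + u₄ * X * Z ^ j + u₅ * S * Z ^ j
      + u₆ * Z ^ (2 * j + 1))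
    (h0 : 𝕋 ^ (j + 1) ∣ 2 * α * X + a₀ * X ^ 2 + u₂ * S + b₀ * X * S + c₀ * S ^ 2 + u₄ * Z ^ j
      + e₀ * X * Z ^ j + f₀ * S * Z ^ j + g₀ * Z ^ (2 * j + 1))
    (h1 : 𝕋 ^ (j + 1) ∣ a₁ * X ^ 2 + u₂ * X + b₁ * X * S + 2 * A * S + c₁ * S ^ 2
      + e₁ * X * Z ^ j + u₅ * Z ^ j + f₁ * S * Z ^ j + g₁ * Z ^ (2 * j + 1))
    (hα : constantCoeff α ≠ 0) (hu₄ : constantCoeff u₄ ≠ 0) (hZ1 : coeff 1 Z ≠ 0) : False := by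
  -- The orders of X and S are raised alternately until both reach j, where `branch_top_order`
  -- applies.
  have key : ∀ i, 2 ≤ i → i ≤ j → 𝕋 ^ i ∣ S := by
    intro i hi
    induction i, hi using Nat.le_induction with
    | base => intro _; exact hS
    | succ i hi ih =>
      intro hij
      have hSi := ih (by omega)
      have hXi := branch_x_order hi hij hSi hX hZ hu₂
        ((pow_dvd_pow _ (by omega)).trans h0) hα
      exact branch_s_order hi hij hSi hXi hZ hu₂ hA (hA1 (by omega)) hF h1
  have hSj := key j hj le_rfl
  have hXj : 𝕋 ^ j ∣ X := by
    rcases hj.eq_or_lt with rfl | hj3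
    · exact branch_x_two le_rfl hX ((dvd_pow_self _ two_ne_zero).trans hS) hZ hu₂
        ((pow_dvd_pow _ (by omega)).trans h0) hα
    · have := branch_x_order (i := j - 1) (by omega) (by omega) (key (j - 1) (by omega) (by omega))
        hX hZ hu₂ ((pow_dvd_pow _ (by omega)).trans h0) hα
      rwa [Nat.sub_add_cancel (by omega)] at this
  exact branch_top_order (by omega) hXj hSj hZ hu₂ hA hF h0 h1 hu₄ hZ1

end PowerSeriesLemmas

end DuVal

/-! ### Types D and E: first-order consequences of the rank one Hessian. -/

namespace DuVal

open MvPowerSeries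

theorem pd_comm (a b : Fin 3) (w : OX) : pd a (pd b w) = pd b (pd a w) := by
  ext m
  simp only [pd, MvPowerSeries.coeff_pderiv]
  rcases eq_or_ne a b with rfl | hab
  · rfl
  · simp [hab, hab.symm, add_right_comm]
    ring

theorem cc_hessian_mul (d d' : Derivation ℂ OX OX) (p q : OX) :
    cc (d (d' (p * q))) = cc p * cc (d (d' q)) + cc (d p) * cc (d' q) + cc q * cc (d (d' p))
      + cc (d q) * cc (d' p) := by
  simp only [derivation_mul, map_add, map_mul]
  ring

section

variable {T : DuValType} {φ : Matrix (Fin 2) (Fin 2) OX} {g h : OX}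

theorem cc_hessian_equation (hT : IsDE T) (a b : Fin 3) :
    cc (pd a (pd b T.equation)) = if a = 0 ∧ b = 0 then 2 else 0 := by
  obtain ⟨c, hc, e⟩ := equation_de hT
  have h1 : cc (pd a (pd b c)) = 0 :=
    mem_maxId.1 (derivation_mem_maxId _ (derivation_mem_maxId_pow _ hc))
  rw [e, map_add, map_add, map_add, h1, add_zero, pow_two, cc_hessian_mul]
  simp only [pd_xv]
  fin_cases a <;> fin_cases b <;> norm_num [one_add_one_eq_two]

/-- Every member of the net has a Hessian of rank at most one. Along the pencil spanned by det φ =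
x² + ⋯ and one minor, this kills every entry of the Hessian of the minor outside the (x, x) place.
-/
theorem IsGeneralNormal.cc_hessian_minor (H : IsGeneralNormal T φ g h) (hT : IsDE T) {a b : Fin 3}
    (hab : b ≠ 0) : cc (pd a (pd b (minorL φ g h))) = 0 ∧ cc (pd a (pd b (minorR φ g h))) = 0 := by
  have key : ∀ (a b a' b' : Fin 3) (c : Fin 3 → ℂ),
      (c 0 * cc (pd a (pd b φ.det)) + c 1 * cc (pd a (pd b (minorL φ g h)))
        + c 2 * cc (pd a (pd b (minorR φ g h)))) *
      (c 0 * cc (pd a' (pd b' φ.det)) + c 1 * cc (pd a' (pd b' (minorL φ g h)))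
        + c 2 * cc (pd a' (pd b' (minorR φ g h)))) -
      (c 0 * cc (pd a (pd b' φ.det)) + c 1 * cc (pd a (pd b' (minorL φ g h)))
        + c 2 * cc (pd a (pd b' (minorR φ g h)))) *
      (c 0 * cc (pd a' (pd b φ.det)) + c 1 * cc (pd a' (pd b (minorL φ g h)))
        + c 2 * cc (pd a' (pd b (minorR φ g h)))) = 0 := by
    intro a b a' b'
    refine H.eq_zero_of_closed _ (by fun_prop) (fun c hc => ?_)
    have := hc.hessian hT (pd a) (pd a') (pd b) (pd b')
    simp only [map_add, cc_smul, Derivation.map_smul] at this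
    exact sub_eq_zero.2 this
  -- the polynomial identities along a pencil spanned by the determinant and one minor
  have aux : ∀ q : Fin 3 → Fin 3 → ℂ, (∀ a b, q a b = q b a) →
      (∀ (t : ℂ) (a b a' b' : Fin 3), ((if a = 0 ∧ b = 0 then 2 else 0) + t * q a b) *
        ((if a' = 0 ∧ b' = 0 then 2 else 0) + t * q a' b') -
        ((if a = 0 ∧ b' = 0 then 2 else 0) + t * q a b') *
        ((if a' = 0 ∧ b = 0 then 2 else 0) + t * q a' b) = 0) → ∀ a b, b ≠ 0 → q a b = 0 := by
    intro q hq ht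
    have h1 : ∀ a b, a ≠ 0 → b ≠ 0 → q a b = 0 ∧ q 0 b * q a 0 = 0 := by
      intro a b ha hb
      -- The parameters 1 and -1 separate the linear part of the identity from the quadratic part.
      have e1 := ht 1 0 0 a b
      have e2 := ht (-1) 0 0 a b
      simp only [ha, hb, and_self, and_false, and_true, if_true, if_false] at e1 e2
      have e3 : q a b = 0 := by linear_combination (e1 - e2) / 4
      refine ⟨e3, ?_⟩
      rw [e3] at e1
      linear_combination -e1
    intro a b hb
    by_cases ha : a = 0
    · subst ha
      have := (h1 b b hb hb).2
      rw [hq b 0] at this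
      exact mul_self_eq_zero.1 this
    · exact (h1 a b ha hb).1
  refine ⟨aux (fun a b => cc (pd a (pd b (minorL φ g h)))) (fun a b => by rw [pd_comm]) ?_ a b hab,
    aux (fun a b => cc (pd a (pd b (minorR φ g h)))) (fun a b => by rw [pd_comm]) ?_ a b hab⟩
  · intro t a b a' b'
    have := key a b a' b' ![1, t, 0]
    simp only [H.det_eq, cc_hessian_equation hT] at this
    simpa using this
  · intro t a b a' b'
    have := key a b a' b' ![1, 0, t]
    simp only [H.det_eq, cc_hessian_equation hT] at this
    simpa using this

/-- The coefficient of x² in det φ is 1. Through the invertible matrix ∂ₓφ(0), conditions on the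
minors become conditions on g and h. -/
theorem IsGeneralNormal.det_gradient (H : IsGeneralNormal T φ g h) (hT : IsDE T)
    (hφ : ∀ i j, cc (φ i j) = 0) :
    cc (pd 0 (φ 0 0)) * cc (pd 0 (φ 1 1)) - cc (pd 0 (φ 0 1)) * cc (pd 0 (φ 1 0)) = 1 := by
  have h1 := cc_hessian_equation hT 0 0
  rw [← H.det_eq, Matrix.det_fin_two, map_sub, map_sub, map_sub, cc_hessian_mul, cc_hessian_mul] at h1
  simp only [hφ, and_self, if_true] at h1
  linear_combination h1 / 2

theorem eq_zero_of_adjugate {a b c d u v : ℂ} (hdet : a * d - b * c = 1) (h1 : a * v - c * u = 0)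
    (h2 : b * v - d * u = 0) : u = 0 ∧ v = 0 :=
  ⟨by linear_combination -u * hdet + b * h1 - a * h2,
    by linear_combination -v * hdet + d * h1 - c * h2⟩

theorem IsGeneralNormal.cc_eq_zero (H : IsGeneralNormal T φ g h) (hT : IsDE T)
    (hφ : ∀ i j, cc (φ i j) = 0) : cc g = 0 ∧ cc h = 0 := by
  have hL := (mem_sq_iff.1 H.minor_mem_sq.1).2 0
  have hR := (mem_sq_iff.1 H.minor_mem_sq.2).2 0
  rw [minorL, map_sub, map_sub, derivation_mul, derivation_mul] at hL
  rw [minorR, map_sub, map_sub, derivation_mul, derivation_mul] at hR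
  simp only [map_add, map_mul, hφ] at hL hR
  exact eq_zero_of_adjugate (H.det_gradient hT hφ) (by linear_combination hL)
    (by linear_combination hR)

/-- Tangent directions in the plane `x = 0` killed by `φ` are killed by the last column. -/
theorem IsGeneralNormal.tangent_eq_zero (H : IsGeneralNormal T φ g h) (hT : IsDE T)
    (hφ : ∀ i j, cc (φ i j) = 0) (α β : ℂ)
    (hτ : ∀ i j, α * cc (pd 1 (φ i j)) + β * cc (pd 2 (φ i j)) = 0) :
    α * cc (pd 1 g) + β * cc (pd 2 g) = 0 ∧ α * cc (pd 1 h) + β * cc (pd 2 h) = 0 := by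
  obtain ⟨hg, hh⟩ := H.cc_eq_zero hT hφ
  obtain ⟨l1, r1⟩ := H.cc_hessian_minor hT (a := 0) (b := 1) (by decide)
  obtain ⟨l2, r2⟩ := H.cc_hessian_minor hT (a := 0) (b := 2) (by decide)
  rw [minorL, map_sub, map_sub, map_sub, cc_hessian_mul, cc_hessian_mul, hφ, hφ, hg, hh] at l1 l2
  rw [minorR, map_sub, map_sub, map_sub, cc_hessian_mul, cc_hessian_mul, hφ, hφ, hg, hh] at r1 r2
  refine eq_zero_of_adjugate (H.det_gradient hT hφ) ?_ ?_
  · linear_combination α * l1 + β * l2 - cc (pd 0 h) * hτ 0 0 + cc (pd 0 g) * hτ 1 0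
  · linear_combination α * r1 + β * r2 - cc (pd 0 h) * hτ 0 1 + cc (pd 0 g) * hτ 1 1

theorem mem_of_isUnit_mul_mem {K : Ideal OX} {u a : OX} (hu : cc u ≠ 0) (h : u * a ∈ K) : a ∈ K :=
  (Ideal.unit_mul_mem_iff_mem K (isUnit_iff_cc.2 hu)).1 h

theorem mem_of_C_mul_mem {K : Ideal OX} {r : ℂ} {a : OX} (hr : r ≠ 0) (h : C r * a ∈ K) : a ∈ K :=
  mem_of_isUnit_mul_mem (by rwa [cc_C]) h

theorem pd_zero_equation (hT : IsDE T) : pd 0 T.equation = 2 * xv 0 := by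
  cases T with
  | A n hn => exact hT.elim
  | _ => simp [DuValType.equation]

theorem IsGeneralNormal.x_mem (H : IsGeneralNormal T φ g h) (hT : IsDE T) :
    xv 0 ∈ entriesIdeal φ := by
  have := derivation_det_mem (pd 0) φ
  rw [H.det_eq, pd_zero_equation hT] at this
  refine mem_of_isUnit_mul_mem (u := 2) ?_ this
  rw [map_ofNat]; exact two_ne_zero

/-- Some entry of `φ` has a nonzero derivative in the plane `x = 0`. -/
theorem IsGeneralNormal.exists_entry (H : IsGeneralNormal T φ g h) (hT : IsDE T)
    (hφ : ∀ i j, cc (φ i j) = 0) :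
    ∃ i j, cc (pd 1 (φ i j)) ≠ 0 ∨ cc (pd 2 (φ i j)) ≠ 0 := by
  by_contra! hne
  -- Along x = 0, y = z the determinant would have order at least four, while the D and E equations
  -- have t³-coefficient 2 (for D₄) or 1 (otherwise).
  obtain ⟨Θ, hΘ⟩ := exists_arc ![0, PowerSeries.X, PowerSeries.X] (by
    intro i; fin_cases i <;> simp)
  have h0 : Θ (xv 0) = 0 := hΘ 0
  have h1 : Θ (xv 1) = PowerSeries.X := hΘ 1
  have h2 : Θ (xv 2) = PowerSeries.X := hΘ 2
  have hd : ∀ i j, PowerSeries.X ^ 2 ∣ Θ (φ i j) := by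
    intro i j
    rw [PowerSeries.X_pow_dvd_iff]
    intro m hm
    interval_cases m
    · rw [PowerSeries.coeff_zero_eq_constantCoeff, constantCoeff_arc, hφ]
    · rw [coeff_one_arc _ (mem_maxId.2 (hφ i j)), Fin.sum_univ_three, h0, (hne i j).1, (hne i j).2]
      simp
  have hdet : PowerSeries.X ^ 4 ∣ Θ T.equation := by
    rw [← H.det_eq, Matrix.det_fin_two, map_sub, map_mul, map_mul,
      show (PowerSeries.X : PowerSeries ℂ) ^ 4 = PowerSeries.X ^ 2 * PowerSeries.X ^ 2 by ring]
    exact dvd_sub (mul_dvd_mul (hd _ _) (hd _ _)) (mul_dvd_mul (hd _ _) (hd _ _))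
  have := PowerSeries.X_pow_dvd_iff.1 hdet 3 (by norm_num)
  cases T with
  | A n hn => exact hT.elim
  | D n hn =>
    simp only [DuValType.equation, map_add, map_mul, map_pow, h0, h1, h2, ← pow_succ,
      PowerSeries.coeff_X_pow] at this
    by_cases hn4 : n = 4
    · subst hn4; norm_num at this
    · rw [if_neg (show ¬ 3 = n - 1 by omega)] at this
      norm_num at this
  | _ => norm_num [DuValType.equation, map_add, map_mul, map_pow, h0, h1, h2, ← pow_succ',
      PowerSeries.coeff_X_pow] at this

theorem exists_decomp_sq {w : OX} (h0 : cc w = 0) (h2 : cc (pd 2 w) = 0) :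
    ∃ a b c : OX, w = xv 0 * a + xv 1 * b + xv 2 ^ 2 * c ∧ cc b = cc (pd 1 w) := by
  obtain ⟨a, b, c, rfl⟩ := exists_decomp h0
  have hc : cc c = 0 := by simpa [pd_mul] using h2
  obtain ⟨a', b', c', rfl⟩ := exists_decomp hc
  refine ⟨a + xv 2 * a', b + xv 2 * b', c', by ring, ?_⟩
  simp

/-- The case of a smooth equation transversal to the plane `z = 0` among the entries. -/
theorem IsGeneralNormal.mem_of_transversal (H : IsGeneralNormal T φ g h) (hT : IsDE T)
    (hφ : ∀ i j, cc (φ i j) = 0) {i₀ j₀ : Fin 2} (hs : cc (pd 2 (φ i₀ j₀)) ≠ 0) :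
    g ∈ entriesIdeal φ ∧ h ∈ entriesIdeal φ := by
  have hx := H.x_mem hT
  obtain ⟨a, b, c, e⟩ := exists_decomp (hφ i₀ j₀)
  have hc : cc c ≠ 0 := by
    have : cc (pd 2 (φ i₀ j₀)) = cc c := by rw [e]; simp
    rwa [this] at hs
  obtain ⟨r, hr⟩ : ∃ r, xv 2 - xv 1 * r ∈ entriesIdeal φ := by
    obtain ⟨u, rfl⟩ := isUnit_iff_cc.2 hc
    refine ⟨-(b * ↑u⁻¹), ?_⟩
    have h1 : ↑u⁻¹ * (φ i₀ j₀ - xv 0 * a) ∈ entriesIdeal φ :=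
      Ideal.mul_mem_left _ _ (sub_mem (entry_mem _ _ _) (Ideal.mul_mem_right _ _ hx))
    convert h1 using 1
    rw [e]
    linear_combination (- xv 2) * u.inv_mul
  have hpd : ∀ d : Fin 3, pd d T.equation ∈ entriesIdeal φ := fun d => by
    rw [← H.det_eq]; exact derivation_det_mem _ _
  -- Once x, z - yr and y² lie in I(φ), the quotient is spanned by 1 and y, and only the derivative
  -- in the direction (1, r(0)) of the (y, z)-plane matters.
  have hy : xv 1 ^ 2 ∈ entriesIdeal φ := by
    have hd1 := hpd 1
    have hd2 := hpd 2
    cases T with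
    | A n hn => exact hT.elim
    | D n hn =>
      obtain ⟨m, rfl⟩ : ∃ m, n = m + 4 := ⟨n - 4, by omega⟩
      have e1 : pd 1 (DuValType.D (m + 4) hn).equation = 2 * (xv 1 * xv 2) := by
        simp [DuValType.equation]; ring
      have e2 : pd 2 (DuValType.D (m + 4) hn).equation = xv 1 ^ 2 + (m + 3) * xv 2 ^ (m + 2) := by
        simp [DuValType.equation]
      rw [e1] at hd1
      rw [e2] at hd2
      have hyz : xv 1 * xv 2 ∈ entriesIdeal φ :=
        mem_of_isUnit_mul_mem (u := 2) (by rw [map_ofNat]; exact two_ne_zero) hd1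
      have hz2 : xv 2 ^ 2 ∈ entriesIdeal φ := by
        have : xv 2 ^ 2 = xv 2 * (xv 2 - xv 1 * r) + r * (xv 1 * xv 2) := by ring
        rw [this]
        exact add_mem (Ideal.mul_mem_left _ _ hr) (Ideal.mul_mem_left _ _ hyz)
      have : xv 1 ^ 2 = (xv 1 ^ 2 + (m + 3) * xv 2 ^ (m + 2)) - (m + 3) * xv 2 ^ m * xv 2 ^ 2 := by
        ring
      rw [this]
      exact sub_mem hd2 (Ideal.mul_mem_left _ _ hz2)
    | E6 =>
      have e1 : pd 1 DuValType.E6.equation = 3 * xv 1 ^ 2 := by simp [DuValType.equation]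
      rw [e1] at hd1
      exact mem_of_isUnit_mul_mem (u := 3) (by rw [map_ofNat]; exact three_ne_zero) hd1
    | E7 =>
      have e1 : pd 1 DuValType.E7.equation = 3 * xv 1 ^ 2 + xv 2 ^ 3 := by
        simp [DuValType.equation]
      rw [e1] at hd1
      refine mem_of_isUnit_mul_mem (u := 3 + xv 1 * r ^ 3) (by
        rw [map_add, map_mul, map_ofNat]; simp) ?_
      have : (3 + xv 1 * r ^ 3) * xv 1 ^ 2 = (3 * xv 1 ^ 2 + xv 2 ^ 3)
          - (xv 2 ^ 2 + xv 2 * (xv 1 * r) + (xv 1 * r) ^ 2) * (xv 2 - xv 1 * r) := by ring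
      rw [this]
      exact sub_mem hd1 (Ideal.mul_mem_left _ _ hr)
    | E8 =>
      have e1 : pd 1 DuValType.E8.equation = 3 * xv 1 ^ 2 := by simp [DuValType.equation]
      rw [e1] at hd1
      exact mem_of_isUnit_mul_mem (u := 3) (by rw [map_ofNat]; exact three_ne_zero) hd1
  -- modulo the ideal, a function vanishing at the origin is a multiple of `y`
  have red : ∀ w : OX, cc w = 0 →
      w - C (cc (pd 1 w) + cc r * cc (pd 2 w)) * xv 1 ∈ entriesIdeal φ := by
    intro w hw
    obtain ⟨a, b, c, rfl⟩ := exists_decomp hw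
    have e1 : cc (pd 1 (xv 0 * a + xv 1 * b + xv 2 * c)) = cc b := by simp
    have e2 : cc (pd 2 (xv 0 * a + xv 1 * b + xv 2 * c)) = cc c := by simp
    rw [e1, e2, ← map_mul, ← map_add]
    obtain ⟨a', b', c', e3⟩ := exists_decomp (mem_maxId.1 (sub_cc_mem (b + r * c)))
    have : xv 0 * a + xv 1 * b + xv 2 * c - C (cc (b + r * c)) * xv 1 =
        xv 0 * (a + xv 1 * a') + (c + xv 1 * c') * (xv 2 - xv 1 * r)
          + (b' + c' * r) * xv 1 ^ 2 := by
      linear_combination xv 1 * e3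
    rw [this]
    exact add_mem (add_mem (Ideal.mul_mem_right _ _ hx) (Ideal.mul_mem_left _ _ hr))
      (Ideal.mul_mem_left _ _ hy)
  obtain ⟨hg, hh⟩ := H.cc_eq_zero hT hφ
  -- Either φ kills that direction, and then so do g and h, or y ∈ I(φ) and I(φ) contains the
  -- maximal ideal.
  by_cases hall : ∀ i j, 1 * cc (pd 1 (φ i j)) + cc r * cc (pd 2 (φ i j)) = 0
  · obtain ⟨h1, h2⟩ := H.tangent_eq_zero hT hφ 1 (cc r) hall
    rw [one_mul] at h1 h2
    have r1 := red g hg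
    have r2 := red h hh
    rw [h1] at r1
    rw [h2] at r2
    exact ⟨by simpa using r1, by simpa using r2⟩
  · push Not at hall
    obtain ⟨i, j, hij⟩ := hall
    rw [one_mul] at hij
    have hy1 : xv 1 ∈ entriesIdeal φ := by
      refine mem_of_C_mul_mem hij ?_
      simpa using sub_mem (entry_mem φ i j) (red _ (hφ i j))
    exact ⟨(Submodule.sub_mem_iff_left _ (Ideal.mul_mem_left _ _ hy1)).1 (red g hg),
      (Submodule.sub_mem_iff_left _ (Ideal.mul_mem_left _ _ hy1)).1 (red h hh)⟩

end

end DuVal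

/-! ### Functions adapted to a branch x = s = 0, and the arcs they cannot carry. -/

namespace DuVal

open MvPowerSeries

/-- The functions `e₀ x² + e₁ x s + e₂ s² + (e₃ x + e₄ s) z^j + e₅ z^(2j+1)`. -/
noncomputable def branchForm (j : ℕ) (s : OX) (e : Fin 6 → OX) : OX :=
  e 0 * xv 0 ^ 2 + e 1 * xv 0 * s + e 2 * s ^ 2 + e 3 * xv 0 * xv 2 ^ j + e 4 * s * xv 2 ^ j
    + e 5 * xv 2 ^ (2 * j + 1)

/-- Coordinates `x, s, z` with `s = y - z² Q(z)`. -/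
structure IsBranchCoord (s Q : OX) : Prop where
  eq : s = xv 1 - xv 2 ^ 2 * Q
  pd_zero : pd 0 Q = 0
  pd_one : pd 1 Q = 0

/-- The derivation along `z` in the coordinates `x, s, z`. -/
noncomputable def dz (Q : OX) : Derivation ℂ OX OX := pd 2 + pd 2 (xv 2 ^ 2 * Q) • pd 1

section

variable {s Q : OX} {j : ℕ} {e : Fin 6 → OX}

theorem dz_apply (w : OX) : dz Q w = pd 2 w + pd 2 (xv 2 ^ 2 * Q) * pd 1 w := by
  simp [dz]

theorem IsBranchCoord.pd_zero_s (hs : IsBranchCoord s Q) : pd 0 s = 0 := by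
  rw [hs.eq]; simp [hs.pd_zero]

theorem IsBranchCoord.pd_one_s (hs : IsBranchCoord s Q) : pd 1 s = 1 := by
  rw [hs.eq]; simp [hs.pd_one]

theorem IsBranchCoord.dz_s (hs : IsBranchCoord s Q) : dz Q s = 0 := by
  rw [dz_apply, hs.pd_one_s, mul_one, hs.eq, map_sub, pd_xv]
  simp

theorem dz_x : dz Q (xv 0) = 0 := by rw [dz_apply]; simp

theorem dz_z : dz Q (xv 2) = 1 := by
  rw [dz_apply, pd_xv, pd_xv]; simp

theorem IsBranchCoord.cc_s (hs : IsBranchCoord s Q) : cc s = 0 := by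
  rw [hs.eq]; simp

theorem cc_dz (w : OX) : cc (dz Q w) = cc (pd 2 w) := by
  rw [dz_apply, map_add, map_mul, pow_two, mul_assoc, pd_mul]
  simp

theorem IsBranchCoord.pd_zero_branchForm (hs : IsBranchCoord s Q) :
    pd 0 (branchForm j s e) = 2 * e 0 * xv 0 + pd 0 (e 0) * xv 0 ^ 2 + e 1 * s
      + pd 0 (e 1) * xv 0 * s + pd 0 (e 2) * s ^ 2 + e 3 * xv 2 ^ j + pd 0 (e 3) * xv 0 * xv 2 ^ j
      + pd 0 (e 4) * s * xv 2 ^ j + pd 0 (e 5) * xv 2 ^ (2 * j + 1) := by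
  simp only [branchForm, map_add, derivation_mul, Derivation.leibniz_pow, pd_xv, hs.pd_zero_s]
  simp
  ring

theorem IsBranchCoord.pd_one_branchForm (hs : IsBranchCoord s Q) :
    pd 1 (branchForm j s e) = pd 1 (e 0) * xv 0 ^ 2 + e 1 * xv 0 + pd 1 (e 1) * xv 0 * s
      + 2 * e 2 * s + pd 1 (e 2) * s ^ 2 + pd 1 (e 3) * xv 0 * xv 2 ^ j + e 4 * xv 2 ^ j
      + pd 1 (e 4) * s * xv 2 ^ j + pd 1 (e 5) * xv 2 ^ (2 * j + 1) := by
  simp only [branchForm, map_add, derivation_mul, Derivation.leibniz_pow, pd_xv, hs.pd_one_s]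
  simp
  ring

theorem IsBranchCoord.dz_branchForm (hs : IsBranchCoord s Q) (hj : 1 ≤ j) :
    dz Q (branchForm j s e) = dz Q (e 0) * xv 0 ^ 2 + dz Q (e 1) * xv 0 * s + dz Q (e 2) * s ^ 2
      + (dz Q (e 3) * xv 2 + j * e 3) * xv 0 * xv 2 ^ (j - 1)
      + (dz Q (e 4) * xv 2 + j * e 4) * s * xv 2 ^ (j - 1)
      + (dz Q (e 5) * xv 2 + (2 * j + 1) * e 5) * xv 2 ^ (2 * j) := by
  obtain ⟨i, rfl⟩ : ∃ i, j = i + 1 := ⟨j - 1, by omega⟩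
  simp only [branchForm, map_add, derivation_mul, Derivation.leibniz_pow, dz_x, dz_z, hs.dz_s]
  simp
  ring

variable {θ : OX →ₐ[ℂ] PowerSeries ℂ}

theorem X_dvd_of_cc (θ : OX →ₐ[ℂ] PowerSeries ℂ) {w : OX} (hw : cc w = 0) : PowerSeries.X ∣ θ w :=
  X_dvd_arc θ (mem_maxId.2 hw)

theorem IsBranchCoord.coeff_one_s (hs : IsBranchCoord s Q) (θ : OX →ₐ[ℂ] PowerSeries ℂ) :
    PowerSeries.coeff 1 (θ s) = PowerSeries.coeff 1 (θ (xv 1)) := by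
  rw [coeff_one_arc θ (mem_maxId.2 hs.cc_s), Fin.sum_univ_three, hs.pd_zero_s, hs.pd_one_s,
    ← cc_dz (Q := Q), hs.dz_s]
  simp

/-- First-order behaviour along an arc tangent to the plane `x = 0`. -/
theorem IsBranchCoord.coeff_one_of_tangent (hs : IsBranchCoord s Q)
    (hX : PowerSeries.coeff 1 (θ (xv 0)) = 0) {w : OX} (hw : cc w = 0) :
    PowerSeries.coeff 1 (θ w) = cc (pd 1 w) * PowerSeries.coeff 1 (θ s)
      + cc (dz Q w) * PowerSeries.coeff 1 (θ (xv 2)) := by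
  rw [coeff_one_arc θ (mem_maxId.2 hw), Fin.sum_univ_three, hX, hs.coeff_one_s, cc_dz]
  ring

theorem X_sq_dvd_iff {p : PowerSeries ℂ} :
    PowerSeries.X ^ 2 ∣ p ↔ PowerSeries.constantCoeff p = 0 ∧ PowerSeries.coeff 1 p = 0 := by
  rw [PowerSeries.X_pow_dvd_iff]
  constructor
  · intro h
    exact ⟨by simpa using h 0 (by norm_num), h 1 (by norm_num)⟩
  · rintro ⟨h0, h1⟩ m hm
    interval_cases m
    · simpa using h0
    · exact h1

theorem IsBranchCoord.x_sq_dvd (hs : IsBranchCoord s Q) (hj : 2 ≤ j) (h1 : cc (e 1) = 0)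
    (h0 : cc (e 0) ≠ 0) (hE0 : PowerSeries.X ^ 2 ∣ θ (pd 0 (branchForm j s e))) :
    PowerSeries.X ^ 2 ∣ θ (xv 0) := by
  rw [hs.pd_zero_branchForm] at hE0
  simp only [map_add, map_mul, map_pow, map_ofNat] at hE0
  exact branch_x_two hj (X_dvd_of_cc θ (by simp)) (X_dvd_of_cc θ hs.cc_s) (X_dvd_of_cc θ (by simp))
    (X_dvd_of_cc θ h1) hE0 (by rwa [constantCoeff_arc])

/-- Once the tangent of the arc satisfies x = s = 0, smoothness makes the arc transversal to z = 0,
and `branch_contradiction` applies. -/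
theorem IsBranchCoord.contradiction (hs : IsBranchCoord s Q) (hj : 2 ≤ j) (hθ : IsSmoothArc θ)
    (h1 : cc (e 1) = 0) (h2 : cc (e 2) = 0) (h0 : cc (e 0) ≠ 0) (h3 : cc (e 3) ≠ 0)
    (hdz : j ≠ 2 → cc (dz Q (e 2)) ≠ 0)
    (hF : PowerSeries.X ^ (2 * j + 1) ∣ θ (branchForm j s e))
    (hE0 : PowerSeries.X ^ (j + 1) ∣ θ (pd 0 (branchForm j s e)))
    (hE1 : PowerSeries.X ^ (j + 1) ∣ θ (pd 1 (branchForm j s e)))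
    (hS : PowerSeries.coeff 1 (θ s) = 0) : False := by
  have hX2 := hs.x_sq_dvd hj h1 h0 ((pow_dvd_pow _ (by omega)).trans hE0)
  have hX1 := (X_sq_dvd_iff.1 hX2).2
  have hZ1 : PowerSeries.coeff 1 (θ (xv 2)) ≠ 0 := by
    obtain ⟨i, hi⟩ := hθ
    have := hs.coeff_one_s θ
    rw [hS] at this
    fin_cases i
    · exact absurd hX1 hi
    · exact absurd this.symm hi
    · exact hi
  have hS2 : PowerSeries.X ^ 2 ∣ θ s :=
    X_sq_dvd_iff.2 ⟨by rw [constantCoeff_arc, hs.cc_s], hS⟩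
  rw [hs.pd_zero_branchForm] at hE0
  rw [hs.pd_one_branchForm] at hE1
  rw [branchForm] at hF
  simp only [map_add, map_mul, map_pow, map_ofNat] at hE0 hE1 hF
  refine branch_contradiction hj (X_dvd_of_cc θ (by simp)) hS2 (X_dvd_of_cc θ (by simp))
    (X_dvd_of_cc θ h1) (X_dvd_of_cc θ h2) (fun hj2 => ?_) hF hE0 hE1 (by rwa [constantCoeff_arc])
    (by rwa [constantCoeff_arc]) hZ1
  rw [hs.coeff_one_of_tangent hX1 h2, hS, mul_zero, zero_add]
  exact mul_ne_zero (hdz hj2) hZ1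

/-- No branch of type `D` on a function in normal form. -/
theorem IsBranchCoord.false_of_D (hs : IsBranchCoord s Q) (hj : 2 ≤ j) (hθ : IsSmoothArc θ)
    (h1 : cc (e 1) = 0) (h2 : cc (e 2) = 0) (h0 : cc (e 0) ≠ 0) (h3 : cc (e 3) ≠ 0)
    (hdz : cc (dz Q (e 2)) ≠ 0)
    (hdisc : cc (dz Q (e 2)) ^ 2 - 4 * cc (pd 1 (e 2)) * cc (e 4) ≠ 0)
    (hF : PowerSeries.X ^ (2 * j + 1) ∣ θ (branchForm j s e))
    (hE : ∀ d : Derivation ℂ OX OX, PowerSeries.X ^ (2 * j) ∣ θ (d (branchForm j s e))) :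
    False := by
  have hE' : ∀ d : Derivation ℂ OX OX, PowerSeries.X ^ (j + 1) ∣ θ (d (branchForm j s e)) :=
    fun d => (pow_dvd_pow _ (by omega)).trans (hE d)
  refine hs.contradiction hj hθ h1 h2 h0 h3 (fun _ => hdz) hF (hE' _) (hE' _) ?_
  have hX2 := hs.x_sq_dvd hj h1 h0 ((pow_dvd_pow _ (by omega)).trans (hE _))
  have hX1 := (X_sq_dvd_iff.1 hX2).2
  have hE1 := (pow_dvd_pow _ (by omega : 3 ≤ 2 * j)).trans (hE (pd 1))
  have hE2 := (pow_dvd_pow _ (by omega : 3 ≤ 2 * j)).trans (hE (dz Q))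
  rw [hs.pd_one_branchForm] at hE1
  rw [hs.dz_branchForm (by omega)] at hE2
  simp only [map_add, map_mul, map_pow, map_ofNat, map_natCast] at hE1 hE2
  refine branch_s_tangent hj hX2 (X_dvd_of_cc θ hs.cc_s) (X_dvd_of_cc θ (by simp))
    (X_dvd_of_cc θ h1) (X_dvd_of_cc θ h2) hE1 hE2 ?_ (by rwa [constantCoeff_arc])
    (fun _ => by simpa only [constantCoeff_arc] using hdisc)
  rw [hs.coeff_one_of_tangent hX1 h2, constantCoeff_arc, constantCoeff_arc]

theorem cc_xv (i : Fin 3) : cc (xv i) = 0 := mem_maxId.1 (xv_mem i)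

/-- No branch of type `E₇` on a function in normal form. -/
theorem IsBranchCoord.false_of_E7 (hs : IsBranchCoord s Q) (hθ : IsSmoothArc θ)
    (h1 : cc (e 1) = 0) (h2 : cc (e 2) = 0) (h0 : cc (e 0) ≠ 0) (h3 : cc (e 3) ≠ 0)
    (hpd : cc (pd 1 (e 2)) ≠ 0)
    (hF : θ (branchForm 2 s e) = 0)
    (hE : ∀ d : Derivation ℂ OX OX, PowerSeries.X ^ 3 ∣ θ (d (branchForm 2 s e)))
    (hH : ∀ d₁ d₂ d₃ d₄ : Derivation ℂ OX OX, PowerSeries.X ^ 2 ∣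
        θ (d₁ (d₃ (branchForm 2 s e))) * θ (d₂ (d₄ (branchForm 2 s e)))
          - θ (d₁ (d₄ (branchForm 2 s e))) * θ (d₂ (d₃ (branchForm 2 s e)))) :
    False := by
  refine hs.contradiction le_rfl hθ h1 h2 h0 h3 (fun h => absurd rfl h) (by rw [hF]; exact dvd_zero _)
    (hE _) (hE _) ?_
  have hX2 := hs.x_sq_dvd le_rfl h1 h0 ((pow_dvd_pow _ (by omega)).trans (hE _))
  have hX1 := (X_sq_dvd_iff.1 hX2).2
  -- The second x-derivative is a unit and the mixed ones vanish at the origin, so the vanishing of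
  -- the Hessian minors to order two passes to the remaining second derivatives.
  have hcoef : ∀ a b : Derivation ℂ OX OX, cc (pd 0 (b (branchForm 2 s e))) = 0 →
      cc (a (pd 0 (branchForm 2 s e))) = 0 → PowerSeries.coeff 1 (θ (a (b (branchForm 2 s e)))) = 0 := by
    intro a b hb ha
    have hu : IsUnit (θ (pd 0 (pd 0 (branchForm 2 s e)))) := by
      apply isUnit_of_constantCoeff
      rw [constantCoeff_arc]
      simp only [branchForm, map_add, derivation_mul, pow_succ, pow_zero, one_mul, pd_xv,
        hs.pd_zero_s]
      simpa [hs.cc_s] using h0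
    have := hH (pd 0) a (pd 0) b
    have h' : PowerSeries.X ^ 2 ∣ θ (pd 0 (b (branchForm 2 s e))) * θ (a (pd 0 (branchForm 2 s e))) := by
      rw [pow_two]
      exact mul_dvd_mul (X_dvd_of_cc θ hb) (X_dvd_of_cc θ ha)
    have h'' := (hu.dvd_mul_left).1 ((dvd_sub_left h').1 this)
    exact (X_sq_dvd_iff.1 h'').2
  have d00 : cc (pd 0 (pd 1 (branchForm 2 s e))) = 0 := by
    simp only [branchForm, map_add, derivation_mul, pow_succ, pow_zero, one_mul, pd_xv,
      hs.pd_zero_s, hs.pd_one_s]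
    simp [hs.cc_s, h1]
  have d01 : cc (pd 1 (pd 0 (branchForm 2 s e))) = 0 := by rwa [pd_comm]
  have d02 : cc (pd 0 (dz Q (branchForm 2 s e))) = 0 := by
    simp only [branchForm, map_add, derivation_mul, pow_succ, pow_zero, one_mul, pd_xv,
      hs.pd_zero_s, hs.dz_s, dz_x, dz_z]
    simp [hs.cc_s]
  have d20 : cc (dz Q (pd 0 (branchForm 2 s e))) = 0 := by
    simp only [branchForm, map_add, derivation_mul, pow_succ, pow_zero, one_mul, pd_xv,
      hs.pd_zero_s, hs.dz_s, dz_x, dz_z]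
    simp [hs.cc_s]
  have k1 := hcoef (pd 1) (pd 1) d00 d01
  have k2 := hcoef (pd 1) (dz Q) d02 d01
  have k3 := hcoef (dz Q) (dz Q) d02 d20
  rw [hs.coeff_one_of_tangent hX1] at k1 k2 k3
  · simp only [branchForm, map_add, derivation_mul, pow_succ, pow_zero, one_mul, pd_xv,
      hs.pd_one_s, hs.dz_s, dz_x, dz_z] at k1 k2 k3
    simp [hs.cc_s] at k1 k2 k3
    -- The tangent lies in the kernel of the Hessian of the cubic c s³ + r s²z + u sz² formed with
    -- the values at the origin of ∂e₂/∂s, ∂e₂/∂z and e₄. If s ≠ 0 on it, then u = r = c = 0.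
    by_contra hS
    have h4 := k3.resolve_right hS
    rw [h4] at k2
    have hz : cc (dz Q (e 2)) = 0 := by
      refine (mul_eq_zero.1 ?_).resolve_right hS
      linear_combination k2 / 2
    rw [hz] at k1
    exact mul_ne_zero hpd hS (by linear_combination k1 / 6)
  all_goals
    simp only [branchForm, map_add, derivation_mul, pow_succ, pow_zero, one_mul, pd_xv,
      hs.pd_one_s, hs.dz_s, dz_x, dz_z]
    simp [hs.cc_s, h2]

theorem cc_two : cc 2 = 2 := map_ofNat cc 2

theorem derivation_two (d : Derivation ℂ OX OX) : d 2 = 0 := by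
  rw [← one_add_one_eq_two, map_add, Derivation.map_one_eq_zero, add_zero]

theorem IsBranchCoord.cc_pd_zero_zero (hs : IsBranchCoord s Q) (hj : 2 ≤ j) :
    cc (pd 0 (pd 0 (branchForm j s e))) = 2 * cc (e 0) := by
  have hj0 : j ≠ 0 := by omega
  rw [hs.pd_zero_branchForm]
  simp only [map_add, derivation_mul, Derivation.leibniz_pow, pd_xv, hs.pd_zero_s]
  simp [hs.cc_s, hj0, cc_two, derivation_two]

theorem IsBranchCoord.cc_pd_zero_one (hs : IsBranchCoord s Q) (hj : 2 ≤ j) :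
    cc (pd 0 (pd 1 (branchForm j s e))) = cc (e 1) := by
  have hj0 : j ≠ 0 := by omega
  rw [hs.pd_one_branchForm]
  simp only [map_add, derivation_mul, Derivation.leibniz_pow, pd_xv, hs.pd_zero_s]
  simp [hs.cc_s, hj0, cc_two, derivation_two]

theorem IsBranchCoord.cc_pd_one_one (hs : IsBranchCoord s Q) (hj : 2 ≤ j) :
    cc (pd 1 (pd 1 (branchForm j s e))) = 2 * cc (e 2) := by
  have hj0 : j ≠ 0 := by omega
  rw [hs.pd_one_branchForm]
  simp only [map_add, derivation_mul, Derivation.leibniz_pow, pd_xv, hs.pd_one_s]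
  simp [hs.cc_s, hj0, cc_two]

theorem IsBranchCoord.cc_pd_one_one_one (hs : IsBranchCoord s Q) (hj : 2 ≤ j) :
    cc (pd 1 (pd 1 (pd 1 (branchForm j s e)))) = 6 * cc (pd 1 (e 2)) := by
  have hj0 : j ≠ 0 := by omega
  rw [hs.pd_one_branchForm]
  simp only [map_add, derivation_mul, Derivation.leibniz_pow, pd_xv, hs.pd_one_s]
  simp [hs.cc_s, hj0, cc_two, derivation_two, hs.pd_one_s]
  ring

theorem IsBranchCoord.cc_dz_pd_one_one (hs : IsBranchCoord s Q) (hj : 2 ≤ j) :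
    cc (dz Q (pd 1 (pd 1 (branchForm j s e)))) = 2 * cc (dz Q (e 2)) := by
  have hj0 : j ≠ 0 := by omega
  have hj1 : j - 1 ≠ 0 := by omega
  rw [hs.pd_one_branchForm]
  simp only [map_add, derivation_mul, Derivation.leibniz_pow, pd_xv, hs.pd_one_s, hs.dz_s, dz_x,
    dz_z]
  simp [hs.cc_s, hj0, hj1, cc_two, derivation_two, hs.dz_s]

end

end DuVal

/-! ### Minors in branch form, and the contact of φ with the branch. -/

namespace DuVal

open MvPowerSeries

section

variable {s Q : OX} {j : ℕ}

/-- Product of `x a + s b + z^(j+1) c` and `x a' + s b' + z^j c'`. -/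
noncomputable def prodCoeffs (u v : Fin 3 → OX) : Fin 6 → OX :=
  ![u 0 * v 0, u 0 * v 1 + u 1 * v 0, u 1 * v 1, u 0 * v 2 + xv 2 * u 2 * v 0,
    u 1 * v 2 + xv 2 * u 2 * v 1, u 2 * v 2]

theorem branchForm_prodCoeffs (u v : Fin 3 → OX) :
    branchForm j s (prodCoeffs u v) = (xv 0 * u 0 + s * u 1 + xv 2 ^ (j + 1) * u 2) *
      (xv 0 * v 0 + s * v 1 + xv 2 ^ j * v 2) := by
  simp [branchForm, prodCoeffs]
  ring

theorem branchForm_add (e e' : Fin 6 → OX) :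
    branchForm j s (e + e') = branchForm j s e + branchForm j s e' := by
  simp only [branchForm, Pi.add_apply]; ring

theorem branchForm_sub (e e' : Fin 6 → OX) :
    branchForm j s (e - e') = branchForm j s e - branchForm j s e' := by
  simp only [branchForm, Pi.sub_apply]; ring

theorem branchForm_smul (r : ℂ) (e : Fin 6 → OX) :
    branchForm j s (r • e) = r • branchForm j s e := by
  simp only [branchForm, Pi.smul_apply, smul_mul_assoc, smul_add]

/-- The linear form with given coefficients. -/
noncomputable def linForm (a : Fin 3 → ℂ) : MvPolynomial (Fin 3) ℂ :=
  ∑ i, MvPolynomial.C (a i) * MvPolynomial.X i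

theorem eval_linForm (a c : Fin 3 → ℂ) :
    MvPolynomial.eval c (linForm a) = c 0 * a 0 + c 1 * a 1 + c 2 * a 2 := by
  rw [linForm, Fin.sum_univ_three]
  simp only [map_add, map_mul, MvPolynomial.eval_C, MvPolynomial.eval_X]
  ring

theorem linForm_ne_zero {a : Fin 3 → ℂ} (i : Fin 3) (ha : a i ≠ 0) : linForm a ≠ 0 := by
  intro h
  have := eval_linForm a (Pi.single i 1)
  rw [h, map_zero] at this
  fin_cases i <;> simp at this ha <;> exact ha this.symm

theorem cc_aeval_z (p : Polynomial ℂ) : cc (Polynomial.aeval (xv 2) p) = p.coeff 0 := by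
  have : cc (Polynomial.aeval (xv 2) p) = ccAlg (Polynomial.aeval (xv 2) p) := rfl
  rw [this, ← Polynomial.aeval_algHom_apply, show (ccAlg : OX →ₐ[ℂ] ℂ) (xv 2) = 0 from cc_xv 2,
    Polynomial.coeff_zero_eq_aeval_zero]

/-- By minimality of k, a polynomial in z lying in K has order at least k: otherwise it would be a
unit times a lower power of z. Together with `mem_of_dvd_arc`, membership in K is the order
condition on the branch. -/
theorem dvd_arc_of_mem {K : Ideal OX} {r : OX} (hs : xv 1 = s + xv 2 * r) {k : ℕ}
    (hx : xv 0 ∈ K) (hsK : s ∈ K) (hz : xv 2 ^ k ∈ K) (hmin : ∀ m < k, xv 2 ^ m ∉ K)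
    (Θ : OX →ₐ[ℂ] PowerSeries ℂ)
    (h0 : Θ (xv 0) = 0) (h1 : Θ s = 0) (h2 : Θ (xv 2) = PowerSeries.X) {w : OX} (hw : w ∈ K) :
    PowerSeries.X ^ k ∣ Θ w := by
  obtain ⟨q, a, b, c, rfl⟩ := exists_polynomial_decomp hs w k
  have hq : Polynomial.aeval (xv 2) q ∈ K := by
    have h3 := (Submodule.add_mem_iff_left K (Ideal.mul_mem_right c K hz)).1 hw
    have h4 := (Submodule.add_mem_iff_left K (Ideal.mul_mem_right b K hsK)).1 h3
    exact (Submodule.add_mem_iff_left K (Ideal.mul_mem_right a K hx)).1 h4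
  have key : ∀ m ≤ k, Polynomial.X ^ m ∣ q := by
    intro m
    induction m with
    | zero => simp
    | succ m ih =>
      intro hm
      obtain ⟨q', rfl⟩ := ih (by omega)
      rw [pow_succ]
      refine mul_dvd_mul_left _ (Polynomial.X_dvd_iff.2 ?_)
      by_contra hc
      rw [map_mul, map_pow, Polynomial.aeval_X, mul_comm] at hq
      exact hmin m (by omega) (mem_of_isUnit_mul_mem (by rwa [cc_aeval_z]) hq)
  obtain ⟨q', rfl⟩ := key k le_rfl
  simp only [map_add, map_mul, map_pow, h0, h1, h2, zero_mul, add_zero, Polynomial.aeval_X]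
  exact dvd_add (dvd_mul_right _ _) (dvd_mul_right _ _)

end

section

variable {T : DuValType} {φ : Matrix (Fin 2) (Fin 2) OX} {g h : OX}

/-- Modulo y - z²r the partial derivatives of the normal form yield a power of z. The exponent
itself matters only for E₇, where it forces j = 2. -/
theorem IsGeneralNormal.z_pow_mem (H : IsGeneralNormal T φ g h) (hT : IsDE T) {r : OX}
    (hr : xv 1 - xv 2 ^ 2 * r ∈ entriesIdeal φ) :
    ∃ k, xv 2 ^ k ∈ entriesIdeal φ ∧ (T = .E7 → k = 3) := by
  have hpd : ∀ d : Fin 3, pd d T.equation ∈ entriesIdeal φ := fun d => by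
    rw [← H.det_eq]; exact derivation_det_mem _ _
  have hd1 := hpd 1
  have hd2 := hpd 2
  cases T with
  | A n hn => exact hT.elim
  | D n hn =>
    obtain ⟨m, rfl⟩ : ∃ m, n = m + 4 := ⟨n - 4, by omega⟩
    refine ⟨m + 2, ?_, by simp⟩
    have e1 : pd 1 (DuValType.D (m + 4) hn).equation = 2 * (xv 1 * xv 2) := by
      simp [DuValType.equation]; ring
    have e2 : pd 2 (DuValType.D (m + 4) hn).equation = xv 1 ^ 2 + (m + 3) * xv 2 ^ (m + 2) := by
      simp [DuValType.equation]
    rw [e1] at hd1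
    rw [e2] at hd2
    have hyz : xv 1 * xv 2 ∈ entriesIdeal φ := mem_of_isUnit_mul_mem (by simp [cc_two]) hd1
    refine mem_of_C_mul_mem (r := m + 3) (by exact_mod_cast (by omega : m + 3 ≠ 0)) ?_
    have : C ((m : ℂ) + 3) * xv 2 ^ (m + 2) = (xv 1 ^ 2 + ((m : OX) + 3) * xv 2 ^ (m + 2))
        - xv 1 * (xv 1 - xv 2 ^ 2 * r) - xv 2 * r * (xv 1 * xv 2) := by
      rw [map_add, map_natCast, map_ofNat]; ring
    rw [this]
    exact sub_mem (sub_mem hd2 (Ideal.mul_mem_left _ _ hr)) (Ideal.mul_mem_left _ _ hyz)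
  | E6 =>
    refine ⟨3, ?_, by simp⟩
    have e2 : pd 2 DuValType.E6.equation = 4 * xv 2 ^ 3 := by simp [DuValType.equation]
    rw [e2] at hd2
    exact mem_of_isUnit_mul_mem (u := 4) (by rw [map_ofNat]; norm_num) hd2
  | E7 =>
    refine ⟨3, ?_, by simp⟩
    have e1 : pd 1 DuValType.E7.equation = 3 * xv 1 ^ 2 + xv 2 ^ 3 := by
      simp [DuValType.equation]
    rw [e1] at hd1
    refine mem_of_isUnit_mul_mem (u := 1 + 3 * xv 2 * r ^ 2) (by simp) ?_
    have : (1 + 3 * xv 2 * r ^ 2) * xv 2 ^ 3 = (3 * xv 1 ^ 2 + xv 2 ^ 3)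
        - 3 * (xv 1 + xv 2 ^ 2 * r) * (xv 1 - xv 2 ^ 2 * r) := by ring
    rw [this]
    exact sub_mem hd1 (Ideal.mul_mem_left _ _ hr)
  | E8 =>
    refine ⟨4, ?_, by simp⟩
    have e2 : pd 2 DuValType.E8.equation = 5 * xv 2 ^ 4 := by simp [DuValType.equation]
    rw [e2] at hd2
    exact mem_of_isUnit_mul_mem (u := 5) (by rw [map_ofNat]; norm_num) hd2

/-- The order of contact of `φ` with the branch bounds the type. -/
theorem IsGeneralNormal.type_of_order (H : IsGeneralNormal T φ g h) (hT : IsDE T) {k : ℕ}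
    (hk : 3 ≤ k) (Θ : OX →ₐ[ℂ] PowerSeries ℂ) (h0 : Θ (xv 0) = 0)
    (h1 : PowerSeries.X ^ 2 ∣ Θ (xv 1)) (h2 : Θ (xv 2) = PowerSeries.X)
    (hK : ∀ w ∈ entriesIdeal φ, PowerSeries.X ^ k ∣ Θ w) :
    T = .E7 ∨ ∃ n hn, T = .D n hn ∧ 2 * k ≤ n := by
  -- On the branch y³ has order at least six, so the order 4 of z⁴ in E₆ and 5 of z⁵ in E₈
  -- contradict order 2k ≥ 6 of the determinant.
  have hdet : PowerSeries.X ^ (2 * k) ∣ Θ T.equation := by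
    rw [← H.det_eq, Matrix.det_fin_two, map_sub, map_mul, map_mul, two_mul, pow_add]
    exact dvd_sub (mul_dvd_mul (hK _ (entry_mem _ _ _)) (hK _ (entry_mem _ _ _)))
      (mul_dvd_mul (hK _ (entry_mem _ _ _)) (hK _ (entry_mem _ _ _)))
  have hP3 : PowerSeries.X ^ 6 ∣ Θ (xv 1) ^ 3 := by
    have := pow_dvd_pow_of_dvd h1 3
    rwa [← pow_mul] at this
  cases T with
  | A n hn => exact hT.elim
  | D n hn =>
    refine Or.inr ⟨n, hn, rfl, ?_⟩
    -- This gives y order at least k - 1 on the branch, hence y²z order at least 2k - 1, and z^(n-1)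
    -- must match it.
    have hyz : xv 1 * xv 2 ∈ entriesIdeal φ := by
      have hd1 := derivation_det_mem (pd 1) φ
      have e1 : pd 1 (DuValType.D n hn).equation = 2 * (xv 1 * xv 2) := by
        simp [DuValType.equation]; ring
      rw [H.det_eq, e1] at hd1
      exact mem_of_isUnit_mul_mem (by simp [cc_two]) hd1
    have h3 := hK _ hyz
    rw [map_mul, h2] at h3
    obtain ⟨m, rfl⟩ : ∃ m, k = m + 1 := ⟨k - 1, by omega⟩
    rw [pow_succ, mul_dvd_mul_iff_right PowerSeries.X_ne_zero] at h3
    have h4 : PowerSeries.X ^ (2 * m + 1) ∣ Θ (xv 1) ^ 2 * PowerSeries.X := by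
      have := mul_dvd_mul (pow_dvd_pow_of_dvd h3 2) (dvd_refl PowerSeries.X)
      rwa [← pow_mul, ← pow_succ, mul_comm m] at this
    have h5 : (PowerSeries.X : PowerSeries ℂ) ^ (2 * m + 1) ∣ PowerSeries.X ^ (n - 1) := by
      have := (pow_dvd_pow _ (by omega : 2 * m + 1 ≤ 2 * (m + 1))).trans hdet
      rw [DuValType.equation] at this
      simp only [map_add, map_mul, map_pow, h0, h2] at this
      rw [zero_pow two_ne_zero, zero_add] at this
      exact (dvd_add_right h4).1 this
    have := (pow_dvd_pow_iff PowerSeries.X_ne_zero PowerSeries.X_prime.not_isUnit).1 h5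
    omega
  | E6 =>
    exfalso
    have h5 : (PowerSeries.X : PowerSeries ℂ) ^ 6 ∣ PowerSeries.X ^ 4 := by
      have := (pow_dvd_pow _ (by omega : 6 ≤ 2 * k)).trans hdet
      rw [DuValType.equation] at this
      simp only [map_add, map_pow, h0, h2] at this
      rw [zero_pow two_ne_zero, zero_add] at this
      exact (dvd_add_right hP3).1 this
    have := (pow_dvd_pow_iff PowerSeries.X_ne_zero PowerSeries.X_prime.not_isUnit).1 h5
    omega
  | E7 => exact Or.inl rfl
  | E8 =>
    exfalso
    have h5 : (PowerSeries.X : PowerSeries ℂ) ^ 6 ∣ PowerSeries.X ^ 5 := by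
      have := (pow_dvd_pow _ (by omega : 6 ≤ 2 * k)).trans hdet
      rw [DuValType.equation] at this
      simp only [map_add, map_pow, h0, h2] at this
      rw [zero_pow two_ne_zero, zero_add] at this
      exact (dvd_add_right hP3).1 this
    have := (pow_dvd_pow_iff PowerSeries.X_ne_zero PowerSeries.X_prime.not_isUnit).1 h5
    omega

end

end DuVal

/-! ### Types D and E: the tangential case and the conclusion for normal forms. -/

namespace DuVal

open MvPowerSeries

section

variable {T : DuValType} {φ : Matrix (Fin 2) (Fin 2) OX} {g h : OX} {s Q : OX} {j : ℕ}

/-- The coefficients of the general linear combination of the minors. -/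
noncomputable def combCoeffs (E : Fin 3 → Fin 6 → OX) (c : Fin 3 → ℂ) : Fin 6 → OX :=
  c 0 • E 0 + c 1 • E 1 + c 2 • E 2

theorem cc_combCoeffs (E : Fin 3 → Fin 6 → OX) (c : Fin 3 → ℂ) (m : Fin 6) :
    cc (combCoeffs E c m) = MvPolynomial.eval c (linForm fun i => cc (E i m)) := by
  rw [eval_linForm]
  simp only [combCoeffs, Pi.add_apply, Pi.smul_apply, map_add, cc_smul]

theorem cc_derivation_combCoeffs (d : Derivation ℂ OX OX) (E : Fin 3 → Fin 6 → OX) (c : Fin 3 → ℂ)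
    (m : Fin 6) :
    cc (d (combCoeffs E c m)) = MvPolynomial.eval c (linForm fun i => cc (d (E i m))) := by
  rw [eval_linForm]
  simp only [combCoeffs, Pi.add_apply, Pi.smul_apply, map_add, cc_smul, Derivation.map_smul]

theorem IsBranchCoord.cc_coeff_eq_zero (hs : IsBranchCoord s Q) (hj : 2 ≤ j) {e : Fin 6 → OX}
    {M : OX} (hM : M = branchForm j s e)
    (hH : ∀ a, cc (pd a (pd 1 M)) = 0) : cc (e 1) = 0 ∧ cc (e 2) = 0 := by
  subst hM
  have h1 := hH 0
  have h2 := hH 1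
  rw [hs.cc_pd_zero_one hj] at h1
  rw [hs.cc_pd_one_one hj] at h2
  exact ⟨h1, (mul_eq_zero.1 h2).resolve_left two_ne_zero⟩

/-- A pencil of minors of lower order than `φ` along the branch `x = s = 0` has members which are
not of the type of the determinant. -/
theorem IsGeneralNormal.false_of_branch (H : IsGeneralNormal T φ g h) (hT : IsDE T)
    (hs : IsBranchCoord s Q) (hj : 2 ≤ j)
    (hTj : (T = .E7 ∧ j = 2) ∨ ∃ n hn, T = .D n hn ∧ 2 * j + 2 ≤ n)
    (a : Fin 2 → Fin 2 → Fin 3 → OX) (v : Fin 2 → Fin 3 → OX)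
    (hφ : ∀ i i', φ i i' = xv 0 * a i i' 0 + s * a i i' 1 + xv 2 ^ (j + 1) * a i i' 2)
    (hg : g = xv 0 * v 0 0 + s * v 0 1 + xv 2 ^ j * v 0 2)
    (hh : h = xv 0 * v 1 0 + s * v 1 1 + xv 2 ^ j * v 1 2)
    (hv : cc (v 0 2) ≠ 0 ∨ cc (v 1 2) ≠ 0) : False := by
  -- Each product needs one factor written with z^(j+1) and one with z^j; for the determinant the
  -- second factor absorbs a z into its coefficient.
  set u : Fin 2 → Fin 2 → Fin 3 → OX := fun i i' => ![a i i' 0, a i i' 1, xv 2 * a i i' 2] with hu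
  have hφ' : ∀ i i', φ i i' = xv 0 * u i i' 0 + s * u i i' 1 + xv 2 ^ j * u i i' 2 := by
    intro i i'
    rw [hφ, hu]
    simp only [Matrix.cons_val]
    ring
  set E : Fin 3 → Fin 6 → OX := ![prodCoeffs (a 0 0) (u 1 1) - prodCoeffs (a 0 1) (u 1 0),
    prodCoeffs (a 0 0) (v 1) - prodCoeffs (a 1 0) (v 0),
    prodCoeffs (a 0 1) (v 1) - prodCoeffs (a 1 1) (v 0)] with hE
  have hdet : φ.det = branchForm j s (E 0) := by
    simp only [hE, Matrix.cons_val]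
    rw [branchForm_sub, branchForm_prodCoeffs, branchForm_prodCoeffs, ← hφ, ← hφ, ← hφ', ← hφ',
      Matrix.det_fin_two]
  have hL : minorL φ g h = branchForm j s (E 1) := by
    simp only [hE, Matrix.cons_val]
    rw [branchForm_sub, branchForm_prodCoeffs, branchForm_prodCoeffs, ← hφ, ← hφ, ← hg, ← hh,
      minorL]
  have hR : minorR φ g h = branchForm j s (E 2) := by
    simp only [hE, Matrix.cons_val]
    rw [branchForm_sub, branchForm_prodCoeffs, branchForm_prodCoeffs, ← hφ, ← hφ, ← hg, ← hh,
      minorR]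
  have hcomb : ∀ c : Fin 3 → ℂ, c 0 • φ.det + c 1 • minorL φ g h + c 2 • minorR φ g h =
      branchForm j s (combCoeffs E c) := by
    intro c
    rw [combCoeffs, branchForm_add, branchForm_add, branchForm_smul, branchForm_smul,
      branchForm_smul, ← hdet, ← hL, ← hR]
  -- vanishing Hessian coefficients
  have hz : ∀ i, cc (E i 1) = 0 ∧ cc (E i 2) = 0 := by
    intro i
    fin_cases i
    · refine hs.cc_coeff_eq_zero hj hdet fun b => ?_
      rw [H.det_eq, cc_hessian_equation hT, if_neg (by simp)]
    · exact hs.cc_coeff_eq_zero hj hL fun b => (H.cc_hessian_minor hT (by decide)).1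
    · exact hs.cc_coeff_eq_zero hj hR fun b => (H.cc_hessian_minor hT (by decide)).2
  have hz1 : ∀ c, cc (combCoeffs E c 1) = 0 := fun c => by
    rw [cc_combCoeffs, eval_linForm, (hz 0).1, (hz 1).1, (hz 2).1]; ring
  have hz2 : ∀ c, cc (combCoeffs E c 2) = 0 := fun c => by
    rw [cc_combCoeffs, eval_linForm, (hz 0).2, (hz 1).2, (hz 2).2]; ring
  -- the generic conditions
  have hα : linForm (fun i => cc (E i 0)) ≠ 0 := by
    refine linForm_ne_zero 0 fun h0 => ?_
    have h1 := cc_hessian_equation hT 0 0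
    rw [← H.det_eq, hdet, hs.cc_pd_zero_zero hj, h0] at h1
    simp at h1
  have hent : ∀ i i', cc (φ i i') = 0 := fun i i' => by rw [hφ]; simp [hs.cc_s]
  have hA : ∀ i i', cc (pd 0 (φ i i')) = cc (a i i' 0) := fun i i' => by
    rw [hφ]
    simp only [map_add, derivation_mul, Derivation.leibniz_pow, pd_xv, hs.pd_zero_s]
    simp [hs.cc_s]
  -- The coefficients of x z^j in the two minors come from the invertible matrix ∂ₓφ(0) and the
  -- leading coefficients of g and h on the branch, so they do not both vanish.
  have hu4 : linForm (fun i => cc (E i 3)) ≠ 0 := by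
    have hAdet := H.det_gradient hT hent
    rw [hA, hA, hA, hA] at hAdet
    by_contra hne
    have e1 : cc (E 1 3) = 0 := by
      by_contra h1
      exact linForm_ne_zero 1 h1 hne
    have e2 : cc (E 2 3) = 0 := by
      by_contra h2
      exact linForm_ne_zero 2 h2 hne
    simp only [hE, Matrix.cons_val, prodCoeffs, Pi.sub_apply, map_sub, map_add, map_mul, cc_xv,
      zero_mul, add_zero] at e1 e2
    have := eq_zero_of_adjugate hAdet e1 e2
    rcases hv with hv | hv
    · exact hv this.1
    · exact hv this.2
  obtain ⟨p, hp, hgen⟩ := H.general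
  rcases hTj with ⟨rfl, rfl⟩ | ⟨n, hn, rfl, hjn⟩
  · have hb : linForm (fun i => cc (pd 1 (E i 2))) ≠ 0 := by
      refine linForm_ne_zero 0 fun h0 => ?_
      have h1 := hs.cc_pd_one_one_one (e := E 0) hj
      rw [← hdet, H.det_eq, h0, DuValType.equation] at h1
      simp [pow_succ] at h1
      norm_num at h1
    obtain ⟨c, hc⟩ : ∃ c, MvPolynomial.eval c (p * linForm (fun i => cc (E i 0)) *
        linForm (fun i => cc (E i 3)) * linForm (fun i => cc (pd 1 (E i 2)))) ≠ 0 := by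
      by_contra! hall
      exact mul_ne_zero (mul_ne_zero (mul_ne_zero hp hα) hu4) hb
        (MvPolynomial.funext fun x => by rw [hall x, map_zero])
    simp only [map_mul, mul_ne_zero_iff] at hc
    obtain ⟨⟨⟨hpc, hαc⟩, hu4c⟩, hbc⟩ := hc
    rw [← cc_combCoeffs] at hαc hu4c
    rw [← cc_derivation_combCoeffs] at hbc
    have hmem := hgen c hpc
    rw [hcomb] at hmem
    obtain ⟨θ, hθ, hF, hd, hH⟩ := hmem.exists_arc_E7
    exact hs.false_of_E7 hθ (hz1 c) (hz2 c) hαc hu4c hbc hF hd hH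
  · have hb : cc (dz Q (E 0 2)) = 1 := by
      have h1 := hs.cc_dz_pd_one_one (e := E 0) hj
      rw [← hdet, H.det_eq, cc_dz, DuValType.equation] at h1
      simp [pow_two, Derivation.leibniz_pow] at h1
      linear_combination -h1 / 2
    -- The entries have order j + 1 on the branch, so the coefficient of s z^j in the determinant
    -- vanishes at the origin. Hence the discriminant below equals 1 at c = (1, 0, 0).
    have hδ : cc (E 0 4) = 0 := by
      simp [hE, hu, prodCoeffs]
    have hb' : linForm (fun i => cc (dz Q (E i 2))) ≠ 0 :=
      linForm_ne_zero 0 (by rw [hb]; exact one_ne_zero)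
    have hdisc : linForm (fun i => cc (dz Q (E i 2))) ^ 2 -
        MvPolynomial.C 4 * linForm (fun i => cc (pd 1 (E i 2))) * linForm (fun i => cc (E i 4)) ≠ 0 := by
      intro h0
      have := congrArg (MvPolynomial.eval ![1, 0, 0]) h0
      simp [eval_linForm, hb, hδ] at this
    obtain ⟨c, hc⟩ : ∃ c, MvPolynomial.eval c (p * linForm (fun i => cc (E i 0)) *
        linForm (fun i => cc (E i 3)) * linForm (fun i => cc (dz Q (E i 2))) *
        (linForm (fun i => cc (dz Q (E i 2))) ^ 2 -
        MvPolynomial.C 4 * linForm (fun i => cc (pd 1 (E i 2))) *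
          linForm (fun i => cc (E i 4)))) ≠ 0 := by
      by_contra! hall
      exact mul_ne_zero (mul_ne_zero (mul_ne_zero (mul_ne_zero hp hα) hu4) hb') hdisc
        (MvPolynomial.funext fun x => by rw [hall x, map_zero])
    simp only [map_mul, map_sub, map_pow, mul_ne_zero_iff, MvPolynomial.eval_C] at hc
    obtain ⟨⟨⟨⟨hpc, hαc⟩, hu4c⟩, hbc⟩, hdc⟩ := hc
    rw [← cc_combCoeffs] at hαc hu4c
    rw [← cc_derivation_combCoeffs] at hbc
    rw [← cc_derivation_combCoeffs, ← cc_derivation_combCoeffs, ← cc_combCoeffs] at hdc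
    have hmem := hgen c hpc
    rw [hcomb] at hmem
    obtain ⟨θ, hθ, hF, hd⟩ := hmem.exists_arc_D
    exact hs.false_of_D hj hθ (hz1 c) (hz2 c) hαc hu4c hbc hdc
      ((pow_dvd_pow _ (by omega)).trans hF) fun d => (pow_dvd_pow _ (by omega)).trans (hd d)

/-- The case of entries tangent to the `z`-axis. -/
theorem IsGeneralNormal.mem_of_tangential (H : IsGeneralNormal T φ g h) (hT : IsDE T)
    (hφ : ∀ i j, cc (φ i j) = 0) (hall : ∀ i j, cc (pd 2 (φ i j)) = 0) :
    g ∈ entriesIdeal φ ∧ h ∈ entriesIdeal φ := by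
  have hx := H.x_mem hT
  obtain ⟨hg0, hh0⟩ := H.cc_eq_zero hT hφ
  obtain ⟨hg2, hh2⟩ := H.tangent_eq_zero hT hφ 0 1 (by simp [hall])
  rw [zero_mul, zero_add, one_mul] at hg2 hh2
  obtain ⟨i₀, j₀, h1⟩ := H.exists_entry hT hφ
  replace h1 := h1.resolve_right (by simp [hall])
  obtain ⟨r, hr⟩ : ∃ r, xv 1 - xv 2 ^ 2 * r ∈ entriesIdeal φ := by
    obtain ⟨a, b, c, e, hb⟩ := exists_decomp_sq (hφ i₀ j₀) (hall i₀ j₀)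
    rw [← hb] at h1
    obtain ⟨u, rfl⟩ := isUnit_iff_cc.2 h1
    refine ⟨-(c * ↑u⁻¹), ?_⟩
    have h1 : ↑u⁻¹ * (φ i₀ j₀ - xv 0 * a) ∈ entriesIdeal φ :=
      Ideal.mul_mem_left _ _ (sub_mem (entry_mem _ _ _) (Ideal.mul_mem_right _ _ hx))
    convert h1 using 1
    rw [e]
    linear_combination (- xv 1) * u.inv_mul
  by_cases hz2 : xv 2 ^ 2 ∈ entriesIdeal φ
  · have hy : xv 1 ∈ entriesIdeal φ := by
      simpa using add_mem hr (Ideal.mul_mem_right r _ hz2)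
    have red : ∀ w : OX, cc w = 0 → cc (pd 2 w) = 0 → w ∈ entriesIdeal φ := by
      intro w h0 h2
      obtain ⟨a, b, c, rfl, -⟩ := exists_decomp_sq h0 h2
      exact add_mem (add_mem (Ideal.mul_mem_right _ _ hx) (Ideal.mul_mem_right _ _ hy))
        (Ideal.mul_mem_right _ _ hz2)
    exact ⟨red g hg0 hg2, red h hh0 hh2⟩
  obtain ⟨k₀, hk₀, hk₀7⟩ := H.z_pow_mem hT hr
  have hex : ∃ k, xv 2 ^ k ∈ entriesIdeal φ := ⟨k₀, hk₀⟩
  classical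
  set k := Nat.find hex with hk
  have hkmem : xv 2 ^ k ∈ entriesIdeal φ := Nat.find_spec hex
  have hkmin : ∀ m < k, xv 2 ^ m ∉ entriesIdeal φ := fun m hm => Nat.find_min hex hm
  have hk3 : 3 ≤ k := by
    by_contra hlt
    exact hz2 (Ideal.pow_mem_of_pow_mem _ hkmem (by omega))
  -- Modulo I(φ) the function r may be replaced by a polynomial in z, so that s becomes part of a
  -- coordinate system x, s, z.
  obtain ⟨q, a, b, c, hq⟩ := exists_polynomial_decomp (s := xv 1 - xv 2 ^ 2 * r) (r := xv 2 * r)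
    (by ring) r k
  set Q := Polynomial.aeval (xv 2) q with hQ
  set s := xv 1 - xv 2 ^ 2 * Q with hs
  have hsK : s ∈ entriesIdeal φ := by
    have : s = (xv 1 - xv 2 ^ 2 * r) + xv 2 ^ 2 * (xv 0 * a + (xv 1 - xv 2 ^ 2 * r) * b
        + xv 2 ^ k * c) := by
      rw [hs]; linear_combination (xv 2 ^ 2) * hq
    rw [this]
    exact add_mem hr (Ideal.mul_mem_left _ _ (add_mem (add_mem (Ideal.mul_mem_right _ _ hx)
      (Ideal.mul_mem_right _ _ hr)) (Ideal.mul_mem_right _ _ hkmem)))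
  have hbc : IsBranchCoord s Q := ⟨rfl, derivation_aeval_z (by decide) q,
    derivation_aeval_z (by decide) q⟩
  obtain ⟨Θ, hΘ⟩ := exists_arc ![0, PowerSeries.X ^ 2 * Polynomial.aeval PowerSeries.X q,
    PowerSeries.X] (by intro i; fin_cases i <;> simp)
  have t0 : Θ (xv 0) = 0 := hΘ 0
  have t1 : Θ (xv 1) = PowerSeries.X ^ 2 * Polynomial.aeval PowerSeries.X q := hΘ 1
  have t2 : Θ (xv 2) = PowerSeries.X := hΘ 2
  have ts : Θ s = 0 := by
    rw [hs, map_sub, map_mul, map_pow, t1, t2, hQ, ← Polynomial.aeval_algHom_apply, t2, sub_self]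
  have hs' : xv 1 = s + xv 2 * (xv 2 * Q) := by rw [hs]; ring
  have hK : ∀ w ∈ entriesIdeal φ, PowerSeries.X ^ k ∣ Θ w := fun w hw =>
    dvd_arc_of_mem hs' hx hsK hkmem hkmin Θ t0 ts t2 hw
  by_contra hne
  have hne' : ¬ (PowerSeries.X ^ k ∣ Θ g ∧ PowerSeries.X ^ k ∣ Θ h) := fun hd =>
    hne ⟨mem_of_dvd_arc hs' hx hsK hkmem Θ t0 ts t2 hd.1,
      mem_of_dvd_arc hs' hx hsK hkmem Θ t0 ts t2 hd.2⟩
  have hex' : ∃ m, ¬ (PowerSeries.X ^ m ∣ Θ g ∧ PowerSeries.X ^ m ∣ Θ h) := ⟨k, hne'⟩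
  have hm2 : PowerSeries.X ^ 2 ∣ Θ g ∧ PowerSeries.X ^ 2 ∣ Θ h := by
    have red : ∀ w : OX, cc w = 0 → cc (pd 2 w) = 0 → PowerSeries.X ^ 2 ∣ Θ w := by
      intro w h0 h2
      obtain ⟨a, b, c, rfl, -⟩ := exists_decomp_sq h0 h2
      rw [map_add, map_add, map_mul, map_mul, map_mul, map_pow, t0, t1, t2, zero_mul, zero_add]
      exact dvd_add ((dvd_mul_right _ _).mul_right _) (dvd_mul_right _ _)
    exact ⟨red g hg0 hg2, red h hh0 hh2⟩
  -- The number j is the smaller of the orders of g and h on the branch; j + 1 is the first order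
  -- that one of them misses.
  obtain ⟨j, hj⟩ : ∃ j, Nat.find hex' = j + 1 :=
    ⟨Nat.find hex' - 1, by
      have : Nat.find hex' ≠ 0 := fun h0 => by
        have := Nat.find_spec hex'
        rw [h0] at this
        simp at this
      omega⟩
  have hspec := Nat.find_spec hex'
  rw [hj] at hspec
  obtain ⟨hjg, hjh⟩ := not_not.1 (Nat.find_min hex' (m := j) (by omega))
  have hj2 : 2 ≤ j := by
    by_contra hlt
    exact hspec ⟨(pow_dvd_pow _ (by omega)).trans hm2.1, (pow_dvd_pow _ (by omega)).trans hm2.2⟩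
  have hjk : j + 1 ≤ k := by
    rw [← hj]; exact Nat.find_min' hex' hne'
  have hTj : (T = .E7 ∧ j = 2) ∨ ∃ n hn, T = .D n hn ∧ 2 * j + 2 ≤ n := by
    rcases H.type_of_order hT hk3 Θ t0 (by rw [t1]; exact dvd_mul_right _ _) t2 hK with
      h7 | ⟨n, hn, hD, hkn⟩
    · refine Or.inl ⟨h7, ?_⟩
      have hk' : k ≤ 3 := by
        have := hk₀7 h7
        subst this
        exact Nat.find_min' hex hk₀
      omega
    · exact Or.inr ⟨n, hn, hD, by omega⟩
  have hent : ∀ i i', ∃ u : Fin 3 → OX, φ i i' = xv 0 * u 0 + s * u 1 + xv 2 ^ (j + 1) * u 2 :=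
    fun i i' => exists_decomp_of_dvd hs' Θ t0 ts t2
      ((pow_dvd_pow _ hjk).trans (hK _ (entry_mem φ i i')))
  choose a ha using hent
  obtain ⟨v₀, hv₀⟩ := exists_decomp_of_dvd hs' Θ t0 ts t2 hjg
  obtain ⟨v₁, hv₁⟩ := exists_decomp_of_dvd hs' Θ t0 ts t2 hjh
  refine H.false_of_branch hT hbc hj2 hTj a ![v₀, v₁] ha hv₀ hv₁ ?_
  by_contra! hv
  have red : ∀ v : Fin 3 → OX, cc (v 2) = 0 →
      PowerSeries.X ^ (j + 1) ∣ Θ (xv 0 * v 0 + s * v 1 + xv 2 ^ j * v 2) := by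
    intro v h0
    rw [map_add, map_add, map_mul, map_mul, map_mul, map_pow, t0, ts, t2, zero_mul, zero_mul,
      zero_add, zero_add, pow_succ]
    exact mul_dvd_mul_left _ (X_dvd_of_cc Θ h0)
  apply hspec
  rw [hv₀, hv₁]
  exact ⟨red _ hv.1, red _ hv.2⟩

theorem IsGeneralNormal.mem (H : IsGeneralNormal T φ g h) :
    g ∈ entriesIdeal φ ∧ h ∈ entriesIdeal φ := by
  by_cases hT : IsDE T
  · by_cases hφ : ∀ i j, cc (φ i j) = 0
    · by_cases hall : ∀ i j, cc (pd 2 (φ i j)) = 0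
      · exact H.mem_of_tangential hT hφ hall
      · push Not at hall
        obtain ⟨i, j, hij⟩ := hall
        exact H.mem_of_transversal hT hφ hij
    · push Not at hφ
      obtain ⟨i, j, hij⟩ := hφ
      have := Ideal.eq_top_of_isUnit_mem _ (entry_mem φ i j) (isUnit_iff_cc.2 hij)
      rw [this]
      exact ⟨trivial, trivial⟩
  · cases T with
    | A n hn => exact H.mem_of_A
    | _ => exact (hT trivial).elim

end

end DuVal

/-! ### Reduction of part 2 to normal forms. -/

namespace DuVal

open MvPowerSeries

theorem minorsIdeal_augmented (φ : Matrix (Fin 2) (Fin 2) OX) (g h : OX) :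
    minorsIdeal (augmented φ g h) =
      Ideal.span (Set.range ![φ.det, minorL φ g h, minorR φ g h]) := by
  have hdet : ∀ e : Fin 2 ↪o Fin 3, ((augmented φ g h).submatrix id e).det =
      augmented φ g h 0 (e 0) * augmented φ g h 1 (e 1)
        - augmented φ g h 0 (e 1) * augmented φ g h 1 (e 0) := fun e => by
    rw [Matrix.det_fin_two]; rfl
  apply le_antisymm
  · rw [minorsIdeal, Ideal.span_le]
    rintro _ ⟨e, rfl⟩
    have hlt : e 0 < e 1 := e.strictMono (by decide)
    have hmem : ∀ i, (![φ.det, minorL φ g h, minorR φ g h] : Fin 3 → OX) i ∈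
        Ideal.span (Set.range ![φ.det, minorL φ g h, minorR φ g h]) := fun i =>
      Ideal.subset_span ⟨i, rfl⟩
    change ((augmented φ g h).submatrix id e).det ∈ _
    rw [hdet]
    generalize e 0 = a at hlt
    generalize e 1 = b at hlt
    fin_cases a <;> fin_cases b <;> simp at hlt
    · convert hmem 0 using 1
      simp [augmented, Matrix.det_fin_two]
    · convert hmem 1 using 1
      simp [augmented, minorL, mul_comm]
    · convert hmem 2 using 1
      simp [augmented, minorR, mul_comm]
  · rw [Ideal.span_le]
    have hmem : ∀ e : Fin 2 ↪o Fin 3, ((augmented φ g h).submatrix id e).det ∈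
        minorsIdeal (augmented φ g h) := fun e => Ideal.subset_span ⟨e, rfl⟩
    rintro _ ⟨i, rfl⟩
    fin_cases i
    · convert hmem (OrderEmbedding.ofStrictMono ![0, 1] (by decide)) using 1
      rw [hdet]; simp [augmented, Matrix.det_fin_two]
    · convert hmem (OrderEmbedding.ofStrictMono ![0, 2] (by decide)) using 1
      rw [hdet]; simp [augmented, minorL, mul_comm]
    · convert hmem (OrderEmbedding.ofStrictMono ![1, 2] (by decide)) using 1
      rw [hdet]; simp [augmented, minorR, mul_comm]

theorem _root_.IsDuValOfType.map {T : DuValType} {f : OX} (hf : IsDuValOfType T f)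
    (τ : OX ≃ₐ[ℂ] OX) : IsDuValOfType T (τ f) := by
  obtain ⟨σ, hσ⟩ := hf
  exact ⟨σ.trans τ, hσ.map τ⟩

theorem _root_.IsDuValOfType.unit_mul {T : DuValType} {f : OX} (hf : IsDuValOfType T f)
    {u : OX} (hu : IsUnit u) : IsDuValOfType T (u * f) := by
  obtain ⟨σ, hσ⟩ := hf
  exact ⟨σ, (associated_unit_mul_left f u hu).trans hσ⟩

/-- The last column of a matrix whose minors cut out a curve in a general Du Val section. -/
theorem mem_entriesIdeal_of_general {I : Ideal OX} {f : OX} (hI : IsGeneralDuValSection I f)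
    {φ : Matrix (Fin 2) (Fin 2) OX} (hφ : Associated f φ.det) {g h : OX}
    (hgh : I = minorsIdeal (augmented φ g h)) : g ∈ entriesIdeal φ ∧ h ∈ entriesIdeal φ := by
  obtain ⟨-, T, ⟨σ, hσ⟩, hgen⟩ := hI
  obtain ⟨u, hu⟩ := hφ.symm.trans hσ
  obtain ⟨p, hp, hmem⟩ := hgen 3 _ ((minorsIdeal_augmented φ g h).symm.trans hgh.symm)
  set l : OX := σ.symm u with hl
  have hlu : IsUnit l := u.isUnit.map σ.symm
  -- Only the first row is multiplied by the unit, so every minor of the extended matrix picks it up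
  -- exactly once, and the ideal of entries only changes by σ.
  set φ' : Matrix (Fin 2) (Fin 2) OX :=
    !![l * σ.symm (φ 0 0), l * σ.symm (φ 0 1); σ.symm (φ 1 0), σ.symm (φ 1 1)] with hφ'
  have hdet : φ'.det = l * σ.symm φ.det := by
    simp [hφ', Matrix.det_fin_two]; ring
  have hL : minorL φ' (l * σ.symm g) (σ.symm h) = l * σ.symm (minorL φ g h) := by
    simp [hφ', minorL]; ring
  have hR : minorR φ' (l * σ.symm g) (σ.symm h) = l * σ.symm (minorR φ g h) := by
    simp [hφ', minorR]; ring
  have H : IsGeneralNormal T φ' (l * σ.symm g) (σ.symm h) := by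
    refine ⟨?_, p, hp, fun c hc => ?_⟩
    · rw [hdet, hl, ← map_mul, mul_comm, hu, AlgEquiv.symm_apply_apply]
    · have := ((hmem c hc).map σ.symm).unit_mul hlu
      rw [Fin.sum_univ_three] at this
      rw [hdet, hL, hR]
      convert this using 1
      simp only [map_add, map_smul, Matrix.cons_val, mul_add, mul_smul_comm]
  obtain ⟨h1, h2⟩ := H.mem
  have hle : entriesIdeal φ' ≤ (entriesIdeal φ).comap σ := by
    rw [entriesIdeal, Ideal.span_le]
    rintro _ ⟨⟨i, j⟩, rfl⟩
    fin_cases i <;> fin_cases j <;>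
      simp [hφ', Ideal.mul_mem_left, entry_mem]
  have h1' := hle h1
  have h2' := hle h2
  rw [Ideal.mem_comap, AlgEquiv.apply_symm_apply] at h2'
  rw [Ideal.mem_comap, map_mul, AlgEquiv.apply_symm_apply, AlgEquiv.apply_symm_apply] at h1'
  exact ⟨(Ideal.unit_mul_mem_iff_mem _ u.isUnit).1 h1', h2'⟩

end DuVal

/-! ### The action of SL(2, ℂ) on linear forms, and coprime orbit products. -/

namespace DuVal

open MvPowerSeries

/-- The order in one variable is a weighted order, hence additive on products. -/
theorem X_prime {σ k : Type*} [CommRing k] [IsDomain k] (s : σ) :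
    Prime (X s : MvPowerSeries σ k) := by
  classical
  have hw : ∀ m : σ →₀ ℕ, Finsupp.weight (Pi.single s 1 : σ → ℕ) m = m s := by
    intro m
    rw [Finsupp.weight_apply, Finsupp.sum]
    simp only [Pi.single_apply, smul_eq_mul, mul_ite, mul_one, mul_zero, Finset.sum_ite_eq']
    split_ifs with h
    · rfl
    · exact (Finsupp.notMem_support_iff.1 h).symm
  have key : ∀ f : MvPowerSeries σ k, X s ∣ f ↔ f.weightedOrder (Pi.single s 1 : σ → ℕ) ≠ 0 := by
    intro f
    rw [X_dvd_iff]
    constructor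
    · intro h h0
      have : ((1 : ℕ) : ℕ∞) ≤ f.weightedOrder (Pi.single s 1 : σ → ℕ) :=
        nat_le_weightedOrder _ fun d hd => h d (by rw [hw] at hd; omega)
      rw [h0] at this
      exact absurd this (by norm_num)
    · intro h m hm
      apply coeff_eq_zero_of_lt_weightedOrder (Pi.single s 1 : σ → ℕ)
      rw [hw, hm]
      exact pos_iff_ne_zero.2 h
  refine ⟨?_, ?_, ?_⟩
  · intro h
    have := congrArg (coeff (Finsupp.single s 1)) h
    simp [coeff_X] at this
  · intro h
    have := h.map (constantCoeff (σ := σ) (R := k))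
    simp at this
  · intro a b hab
    rw [key, key]
    rw [key, weightedOrder_mul] at hab
    by_contra! h
    exact hab (by rw [h.1, h.2, add_zero])

local notation "SL₂" => Matrix.SpecialLinearGroup (Fin 2) ℂ

/-- Linear forms on the plane. -/
noncomputable def lin : (Fin 2 → ℂ) →ₗ[ℂ] OC2 :=
  Fintype.linearCombination ℂ (fun i : Fin 2 => (X i : OC2))

theorem lin_apply (a : Fin 2 → ℂ) : lin a = ∑ i, a i • (X i : OC2) := rfl

theorem linearForms_eq (g : SL₂) (i : Fin 2) : linearForms g i = lin (g⁻¹.1 i) := rfl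

theorem lin_single (i : Fin 2) : lin (Pi.single i 1) = X i := by
  rw [lin, Fintype.linearCombination_apply_single, one_smul]

/-- The action as an algebra homomorphism. -/
noncomputable def actHom (g : SL₂) : OC2 →ₐ[ℂ] OC2 := substAlgHom (hasSubst_linearForms g)

theorem actHom_apply (g : SL₂) (h : OC2) : actHom g h = act g h := by
  rw [actHom, coe_substAlgHom, act]

theorem act_X (g : SL₂) (i : Fin 2) : act g (X i) = linearForms g i := by
  rw [act, subst_X (hasSubst_linearForms g)]

theorem act_lin (g : SL₂) (a : Fin 2 → ℂ) : act g (lin a) = lin (Matrix.vecMul a g⁻¹.1) := by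
  rw [← actHom_apply, lin_apply, map_sum]
  simp only [map_smul, actHom_apply, act_X, linearForms_eq]
  simp only [← map_smul, ← map_sum]
  congr 1

theorem act_mul (g g' : SL₂) (h : OC2) : act (g * g') h = act g (act g' h) := by
  rw [act, act, act, subst_comp_subst_apply (hasSubst_linearForms g') (hasSubst_linearForms g)]
  congr 1
  ext1 i
  have : subst (linearForms g) (linearForms g' i) = act g (linearForms g' i) := rfl
  rw [this, linearForms_eq, linearForms_eq, act_lin, mul_inv_rev]
  congr 1

theorem act_one (h : OC2) : act 1 h = h := by
  have : linearForms 1 = (X : Fin 2 → OC2) := by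
    ext1 i
    rw [linearForms_eq, inv_one, ← lin_single]
    congr 1
    ext j
    simp [Matrix.one_apply, Pi.single_apply, eq_comm]
  rw [act, this, subst_self, id]

/-- The action as an automorphism. -/
noncomputable def actEquiv (g : SL₂) : OC2 ≃ₐ[ℂ] OC2 :=
  AlgEquiv.ofAlgHom (actHom g) (actHom g⁻¹)
    (AlgHom.ext fun h => by
      rw [AlgHom.comp_apply, actHom_apply, actHom_apply, ← act_mul, mul_inv_cancel, act_one]; rfl)
    (AlgHom.ext fun h => by
      rw [AlgHom.comp_apply, actHom_apply, actHom_apply, ← act_mul, inv_mul_cancel, act_one]; rfl)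

theorem actEquiv_apply (g : SL₂) (h : OC2) : actEquiv g h = act g h := actHom_apply g h

/-- A nonzero covector is the first row of a matrix of determinant one; this reduces statements on
linear forms to the first coordinate. -/
theorem exists_act_X_eq_lin {a : Fin 2 → ℂ} (ha : a ≠ 0) : ∃ g : SL₂, act g (X 0) = lin a := by
  suffices h : ∃ g : SL₂, g.1 0 = a by
    obtain ⟨g, hg⟩ := h
    exact ⟨g⁻¹, by rw [act_X, linearForms_eq, inv_inv, hg]⟩
  by_cases h0 : a 0 = 0
  · have h1 : a 1 ≠ 0 := fun h1 => ha (by ext i; fin_cases i <;> assumption)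
    refine ⟨⟨!![a 0, a 1; -(a 1)⁻¹, 0], by simp [Matrix.det_fin_two, h1]⟩, ?_⟩
    ext i; fin_cases i <;> rfl
  · refine ⟨⟨!![a 0, a 1; 0, (a 0)⁻¹], by simp [Matrix.det_fin_two, h0]⟩, ?_⟩
    ext i; fin_cases i <;> rfl

theorem lin_prime {a : Fin 2 → ℂ} (ha : a ≠ 0) : Prime (lin a) := by
  obtain ⟨g, hg⟩ := exists_act_X_eq_lin ha
  rw [← hg, ← actEquiv_apply]
  exact (MulEquiv.prime_iff (actEquiv g)).2 (X_prime 0)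

theorem not_lin_dvd_all {a : Fin 2 → ℂ} (ha : a ≠ 0) : ∃ b, ¬ lin a ∣ lin b := by
  by_contra! h
  obtain ⟨g, hg⟩ := exists_act_X_eq_lin ha
  have h1 := h (g⁻¹.1 1)
  rw [← linearForms_eq, ← act_X, ← hg, ← actEquiv_apply, ← actEquiv_apply,
    map_dvd_iff (actEquiv g), X_dvd_iff] at h1
  have := h1 (Finsupp.single 1 1) (by simp)
  simp [coeff_X] at this

/-- A nontrivial element of finite order has no fixed vectors. -/
theorem det_one_sub_ne_zero {k : SL₂} (hk : IsOfFinOrder k) (h1 : k ≠ 1) : (1 - k.1).det ≠ 0 := by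
  intro hdet
  obtain ⟨n, hn, hkn⟩ := hk.exists_pow_eq_one
  have hd : k.1 0 0 * k.1 1 1 - k.1 0 1 * k.1 1 0 = 1 := by
    rw [← Matrix.det_fin_two]; exact k.2
  rw [Matrix.det_fin_two] at hdet
  simp at hdet
  -- Determinant 1 and trace 2 make k unipotent, and a unipotent matrix of finite order over ℂ is
  -- the identity.
  have htr : k.1 0 0 + k.1 1 1 = 2 := by linear_combination hd - hdet
  have hN : (k.1 - 1) * (k.1 - 1) = 0 := by
    ext i j
    rw [Matrix.mul_apply, Fin.sum_univ_two]
    fin_cases i <;> fin_cases j <;> simp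
    · linear_combination -hd + k.1 0 0 * htr
    · linear_combination k.1 0 1 * htr
    · linear_combination k.1 1 0 * htr
    · linear_combination -hd + k.1 1 1 * htr
  have hpow : ∀ m : ℕ, k.1 ^ m = 1 + m • (k.1 - 1) := by
    intro m
    induction m with
    | zero => simp
    | succ m ih =>
      rw [pow_succ, ih]
      nth_rewrite 2 [show k.1 = 1 + (k.1 - 1) by abel]
      rw [mul_add, mul_one, add_mul, one_mul, smul_mul_assoc, hN, smul_zero, add_zero, succ_nsmul,
        add_assoc]
  have h2 := hpow n
  rw [← Matrix.SpecialLinearGroup.coe_pow, hkn, Matrix.SpecialLinearGroup.coe_one] at h2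
  have h3 : n • (k.1 - 1) = 0 := by simpa using h2.symm
  rw [← Nat.cast_smul_eq_nsmul ℂ] at h3
  have h4 := (smul_eq_zero.1 h3).resolve_left (Nat.cast_ne_zero.2 hn.ne')
  exact h1 (Subtype.ext (sub_eq_zero.1 h4))

section

variable {G : Subgroup SL₂} [Fintype G]

theorem lin_sub_act (g : SL₂) (a : Fin 2 → ℂ) :
    lin a - act g (lin a) = lin (Matrix.vecMul a (1 - g⁻¹.1)) := by
  rw [act_lin, ← map_sub, Matrix.vecMul_sub, Matrix.vecMul_one]

theorem det_ne_zero_of_ne_one {h : G} (hh : h ≠ 1) : (1 - (h : SL₂)⁻¹.1).det ≠ 0 := by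
  apply det_one_sub_ne_zero
  · have h1 : IsOfFinOrder h := isOfFinOrder_of_finite h
    have h2 : IsOfFinOrder (h : SL₂) := MonoidHom.isOfFinOrder G.subtype h1
    exact h2.inv
  · intro h1
    rw [inv_eq_one] at h1
    exact hh (Subtype.ext h1)

/-- The product of the differences of a linear form and its nontrivial translates. -/
noncomputable def orbitProd (G : Subgroup SL₂) [Fintype G] (a : Fin 2 → ℂ) : OC2 := by
  classical
  exact ∏ h ∈ (Finset.univ : Finset G).erase 1, (lin a - act h (lin a))

/-- One prime is removed at a time: L i divides m * a but not m, so it divides the cofactor a and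
cancels. -/
theorem dvd_of_dvd_prod_mul {ι : Type*} (t : Finset ι) (L : ι → OC2) {γ m p : OC2} (hγ : γ ≠ 0)
    (hL : ∀ i ∈ t, Prime (L i)) (hm : ∀ i ∈ t, ¬ L i ∣ m)
    (h1 : γ ∣ (∏ i ∈ t, L i) * p) (h2 : γ ∣ m * p) : γ ∣ p := by
  classical
  induction t using Finset.induction_on with
  | empty => simpa using h1
  | insert i t hi ih =>
    refine ih (fun k hk => hL k (Finset.mem_insert_of_mem hk))
      (fun k hk => hm k (Finset.mem_insert_of_mem hk)) ?_
    have hLi := hL i (Finset.mem_insert_self i t)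
    rw [Finset.prod_insert hi] at h1
    obtain ⟨a, ha⟩ := h1
    obtain ⟨b, hb⟩ := h2
    have e : L i * ((∏ k ∈ t, L k) * b) = m * a := by
      apply mul_left_cancel₀ hγ
      linear_combination m * ha - L i * (∏ k ∈ t, L k) * hb
    obtain ⟨a', rfl⟩ := (hLi.dvd_or_dvd (Dvd.intro _ e)).resolve_left
      (hm i (Finset.mem_insert_self i t))
    refine ⟨a', mul_left_cancel₀ hLi.ne_zero ?_⟩
    linear_combination ha

theorem vecMul_ne_zero {D : Matrix (Fin 2) (Fin 2) ℂ} (hD : D.det ≠ 0) {a : Fin 2 → ℂ} (ha : a ≠ 0) :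
    Matrix.vecMul a D ≠ 0 := fun h => ha (Matrix.eq_zero_of_vecMul_eq_zero hD h)

theorem exists_coprime_orbitProd (G : Subgroup SL₂) [Fintype G] : ∃ a b : Fin 2 → ℂ,
    ∀ γ p : OC2, γ ≠ 0 → γ ∣ orbitProd G a * p → γ ∣ orbitProd G b * p → γ ∣ p := by
  classical
  set L : G → OC2 := fun h => lin ![1, 0] - act h (lin ![1, 0]) with hL
  have he : (![1, 0] : Fin 2 → ℂ) ≠ 0 := fun h => by simpa using congrFun h 0
  have hprime : ∀ h : G, h ≠ 1 → Prime (L h) := fun h hh => by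
    rw [hL]
    simp only [lin_sub_act]
    exact lin_prime (vecMul_ne_zero (det_ne_zero_of_ne_one hh) he)
  -- Two bad values of t for one pair would make L h divide every linear form in the image of 1 -
  -- h'⁻¹. That matrix is invertible, so L h would divide all linear forms. Hence only finitely many
  -- t are bad.
  have hbad : ∀ h h' : G, h ≠ 1 → h' ≠ 1 →
      {t : ℂ | L h ∣ lin ![1, t] - act h' (lin ![1, t])}.Subsingleton := by
    intro h h' hh hh' t₁ ht₁ t₂ ht₂
    by_contra hne
    simp only [Set.mem_ofPred_eq, lin_sub_act] at ht₁ ht₂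
    obtain ⟨b, hb⟩ := not_lin_dvd_all (vecMul_ne_zero (det_ne_zero_of_ne_one hh) he)
    rw [← lin_sub_act] at hb
    apply hb
    set D := (1 - (h' : SL₂)⁻¹.1) with hD
    have hDu : IsUnit D.det := isUnit_iff_ne_zero.2 (det_ne_zero_of_ne_one hh')
    have h01 : L h ∣ lin (Matrix.vecMul ![0, 1] D) := by
      have h1 := dvd_sub ht₁ ht₂
      rw [← map_sub, ← Matrix.sub_vecMul] at h1
      have e : (![1, t₁] - ![1, t₂] : Fin 2 → ℂ) = (t₁ - t₂) • ![0, 1] := by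
        ext i; fin_cases i <;> simp
      rw [e, Matrix.smul_vecMul, map_smul] at h1
      have h2 := h1.trans (Dvd.intro_left (C (t₁ - t₂)⁻¹) rfl)
      rwa [← smul_eq_C_mul, smul_smul, inv_mul_cancel₀ (sub_ne_zero.2 hne), one_smul] at h2
    have h10 : L h ∣ lin (Matrix.vecMul ![1, 0] D) := by
      have e : (![1, 0] : Fin 2 → ℂ) = ![1, t₁] - t₁ • ![0, 1] := by
        ext i; fin_cases i <;> simp
      rw [e, Matrix.sub_vecMul, Matrix.smul_vecMul, map_sub, map_smul, smul_eq_C_mul]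
      exact dvd_sub ht₁ (h01.mul_left _)
    have e : b = Matrix.vecMul (Matrix.vecMul b D⁻¹) D := by
      rw [Matrix.vecMul_vecMul, Matrix.nonsing_inv_mul _ hDu, Matrix.vecMul_one]
    set c := Matrix.vecMul b D⁻¹ with hc
    have ec : c = c 0 • ![1, 0] + c 1 • ![0, 1] := by
      ext i; fin_cases i <;> simp
    rw [e, ec, Matrix.add_vecMul, Matrix.smul_vecMul, Matrix.smul_vecMul, map_add, map_smul,
      map_smul, smul_eq_C_mul, smul_eq_C_mul]
    exact dvd_add (h10.mul_left _) (h01.mul_left _)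
  have hfin : (⋃ x ∈ {x : G × G | x.1 ≠ 1 ∧ x.2 ≠ 1},
      {t : ℂ | L x.1 ∣ lin ![1, t] - act x.2 (lin ![1, t])}).Finite :=
    Set.Finite.biUnion (Set.toFinite _) fun x hx => (hbad x.1 x.2 hx.1 hx.2).finite
  obtain ⟨t, ht⟩ := hfin.infinite_compl.nonempty
  simp only [Set.mem_compl_iff, Set.mem_iUnion, Set.mem_ofPred_eq, not_exists] at ht
  refine ⟨![1, 0], ![1, t], fun γ p hγ h1 h2 => ?_⟩
  refine dvd_of_dvd_prod_mul _ L hγ (fun h hh => hprime h (Finset.ne_of_mem_erase hh)) ?_ h1 h2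
  intro h hh hdvd
  rw [orbitProd, (hprime h (Finset.ne_of_mem_erase hh)).dvd_finsetProd_iff] at hdvd
  obtain ⟨h', hh', hd⟩ := hdvd
  exact ht (h, h') ⟨Finset.ne_of_mem_erase hh, Finset.ne_of_mem_erase hh'⟩ hd

theorem orbitProd_ne_zero (G : Subgroup SL₂) [Fintype G] {a : Fin 2 → ℂ} (ha : a ≠ 0) :
    orbitProd G a ≠ 0 := by
  classical
  rw [orbitProd, Finset.prod_ne_zero_iff]
  intro h hh
  rw [lin_sub_act]
  exact (lin_prime (vecMul_ne_zero (det_ne_zero_of_ne_one (Finset.ne_of_mem_erase hh)) ha)).ne_zero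

end

end DuVal

/-! ### Semi-invariants, averaging, and part 1. -/

namespace DuVal

open MvPowerSeries

local notation "SL₂" => Matrix.SpecialLinearGroup (Fin 2) ℂ

theorem act_map_mul (g : SL₂) (a b : OC2) : act g (a * b) = act g a * act g b := by
  simp only [← actHom_apply, map_mul]

theorem act_smul (g : SL₂) (r : ℂ) (a : OC2) : act g (r • a) = r • act g a := by
  simp only [← actHom_apply, map_smul]

theorem act_pow (g : SL₂) (a : OC2) (n : ℕ) : act g (a ^ n) = act g a ^ n := by
  simp only [← actHom_apply, map_pow]

theorem act_sum {ι : Type*} (t : Finset ι) (g : SL₂) (F : ι → OC2) :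
    act g (∑ i ∈ t, F i) = ∑ i ∈ t, act g (F i) := by
  simp only [← actHom_apply, map_sum]

section

variable {G : Subgroup SL₂} {ρ : G →* ℂˣ}

theorem mem_semiInvariants {q : OC2} :
    q ∈ semiInvariants G ρ ↔ ∀ g : G, act g q = (ρ g : ℂ) • q := Iff.rfl

theorem mem_invariants {q : OC2} : q ∈ semiInvariants G 1 ↔ ∀ g : G, act g q = q := by
  simp [mem_semiInvariants]

theorem mul_mem_invariants {p q : OC2} (hp : p ∈ semiInvariants G ρ)
    (hq : ∀ g : G, act g q = ((ρ g)⁻¹ : ℂˣ).val • q) : p * q ∈ semiInvariants G 1 :=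
  mem_invariants.2 fun g => by
    rw [act_map_mul, hp g, hq g, smul_mul_smul_comm, Units.mul_inv, one_smul]

variable [Fintype G]

theorem reynolds_mem (ρ : G →* ℂˣ) (w : OC2) :
    ∑ g : G, ((ρ g)⁻¹ : ℂˣ).val • act g w ∈ semiInvariants G ρ := by
  intro h
  rw [act_sum, Finset.smul_sum]
  refine Fintype.sum_equiv (Equiv.mulLeft h) _ _ fun g => ?_
  rw [Equiv.coe_mulLeft, act_smul, ← act_mul, smul_smul, map_mul, mul_inv, Units.val_mul,
    ← mul_assoc, Units.mul_inv, one_mul]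
  rfl

theorem sum_act_mem (w : OC2) : ∑ g : G, act g w ∈ semiInvariants G 1 := by
  have := reynolds_mem (G := G) 1 w
  simpa using this

/-- Products of differences of translates lie in the ideal of semi-invariants. -/
theorem orbitProd_mem {J : Ideal OC2} (hJ : ∀ q ∈ semiInvariants G ρ, q ∈ J) (a : Fin 2 → ℂ) :
    orbitProd G a ∈ J := by
  classical
  -- Q vanishes at every translate of the linear form except the form itself, so the ρ-weighted sum
  -- of its values over the orbit is Q at the form. Expanding Q by coefficients writes the same sum
  -- through ρ-averages of powers, which are semi-invariants.
  set Q : Polynomial OC2 := ∏ h ∈ (Finset.univ : Finset G).erase 1,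
    (Polynomial.X - Polynomial.C (act h (lin a))) with hQ
  have hev : ∀ x : OC2, Q.eval x = ∏ h ∈ (Finset.univ : Finset G).erase 1, (x - act h (lin a)) := by
    intro x
    rw [hQ, Polynomial.eval_prod]
    simp
  have h1 : ∑ g : G, ((ρ g)⁻¹ : ℂˣ).val • Q.eval (act g (lin a)) = orbitProd G a := by
    rw [Finset.sum_eq_single 1]
    · rw [hev, map_one, inv_one, Units.val_one, one_smul, Subgroup.coe_one, act_one, orbitProd]
    · intro g _ hg
      rw [hev, Finset.prod_eq_zero (i := g) (Finset.mem_erase.2 ⟨hg, Finset.mem_univ g⟩)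
        (sub_self _), smul_zero]
    · intro h; exact absurd (Finset.mem_univ _) h
  have h2 : ∑ g : G, ((ρ g)⁻¹ : ℂˣ).val • Q.eval (act g (lin a)) =
      ∑ k ∈ Finset.range (Q.natDegree + 1),
        Q.coeff k * ∑ g : G, ((ρ g)⁻¹ : ℂˣ).val • act g (lin a ^ k) := by
    simp only [Polynomial.eval_eq_sum_range, Finset.smul_sum, Finset.mul_sum]
    rw [Finset.sum_comm]
    refine Finset.sum_congr rfl fun k _ => Finset.sum_congr rfl fun g _ => ?_
    rw [act_pow, mul_smul_comm]
  rw [← h1, h2]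
  exact Ideal.sum_mem _ fun k _ => Ideal.mul_mem_left _ _ (hJ _ (reynolds_mem ρ _))

end

theorem equation_ne_zero (T : DuValType) : T.equation ≠ 0 := by
  intro h
  have h1 : pd 0 (pd 0 T.equation) = 2 := by
    cases T <;> simp [DuValType.equation, derivation_two]
  rw [h, map_zero, map_zero] at h1
  simpa [cc_two] using congrArg cc h1

theorem _root_.IsDuVal.ne_zero {f : OX} (hf : IsDuVal f) : f ≠ 0 := by
  obtain ⟨T, hT⟩ := hf
  obtain ⟨σ, w, hw, rfl⟩ := hT.exists_eq
  exact mul_ne_zero hw.ne_zero ((map_ne_zero_iff σ σ.injective).2 (equation_ne_zero T))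

section

variable {G : Subgroup SL₂} {ρ : G →* ℂˣ} {f : OX} {π : OX →ₐ[ℂ] OC2}
  {φ ψ : Matrix (Fin 2) (Fin 2) OX} {I : Ideal OX} {γ : OC2}

theorem _root_.IsQuotientMap.eq_zero_iff (hπ : IsQuotientMap G f π) {a : OX} : π a = 0 ↔ f ∣ a := by
  rw [← Ideal.mem_span_singleton, ← hπ.ker_eq, RingHom.mem_ker]

theorem _root_.IsQuotientMap.prime (hπ : IsQuotientMap G f π) (hf : IsDuVal f) : Prime f := by
  rw [← Ideal.span_singleton_prime hf.ne_zero, ← hπ.ker_eq]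
  have : IsDomain OC2 := NoZeroDivisors.to_isDomain OC2
  exact RingHom.ker_isPrime _

theorem _root_.IsQuotientMap.exists_eq (hπ : IsQuotientMap G f π) {q : OC2}
    (hq : q ∈ semiInvariants G 1) : ∃ a, π a = q := by
  rw [← hπ.range_eq] at hq
  exact hq

theorem _root_.IsQuotientMap.act_eq (hπ : IsQuotientMap G f π) (a : OX) (g : G) :
    act g (π a) = π a := by
  have : π a ∈ semiInvariants G 1 := by rw [← hπ.range_eq]; exact ⟨a, rfl⟩
  exact mem_invariants.1 this g

variable [Fintype G]

/-- The curve is the image of its preimage. -/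
theorem _root_.IsQuotientMap.mem_of_mem_map (hπ : IsQuotientMap G f π) (hfI : f ∈ I) {a : OX}
    (ha : π a ∈ I.map π) : a ∈ I := by
  -- Averaging is linear over the invariants, so it carries the extended ideal back into π(I). The
  -- multiplier c is carried along so that the induction survives multiplication by arbitrary
  -- series.
  have key : ∀ b ∈ I.map π, ∀ c : OC2, ∃ y ∈ I, ∑ g : G, act g (c * b) = π y := by
    intro b hb
    refine Submodule.span_induction (p := fun b _ => ∀ c : OC2, ∃ y ∈ I,
      ∑ g : G, act g (c * b) = π y) ?_ ?_ ?_ ?_ hb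
    · rintro _ ⟨i, hi, rfl⟩ c
      obtain ⟨d, hd⟩ := hπ.exists_eq (sum_act_mem (G := G) c)
      refine ⟨d * i, Ideal.mul_mem_left _ _ hi, ?_⟩
      rw [map_mul, hd, Finset.sum_mul]
      refine Finset.sum_congr rfl fun g _ => ?_
      rw [act_map_mul]
      congr 1
      exact hπ.act_eq i g
    · intro c
      refine ⟨0, zero_mem _, ?_⟩
      simp [← actHom_apply]
    · intro x y _ _ hx hy c
      obtain ⟨x', hx', ex⟩ := hx c
      obtain ⟨y', hy', ey⟩ := hy c
      refine ⟨x' + y', add_mem hx' hy', ?_⟩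
      rw [map_add, ← ex, ← ey, ← Finset.sum_add_distrib]
      simp only [← actHom_apply, mul_add, map_add]
    · intro r x _ hx c
      obtain ⟨x', hx', ex⟩ := hx (c * r)
      exact ⟨x', hx', by rw [← ex, smul_eq_mul, mul_assoc]⟩
  obtain ⟨y, hy, e⟩ := key _ ha 1
  simp only [one_mul, hπ.act_eq, Finset.sum_const, Finset.card_univ] at e
  have h0 : π ((Fintype.card G : ℂ) • a - y) = 0 := by
    rw [map_sub, map_smul, ← e, Nat.cast_smul_eq_nsmul, sub_self]
  have h1 : (Fintype.card G : ℂ) • a - y ∈ I :=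
    Ideal.mem_of_dvd I (hπ.eq_zero_iff.1 h0) hfI
  have h2 : (Fintype.card G : ℂ) • a ∈ I := by simpa using add_mem h1 hy
  rw [MvPowerSeries.smul_eq_C_mul] at h2
  exact mem_of_C_mul_mem (Nat.cast_ne_zero.2 Fintype.card_ne_zero) h2

/-- The radical in the definition of γ costs nothing: a power of π(a) in the extended ideal descends
to I by averaging, and I is radical. -/
theorem _root_.IsOrbifoldEquation.mem_iff (hγ : IsOrbifoldEquation G ρ π I γ)
    (hπ : IsQuotientMap G f π) (hI : I.IsRadical) (hfI : f ∈ I) {a : OX} : a ∈ I ↔ γ ∣ π a := by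
  rw [← Ideal.mem_span_singleton, hγ.span_eq]
  constructor
  · intro ha
    exact Ideal.le_radical (Ideal.mem_map_of_mem π ha)
  · rintro ⟨n, hn⟩
    rw [← map_pow] at hn
    exact hI ⟨n, hπ.mem_of_mem_map hfI hn⟩

/-- The determinant of the matrix factorisation of a rank one module. -/
theorem _root_.IsMatrixFactorisation.associated_det (hφ : IsMatrixFactorisation G ρ π f φ ψ)
    (hπ : IsQuotientMap G f π) (hf : IsDuVal f) : Associated f φ.det := by
  have hp := hπ.prime hf
  obtain ⟨α, hα, hrel⟩ := hφ.exact_seq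
  have hαmem : ∀ i, α i ∈ semiInvariants G ρ := fun i => by
    rw [hα]
    exact ⟨Pi.single i 1, by fin_cases i <;> simp⟩
  have hdet : φ.det * ψ.det = f ^ 2 := by
    rw [← Matrix.det_mul, hφ.mul_eq, Matrix.det_smul]
    simp
  obtain ⟨k, hk, hassoc⟩ := (dvd_prime_pow hp 2).1 (Dvd.intro _ hdet)
  interval_cases k
  · -- the module would vanish
    exfalso
    rw [pow_zero, associated_one_iff_isUnit] at hassoc
    have hzero : ∀ q ∈ semiInvariants G ρ, q ∈ (⊥ : Ideal OC2) := by
      intro q hq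
      rw [hα] at hq
      obtain ⟨a, rfl⟩ := hq
      refine Ideal.mem_bot.2 ((hrel a).2 ⟨φ⁻¹.mulVec a, ?_⟩)
      rw [Matrix.mulVec_mulVec, Matrix.mul_nonsing_inv _ hassoc, Matrix.one_mulVec]
    have he : (![1, 0] : Fin 2 → ℂ) ≠ 0 := fun h => by simpa using congrFun h 0
    exact orbitProd_ne_zero G he (Ideal.mem_bot.1 (orbitProd_mem hzero ![1, 0]))
  · rw [pow_one] at hassoc
    exact hassoc.symm
  · -- all relations would be trivial
    exfalso
    obtain ⟨u, hu⟩ := hassoc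
    have hψ : IsUnit ψ.det := by
      have hφ0 : φ.det ≠ 0 := left_ne_zero_of_mul (hdet.trans_ne (pow_ne_zero 2 hf.ne_zero))
      rw [mul_left_cancel₀ hφ0 (hdet.trans hu.symm)]
      exact u.isUnit
    have htriv : ∀ a : Fin 2 → OX, ∑ i, π (a i) * α i = 0 → ∀ i, π (a i) = 0 := by
      intro a ha i
      obtain ⟨b, rfl⟩ := (hrel a).1 ha
      rw [hπ.eq_zero_iff]
      have : φ = f • ψ⁻¹ := by
        rw [← Matrix.mul_one φ, ← Matrix.mul_nonsing_inv _ hψ, ← Matrix.mul_assoc, hφ.mul_eq,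
          smul_mul_assoc, one_mul]
      rw [this, Matrix.smul_mulVec]
      exact Dvd.intro _ rfl
    have h0 : α 0 ≠ 0 := by
      intro h0
      have := htriv ![1, 0] (by simp [h0]) 0
      simp at this
    set N := Fintype.card G with hN
    have hN0 : N ≠ 0 := Fintype.card_ne_zero
    have hρ : ∀ g, (ρ g : ℂ) ^ N = 1 := fun g => by
      rw [← Units.val_pow_eq_pow_val, ← map_pow, hN, pow_card_eq_one, map_one, Units.val_one]
    -- Rank one: α₀^(N-1)α₁ · α₀ = α₀^N · α₁ is a relation with invariant coefficients, because the
    -- order N of G kills the values of ρ.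
    obtain ⟨c, hc⟩ := hπ.exists_eq (q := α 0 ^ N) (mem_invariants.2 fun g => by
      rw [act_pow, hαmem 0 g, smul_pow, hρ, one_smul])
    obtain ⟨d, hd⟩ := hπ.exists_eq (q := α 0 ^ (N - 1) * α 1) (mem_invariants.2 fun g => by
      rw [act_map_mul, act_pow, hαmem 0 g, hαmem 1 g, smul_pow, smul_mul_smul_comm, ← pow_succ,
        Nat.sub_add_cancel (Nat.pos_of_ne_zero hN0), hρ, one_smul])
    have h1 : π (-c) = 0 := htriv ![d, -c] (by
      rw [Fin.sum_univ_two]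
      simp only [Matrix.cons_val_zero, Matrix.cons_val_one, map_neg, hc, hd]
      rw [← Nat.sub_add_cancel (Nat.pos_of_ne_zero hN0)]
      simp only [Nat.add_sub_cancel]
      ring) 1
    rw [map_neg, hc, neg_eq_zero] at h1
    exact h0 (pow_eq_zero_iff hN0 |>.1 h1)

/-- A curve in a quotient singularity is cut out by the minors of the resolution of its module of
semi-invariants, extended by the coefficients of the orbifold equation. -/
theorem exists_eq_minorsIdeal (hf : IsDuVal f) (hπ : IsQuotientMap G f π) (hI : I.IsRadical)
    (hfI : f ∈ I) (hγ : IsOrbifoldEquation G ρ π I γ) (hφ : IsMatrixFactorisation G ρ π f φ ψ) :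
    ∃ g h : OX, I = minorsIdeal (augmented φ g h) := by
  have hdet := hφ.associated_det hπ hf
  have hmem := fun a : OX => hγ.mem_iff hπ hI hfI (a := a)
  -- Here I = (f), and the zero column works.
  by_cases hγ0 : γ = 0
  · refine ⟨0, 0, ?_⟩
    rw [minorsIdeal_augmented]
    apply le_antisymm
    · intro a ha
      rw [hmem, hγ0, zero_dvd_iff, hπ.eq_zero_iff] at ha
      exact Ideal.mem_of_dvd _ (hdet.symm.dvd.trans ha) (Ideal.subset_span ⟨0, rfl⟩)
    · rw [Ideal.span_le]
      rintro _ ⟨i, rfl⟩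
      fin_cases i
      · exact Ideal.mem_of_dvd _ hdet.dvd hfI
      · simp [minorL]
      · simp [minorR]
  obtain ⟨α, hα, hrel⟩ := hφ.exact_seq
  obtain ⟨c, hc⟩ : ∃ c : Fin 2 → OX, ∑ i, π (c i) * α i = γ := by
    have := hγ.semiInvariant
    rw [hα] at this
    exact this
  have hcol : ∀ j, π (φ 0 j) * α 0 + π (φ 1 j) * α 1 = 0 := by
    intro j
    have := (hrel (fun i => φ i j)).2 ⟨Pi.single j 1, by ext i; simp⟩
    rwa [Fin.sum_univ_two] at this
  rw [Fin.sum_univ_two] at hc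
  refine ⟨c 0, c 1, ?_⟩
  rw [minorsIdeal_augmented]
  have hgen : ∀ i, (![φ.det, minorL φ (c 0) (c 1), minorR φ (c 0) (c 1)] : Fin 3 → OX) i ∈
      Ideal.span (Set.range ![φ.det, minorL φ (c 0) (c 1), minorR φ (c 0) (c 1)]) := fun i =>
    Ideal.subset_span ⟨i, rfl⟩
  apply le_antisymm
  · intro a ha
    obtain ⟨q, hq⟩ := (hmem a).1 ha
    have hqact : ∀ g : G, act g q = ((ρ g)⁻¹ : ℂˣ).val • q := by
      intro g
      have h1 := hπ.act_eq a g
      rw [hq, act_map_mul, hγ.semiInvariant g, smul_mul_assoc, ← mul_smul_comm] at h1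
      have h2 := mul_left_cancel₀ hγ0 h1
      calc act g q = ((ρ g)⁻¹ : ℂˣ).val • ((ρ g : ℂ) • act g q) := by
            rw [smul_smul, Units.inv_mul, one_smul]
        _ = _ := by rw [h2]
    have hαmem : ∀ i, α i ∈ semiInvariants G ρ := fun i => by
      rw [hα]
      exact ⟨Pi.single i 1, by fin_cases i <;> simp⟩
    choose β hβ using fun i => hπ.exists_eq (mul_mem_invariants (hαmem i) hqact)
    have hd : ∀ j, ∃ d, φ 0 j * β 0 + φ 1 j * β 1 = f * d := by
      intro j
      apply hπ.eq_zero_iff.1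
      rw [map_add, map_mul, map_mul, hβ, hβ]
      linear_combination q * hcol j
    choose d hd using hd
    obtain ⟨u, hu⟩ := hdet
    -- Cramer's rule for the transpose of φ, with the factor f cancelled on both sides.
    have hβu : u * β 0 = φ 1 1 * d 0 - φ 1 0 * d 1 ∧ u * β 1 = φ 0 0 * d 1 - φ 0 1 * d 0 := by
      rw [Matrix.det_fin_two] at hu
      constructor
      · apply mul_left_cancel₀ hf.ne_zero
        linear_combination β 0 * hu + φ 1 1 * hd 0 - φ 1 0 * hd 1
      · apply mul_left_cancel₀ hf.ne_zero
        linear_combination β 1 * hu + φ 0 0 * hd 1 - φ 0 1 * hd 0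
    have hfa : f ∣ a - (c 0 * β 0 + c 1 * β 1) := by
      apply hπ.eq_zero_iff.1
      rw [map_sub, map_add, map_mul, map_mul, hβ, hβ, hq, ← hc]
      ring
    obtain ⟨e, he⟩ := hfa
    apply (Ideal.unit_mul_mem_iff_mem _ u.isUnit).1
    have : ↑u * a = e * φ.det + d 1 * minorL φ (c 0) (c 1) - d 0 * minorR φ (c 0) (c 1) := by
      rw [minorL, minorR, ← hu]
      linear_combination (u : OX) * he + c 0 * hβu.1 + c 1 * hβu.2
    rw [this]
    exact sub_mem (add_mem (Ideal.mul_mem_left _ _ (hgen 0)) (Ideal.mul_mem_left _ _ (hgen 1)))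
      (Ideal.mul_mem_left _ _ (hgen 2))
  -- By the column relations, α₀ and α₁ times the pulled-back minor are multiples of γ, so M_ρ
  -- multiplies it into (γ). Two coprime elements of the ideal generated by M_ρ then give
  -- divisibility of the minor itself.
  · have hdvd : ∀ j, γ ∣ π (φ 0 j * c 1 - φ 1 j * c 0) := by
      intro j
      obtain ⟨a, b, hab⟩ := exists_coprime_orbitProd G
      set p := π (φ 0 j * c 1 - φ 1 j * c 0) with hp
      have hJ : ∀ q ∈ semiInvariants G ρ,
          q ∈ Submodule.comap (LinearMap.mulRight OC2 p) (Ideal.span {γ}) := by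
        intro q hq
        rw [hα] at hq
        obtain ⟨r, rfl⟩ := hq
        rw [Submodule.mem_comap, LinearMap.mulRight_apply, Ideal.mem_span_singleton]
        refine ⟨π (r 1) * π (φ 0 j) - π (r 0) * π (φ 1 j), ?_⟩
        change (∑ i, π (r i) * α i) * p = _
        rw [hp, ← hc, Fin.sum_univ_two, map_sub, map_mul, map_mul]
        linear_combination (π (r 0) * π (c 1) - π (r 1) * π (c 0)) * hcol j
      have hO : ∀ a, γ ∣ orbitProd G a * p := fun a => by
        have := orbitProd_mem hJ a
        rwa [Submodule.mem_comap, LinearMap.mulRight_apply, Ideal.mem_span_singleton] at this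
      exact hab γ p hγ0 (hO a) (hO b)
    rw [Ideal.span_le]
    rintro _ ⟨i, rfl⟩
    fin_cases i
    · exact Ideal.mem_of_dvd _ hdet.dvd hfI
    · exact (hmem _).2 (hdvd 0)
    · exact (hmem _).2 (hdvd 1)

end

end DuVal

theorem lemma2p1
    (G : Subgroup (Matrix.SpecialLinearGroup (Fin 2) ℂ)) [Finite G]
    (f : OX) (hf : IsDuVal f)
    (π : OX →ₐ[ℂ] OC2) (hπ : IsQuotientMap G f π)
    (I : Ideal OX) (hI : IsReducedCurve I) (hfI : f ∈ I)
    (ρ : G →* ℂˣ) (γ : OC2) (hγ : IsOrbifoldEquation G ρ π I γ)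
    (φ ψ : Matrix (Fin 2) (Fin 2) OX) (hφ : IsMatrixFactorisation G ρ π f φ ψ) :
    (∃ g h : OX, I = minorsIdeal (augmented φ g h)) ∧
    (IsGeneralDuValSection I f →
      ∀ g h : OX, I = minorsIdeal (augmented φ g h) →
        g ∈ entriesIdeal φ ∧ h ∈ entriesIdeal φ) := by
  cases nonempty_fintype G
  exact ⟨DuVal.exists_eq_minorsIdeal hf hπ hI.isRadical hfI hγ hφ, fun hgen _ _ h =>
    DuVal.mem_entriesIdeal_of_general hgen (hφ.associated_det hπ hf) h⟩
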